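/- Let $M$ be a $d$-dimensional smooth manifold (Hausdorff, second countable, without boundary) and let $\mathcal A$ be a smooth atlas on $M$. For an open set $\Omega\subseteq\mathbb R^d$, $\mathcal D(\Omega)$ denotes the real-valued smooth compactly supported functions on $\Omega$ and $\mathcal D'(\Omega)$ the space of distributions on $\Omega$. A distribution $t\in\mathcal D'(M)$ is a family of distributions $\phi_*t\in\mathcal D'(\phi(U))$, one for each smooth chart $(U,\phi)$ of $M$, such that for all charts $(U,\phi),(U',\phi')$ one has $\phi'_*t=(\phi\circ\phi'^{-1})^*(\phi_*t)$ on $\phi'(U\cap U')$; here the pull-back of a distribution $s$ by a diffeomorphism $f$ is $(f^*s)(h)=s\big(|\det D(f^{-1})|\;h\circ f^{-1}\big)$. A germ of distributions is a family $F=(F_p)_{p\in M}$ in $\mathcal D'(M)$ such that, for every chart $(U,\phi)$ and every $h\in\mathcal D(\phi(U))$, the map $p\mapsto(\phi_*F_p)(h)$ is Borel measurable on $M$. For $f\in\mathcal D(\Omega)$, $x\in\Omega$ and $\lambda\in(0,1]$ put $f^\lambda_x(y)=\lambda^{-d}f(\lambda^{-1}(y-x))$. Let $\gamma>0$ and let $F$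 be a $\gamma$-coherent germ of distributions on $(M,\mathcal A)$: for every $(U,\phi)\in\mathcal A$ with $U\neq\emptyset$ there is $f\in\mathcal D(\phi(U))$ with $\int f\,dx\neq0$ such that for every compact $K\subset U$ there are $\alpha\le\min\{0,\gamma\}$, $C\in\mathbb R$ and $\eta\in(0,1]$ with $$|(\phi_*F_p-\phi_*F_q)(f^\lambda_{\phi(q)})|\le C\,\lambda^{\alpha}\,\big(|\phi(p)-\phi(q)|+\lambda\big)^{\gamma-\alpha}$$ for all $p,q\in K$ and all $\lambda\in(0,\eta]$ for which $f^\lambda_{\phi(q)}\in\mathcal D(\phi(U))$. Theorem 3.1. There is a unique distribution $\mathcal RF\in\mathcal D'(M)$ such that for every $(U,\phi)\in\mathcal A$, every compact $K\subset U$, every $h\in\mathcal D(\phi(U))$ and every compact $L\subset\phi(U)$ there is a constant $C$ with $$|(\phi_*\mathcal RF-\phi_*F_p)(h^\lambda_{\phi(p)})|\le C\,\lambda^\gamma$$ for all $p\in K$ and all $\lambda\in(0,1]$ such that $h^\lambda_{\phi(p)}$ is supported in $L$. -/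

import Mathlib

open scoped Manifold ContDiff Distributions

noncomputable section

/-- The Euclidean space `ℝ^d`. -/
abbrev Eucl (d : ℕ) : Type := EuclideanSpace ℝ (Fin d)

/-- A local chart `(U, φ)` of the smooth manifold `M`: an element of the maximal smooth atlas,
with `U = c.1.source` and `φ(U) = c.1.target`. -/
abbrev SmoothChart (d : ℕ) (M : Type*) [TopologicalSpace M] [ChartedSpace (Eucl d) M] : Type _ :=
  {e : OpenPartialHomeomorph M (Eucl d) // e ∈ IsManifold.maximalAtlas (𝓡 d) ∞ M}

/-- A set of smooth charts is an atlas when their domains cover the manifold (smooth compatibility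
is automatic inside the maximal atlas). -/
def IsSmoothAtlas {d : ℕ} {M : Type*} [TopologicalSpace M] [ChartedSpace (Eucl d) M]
    (A : Set (SmoothChart d M)) : Prop :=
  ∀ p : M, ∃ c ∈ A, p ∈ c.1.source

/-- The image `φ(U)` of a chart, as an open subset of `ℝ^d`. -/
def SmoothChart.image {d : ℕ} {M : Type*} [TopologicalSpace M] [ChartedSpace (Eucl d) M]
    (c : SmoothChart d M) : TopologicalSpace.Opens (Eucl d) :=
  ⟨c.1.target, c.1.open_target⟩

/-- For charts `c = (U, φ)`, `c' = (U', φ')` and a function `h` supported in `φ'(U ∩ U')`, the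
function on `ℝ^d` equal to `|det D(φ' ∘ φ⁻¹)| · (h ∘ φ' ∘ φ⁻¹)` on `φ(U ∩ U')` and to `0`
elsewhere. The set `φ(U ∩ U')` is the source of the transition map `φ' ∘ φ⁻¹`. -/
def transportTest {d : ℕ} {M : Type*} [TopologicalSpace M] [ChartedSpace (Eucl d) M]
    (c c' : SmoothChart d M) (h : Eucl d → ℝ) : Eucl d → ℝ :=
  (c.1.symm.trans c'.1).source.indicator fun x =>
    |(fderiv ℝ (c.1.symm.trans c'.1) x).det| * h ((c.1.symm.trans c'.1) x)

/-- A distribution on the manifold `M`: a family of distributions `t_{φ(U)} ∈ 𝓓'(φ(U))`, one for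
each local chart, satisfying the overlapping condition
`t_{φ'(U')} = (φ ∘ φ'⁻¹)^* t_{φ(U)}` on `φ'(U ∩ U')`.
The pull-back of a distribution by a diffeomorphism `f` is
`(f^* t)(h) = t (|det D(f⁻¹)| · h ∘ f⁻¹)`; here `g` is that (unique) test function, for
`f = φ ∘ φ'⁻¹`. -/
structure ManifoldDistribution (d : ℕ) (M : Type*) [TopologicalSpace M]
    [ChartedSpace (Eucl d) M] where
  /-- The push-forward `φ_* t = t_{φ(U)}` to the image of a chart. -/
  push : (c : SmoothChart d M) → 𝓓'(c.image, ℝ)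
  overlap : ∀ (c c' : SmoothChart d M) (h : 𝓓(c'.image, ℝ)) (g : 𝓓(c.image, ℝ)),
    tsupport h ⊆ (c'.1.symm.trans c.1).source →
    (g : Eucl d → ℝ) = transportTest c c' h →
    push c' h = push c g

/-- A germ of distributions on `M`: a family `(F_p)` of distributions on `M`, Borel measurable in
`p` when tested against any fixed test function. -/
def IsGerm {d : ℕ} {M : Type*} [TopologicalSpace M] [ChartedSpace (Eucl d) M] [MeasurableSpace M]
    (F : M → ManifoldDistribution d M) : Prop :=
  ∀ (c : SmoothChart d M) (h : 𝓓(c.image, ℝ)), Measurable fun p => (F p).push c h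

/-- The rescaled function `f_x^l (y) = l^{-d} f (l^{-1} (y - x))`. -/
def rescaled {d : ℕ} (f : Eucl d → ℝ) (l : ℝ) (x : Eucl d) : Eucl d → ℝ :=
  fun y => (l ^ d)⁻¹ * f (l⁻¹ • (y - x))

/-- `F` is `γ`-coherent with respect to the atlas `A`. For each (nonempty) chart there is one test
function `f` with nonzero integral such that for every compact `K ⊆ U` the bound
`|(φ_* F_p - φ_* F_q)(f_{φ(q)}^l)| ≤ C l^a (|φ(p) - φ(q)| + l)^(γ - a)` holds for `p, q ∈ K`,
some `a ≤ min {0, γ}` and all `l ∈ (0, η]`. The number `η ∈ (0, 1]` only serves to keep the support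
of `f_{φ(q)}^l` inside `φ(U)`, where it is a test function `u`. -/
def IsCoherent {d : ℕ} {M : Type*} [TopologicalSpace M] [ChartedSpace (Eucl d) M]
    (A : Set (SmoothChart d M)) (γ : ℝ) (F : M → ManifoldDistribution d M) : Prop :=
  ∀ c ∈ A, c.1.source.Nonempty →
    ∃ f : 𝓓(c.image, ℝ), (∫ x, f x) ≠ 0 ∧
      ∀ K : Set M, IsCompact K → K ⊆ c.1.source →
        ∃ a : ℝ, a ≤ min 0 γ ∧ ∃ C : ℝ, ∃ η : ℝ, 0 < η ∧ η ≤ 1 ∧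
          ∀ p ∈ K, ∀ q ∈ K, ∀ l : ℝ, 0 < l → l ≤ η →
            ∀ u : 𝓓(c.image, ℝ), (u : Eucl d → ℝ) = rescaled f l (c.1 q) →
              |(F p).push c u - (F q).push c u|
                ≤ C * (l ^ a * (dist (c.1 p) (c.1 q) + l) ^ (γ - a))

/-- `R` satisfies the reconstruction bound `|(φ_* R - φ_* F_p)(h_{φ(p)}^l)| ≤ C l^γ` in every chart
of `A`, for every compact `K ⊆ U` and every `h ∈ 𝓓(φ(U))`, uniformly for `p ∈ K` and `l ∈ (0, 1]`
as long as `h_{φ(p)}^l` is a test function `u` supported in a given compact set `L ⊆ φ(U)`. If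
`φ(U) = ℝ^d`, one choice of `L` contains all these supports. In general, every choice of `L`
that is a neighbourhood of `φ(K)` contains them for all small `l`. -/
def IsReconstruction {d : ℕ} {M : Type*} [TopologicalSpace M] [ChartedSpace (Eucl d) M]
    (A : Set (SmoothChart d M)) (γ : ℝ) (F : M → ManifoldDistribution d M)
    (R : ManifoldDistribution d M) : Prop :=
  ∀ c ∈ A, ∀ K : Set M, IsCompact K → K ⊆ c.1.source →
    ∀ h : 𝓓(c.image, ℝ), ∀ L : Set (Eucl d), IsCompact L → L ⊆ c.1.target →
      ∃ C : ℝ, ∀ p ∈ K, ∀ l : ℝ, 0 < l → l ≤ 1 →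
        ∀ u : 𝓓(c.image, ℝ), (u : Eucl d → ℝ) = rescaled h l (c.1 p) → tsupport u ⊆ L →
          |R.push c u - (F p).push c u| ≤ C * l ^ γ

end

/-!
# Reconstruction of coherent germs of distributions on manifolds

**In one chart.** Fix a compact subset `K` of the image of a chart of the atlas. A linear
combination of rescalings of the given test function `f` is a kernel `φ` with `∫ φ = 1` and enough
vanishing moments (`exists_kernel_of_order`), and coherence passes from `f` to `φ`. With `φ^ε_y`
denoting `rescaled φ ε y`, the reconstruction is
`R(u) = F_x(u) + lim ∫∫ (F_z - F_x)(φ^ε_y) φ^{2ε}(y - z) u(z) dy dz` along `ε = 2^{-n}`. Testing a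
distribution against translates of `φ` commutes with convolution, so the two scales in this integral
may be exchanged (`CoherentOn.pairing_comm`). Passing from `ε` to `ε / 2` therefore amounts to
replacing the inner kernel `φ^{2ε}` by `φ^{ε/2}`, which costs only `O(ε^γ)`
(`CoherentOn.abs_pairing_sub_le`): splitting `F_z - F_x` at `y`, the part `F_z - F_y` is `O(ε^γ)` by
coherence as `|y - z| = O(ε)`, and the part `F_y - F_x` does not depend on `z`, hence is integrated
against `(φ^{ε/2} - φ^{2ε}) ⋆ u`, which the moment conditions make small. As `γ > 0`, the limit
exists; summing from the scale `ε` comparable to the scale `l` of `u` on gives the bound `O(l^γ)`.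
The limit does not depend on the base point `x`, because changing `x` only adds a regularization of
`(F_{x'} - F_x)(u)`. The result is `CoherentOn.exists_reconstructsOn`. Its bound holds for all test
functions at scale `l`, not only for the rescalings of a fixed one; this class is stable under
changes of charts (`exists_scaledTest_transportTest`).

**Uniqueness.** A functional of finite order that is `O(ε^γ)`, `γ > 0`, on the bumps `θ^ε_z` with
`∫ θ = 1` is zero at `u`, since `u` is the limit of its averages `∫ u(z) θ^ε_z dz`
(`FiniteOrder.eq_zero_of_rescaled_le`). This applies to the difference of two reconstructions in a
chart of the atlas, and a partition of unity transfers the result to all charts. It applies just as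
well to the difference of two local reconstructions in overlapping charts, which are thus compatible
(`ReconstructsOn.eq_transportTest`).

**Gluing.** The local reconstructions are glued with a smooth partition of unity (`Patches.glue`).
By compatibility, the result agrees in each chart of the atlas with every local reconstruction there
(`Patches.glue_eq`), and so inherits the bound.
-/

namespace GermReconstruction

open MeasureTheory Metric Set Filter Topology

noncomputable section

section

variable {d : ℕ} {V : Type*} [NormedAddCommGroup V] [NormedSpace ℝ V]

/-! ### Test functions and functionals of finite order -/

/-- A real test function on `ℝ^d`: smooth with compact support. -/
def IsTest (u : Eucl d → ℝ) : Prop := ContDiff ℝ ∞ u ∧ HasCompactSupport u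

/-- All derivatives of `u` of order at most `N` are bounded by `B` on the whole space. -/
def DerivBound (N : ℕ) (B : ℝ) (u : Eucl d → V) : Prop :=
  ∀ k ≤ N, ∀ x, ‖iteratedFDeriv ℝ k u x‖ ≤ B

/-- A functional on functions `ℝ^d → ℝ` which, restricted to test functions, is a distribution of
finite order, with a bound that is uniform over the whole space. Its values away from test functions
are irrelevant. -/
structure FiniteOrder (T : (Eucl d → ℝ) → ℝ) : Prop where
  add : ∀ ⦃u v⦄, IsTest u → IsTest v → T (u + v) = T u + T v
  smul : ∀ (c : ℝ) ⦃u⦄, IsTest u → T (c • u) = c * T u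
  bound : ∃ (N : ℕ) (C : ℝ), 0 ≤ C ∧ ∀ u B, IsTest u → DerivBound N B u → |T u| ≤ C * B

namespace IsTest

variable {u v : Eucl d → ℝ}

lemma add (hu : IsTest u) (hv : IsTest v) : IsTest (u + v) := ⟨hu.1.add hv.1, hu.2.add hv.2⟩

lemma smul (c : ℝ) (hu : IsTest u) : IsTest (c • u) :=
  ⟨hu.1.const_smul c, hu.2.smul_left (f := fun _ => c)⟩

lemma neg (hu : IsTest u) : IsTest (-u) := ⟨hu.1.neg, hu.2.neg⟩

lemma sub (hu : IsTest u) (hv : IsTest v) : IsTest (u - v) := by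
  rw [sub_eq_add_neg]; exact hu.add hv.neg

lemma zero : IsTest (0 : Eucl d → ℝ) := ⟨contDiff_const, HasCompactSupport.zero⟩

lemma sum {ι : Type*} (s : Finset ι) {f : ι → Eucl d → ℝ} (h : ∀ i ∈ s, IsTest (f i)) :
    IsTest (∑ i ∈ s, f i) := by
  classical
  induction s using Finset.induction_on with
  | empty => simpa using zero
  | insert i s hi ih =>
    rw [Finset.sum_insert hi]
    exact (h i (by simp)).add (ih fun j hj => h j (by simp [hj]))

lemma comp_sub (hu : IsTest u) (y : Eucl d) : IsTest fun x => u (x - y) := by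
  refine ⟨hu.1.comp (contDiff_id.sub contDiff_const), ?_⟩
  exact hu.2.comp_homeomorph (Homeomorph.subRight y)

lemma continuous (hu : IsTest u) : Continuous u := hu.1.continuous

lemma integrable (hu : IsTest u) : Integrable u :=
  hu.continuous.integrable_of_hasCompactSupport hu.2

end IsTest

lemma exists_derivBound {u : Eucl d → V} (hu : ContDiff ℝ ∞ u) (hc : HasCompactSupport u) (N : ℕ) :
    ∃ B, 0 ≤ B ∧ DerivBound N B u := by
  have h : ∀ k : ℕ, ∃ B, ∀ x, ‖iteratedFDeriv ℝ k u x‖ ≤ B := fun k =>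
    (hu.continuous_iteratedFDeriv (m := k) (by exact_mod_cast le_top)).bounded_above_of_compact_support
      (hc.iteratedFDeriv k)
  choose B hB using h
  refine ⟨∑ k ∈ Finset.range (N + 1), |B k|, Finset.sum_nonneg fun _ _ => abs_nonneg _,
    fun k hk x => (hB k x).trans ((le_abs_self _).trans ?_)⟩
  exact Finset.single_le_sum (f := fun k => |B k|) (fun _ _ => abs_nonneg _)
    (Finset.mem_range.2 (by omega))

lemma DerivBound.nonneg {N : ℕ} {B : ℝ} {u : Eucl d → V} (h : DerivBound N B u) : 0 ≤ B :=
  (norm_nonneg _).trans (h 0 (Nat.zero_le _) 0)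

namespace FiniteOrder

variable {T S : (Eucl d → ℝ) → ℝ} {u v : Eucl d → ℝ}

lemma zero (hT : FiniteOrder T) : T 0 = 0 := by
  simpa using hT.smul 0 IsTest.zero

lemma sub_apply (hT : FiniteOrder T) (hu : IsTest u) (hv : IsTest v) : T (u - v) = T u - T v := by
  have h : u - v = u + (-1 : ℝ) • v := by simp [sub_eq_add_neg]
  rw [h, hT.add hu (hv.smul _), hT.smul _ hv]; ring

lemma sum_apply (hT : FiniteOrder T) {ι : Type*} (s : Finset ι) {f : ι → Eucl d → ℝ}
    (h : ∀ i ∈ s, IsTest (f i)) : T (∑ i ∈ s, f i) = ∑ i ∈ s, T (f i) := by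
  classical
  induction s using Finset.induction_on with
  | empty => simpa using hT.zero
  | insert i s hi ih =>
    rw [Finset.sum_insert hi, Finset.sum_insert hi, hT.add (h i (by simp))
      (IsTest.sum s fun j hj => h j (by simp [hj])), ih fun j hj => h j (by simp [hj])]

lemma sub (hT : FiniteOrder T) (hS : FiniteOrder S) : FiniteOrder fun u => T u - S u where
  add u v hu hv := by simp only [hT.add hu hv, hS.add hu hv]; ring
  smul c u hu := by simp only [hT.smul c hu, hS.smul c hu]; ring
  bound := by
    obtain ⟨N, C, hC, h⟩ := hT.bound
    obtain ⟨N', C', hC', h'⟩ := hS.bound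
    refine ⟨max N N', C + C', by positivity, fun u B hu hB => ?_⟩
    have h1 := h u B hu fun k hk => hB k (hk.trans (le_max_left _ _))
    have h2 := h' u B hu fun k hk => hB k (hk.trans (le_max_right _ _))
    calc |T u - S u| ≤ |T u| + |S u| := abs_sub _ _
      _ ≤ (C + C') * B := by linarith

end FiniteOrder

/-! ### Averages of translates -/

/-- Differentiation under the integral sign for averages of translates. -/
lemma iteratedFDeriv_integral_translate [CompleteSpace V] {χ : Eucl d → ℝ} (hχ : Integrable χ)
    {s : Eucl d → Eucl d} (hs : Measurable s) {u : Eucl d → V} (hu : ContDiff ℝ ∞ u)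
    (hc : HasCompactSupport u) (k : ℕ) :
    iteratedFDeriv ℝ k (fun x => ∫ y, χ y • u (x - s y)) =
      fun x => ∫ y, χ y • iteratedFDeriv ℝ k u (x - s y) := by
  have hint : ∀ (W : Type _) [NormedAddCommGroup W] [NormedSpace ℝ W] (w : Eucl d → W)
      (_ : Continuous w) (_ : HasCompactSupport w) (x : Eucl d),
      Integrable fun y => χ y • w (x - s y) := by
    intro W _ _ w hw hwc x
    obtain ⟨C, hC⟩ := hw.bounded_above_of_compact_support hwc
    have hm : AEStronglyMeasurable (fun y => w (x - s y)) volume :=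
      (hw.stronglyMeasurable_of_hasCompactSupport hwc).comp_measurable (measurable_const.sub hs)
        |>.aestronglyMeasurable
    refine (hχ.norm.mul_const C).mono' (hχ.1.smul hm) (ae_of_all _ fun y => ?_)
    rw [norm_smul]
    exact mul_le_mul_of_nonneg_left (hC _) (norm_nonneg _)
  induction k with
  | zero =>
    ext x m
    rw [ContinuousMultilinearMap.integral_apply (hint _ _
      (hu.continuous_iteratedFDeriv (m := 0) (by exact_mod_cast le_top)) (hc.iteratedFDeriv 0) x)]
    simp
  | succ k ih =>
    rw [iteratedFDeriv_succ_eq_comp_left, ih]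
    have hk : ContDiff ℝ 1 (iteratedFDeriv ℝ k u) :=
      hu.iteratedFDeriv_right (m := 1) (by exact_mod_cast le_top)
    have hck : HasCompactSupport (iteratedFDeriv ℝ k u) := hc.iteratedFDeriv k
    obtain ⟨C, hC⟩ := (hk.continuous_fderiv one_ne_zero).bounded_above_of_compact_support
      (hck.fderiv ℝ)
    ext1 x
    have hd : HasFDerivAt (fun x => ∫ y, χ y • iteratedFDeriv ℝ k u (x - s y))
        (∫ y, χ y • fderiv ℝ (iteratedFDeriv ℝ k u) (x - s y)) x := by
      refine hasFDerivAt_integral_of_dominated_of_fderiv_le (s := univ)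
        (F' := fun x y => χ y • fderiv ℝ (iteratedFDeriv ℝ k u) (x - s y))
        (bound := fun y => ‖χ y‖ * C) univ_mem ?_ ?_ ?_ ?_ ?_ ?_
      · exact Eventually.of_forall fun x => (hint _ _ hk.continuous hck x).1
      · exact hint _ _ hk.continuous hck x
      · exact (hint _ _ (hk.continuous_fderiv one_ne_zero) (hck.fderiv ℝ) x).1
      · refine ae_of_all _ fun y x _ => ?_
        rw [norm_smul]
        exact mul_le_mul_of_nonneg_left (hC _) (norm_nonneg _)
      · exact hχ.norm.mul_const C
      · refine ae_of_all _ fun y x _ => ?_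
        have h1 := (hk.differentiable one_ne_zero (x - s y)).hasFDerivAt
        have h2 : HasFDerivAt (fun x : Eucl d => x - s y) (ContinuousLinearMap.id ℝ _) x :=
          (hasFDerivAt_id x).sub_const _
        have h3 := (h1.comp x h2).const_smul (χ y)
        rwa [ContinuousLinearMap.comp_id] at h3
    rw [Function.comp_apply, hd.fderiv]
    have h1 := hint _ _ (hk.continuous_fderiv one_ne_zero) (hck.fderiv ℝ) x
    have h2 := hint _ _ (hu.continuous_iteratedFDeriv (m := k + 1) (by exact_mod_cast le_top))
      (hc.iteratedFDeriv (k + 1)) x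
    ext m
    rw [continuousMultilinearCurryLeftEquiv_symm_apply, ContinuousLinearMap.integral_apply h1,
      ContinuousMultilinearMap.integral_apply (h1.apply_continuousLinearMap _),
      ContinuousMultilinearMap.integral_apply h2]
    rfl

end

section

variable {d : ℕ} {V : Type*} [NormedAddCommGroup V] [NormedSpace ℝ V]

lemma DerivBound.norm_iteratedFDeriv_sub_le {N : ℕ} {B : ℝ} {u : Eucl d → V}
    (h : DerivBound (N + 1) B u) (hu : ContDiff ℝ ∞ u) {k : ℕ} (hk : k ≤ N) (x y : Eucl d) :
    ‖iteratedFDeriv ℝ k u x - iteratedFDeriv ℝ k u y‖ ≤ B * ‖x - y‖ := by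
  have hd : ContDiff ℝ 1 (iteratedFDeriv ℝ k u) :=
    hu.iteratedFDeriv_right (m := 1) (by exact_mod_cast le_top)
  refine Convex.norm_image_sub_le_of_norm_fderiv_le (𝕜 := ℝ) (s := univ)
    (fun z _ => hd.differentiable one_ne_zero z) (fun z _ => ?_) convex_univ (mem_univ _) (mem_univ _)
  rw [norm_fderiv_iteratedFDeriv]
  exact h _ (by omega) z

lemma isTest_average {χ θ : Eucl d → ℝ} (hχ : Continuous χ) (hχc : HasCompactSupport χ)
    (hθ : IsTest θ) : IsTest fun x => ∫ y, χ y * θ (x - y) := by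
  have h : (fun x => ∫ y, χ y * θ (x - y)) =
      convolution χ θ (ContinuousLinearMap.lsmul ℝ ℝ) volume := by
    ext x; simp [convolution]
  rw [h]
  exact ⟨hθ.2.contDiff_convolution_right _ hχ.locallyIntegrable hθ.1, hχc.convolution _ hθ.2⟩

/-- On a compact set the identity is uniformly approximated by simple functions. -/
lemma exists_simpleFunc_dist_le {K : Set (Eucl d)} (hK : IsCompact K) {δ : ℝ} (hδ : 0 < δ) :
    ∃ σ : SimpleFunc (Eucl d) (Eucl d), ∀ y ∈ K, ‖y - σ y‖ ≤ δ := by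
  obtain ⟨t, ht⟩ := hK.elim_finite_subcover (fun n : ℕ => ball (TopologicalSpace.denseSeq (Eucl d) n) δ)
    (fun n => isOpen_ball) (fun y _ => by
      obtain ⟨z, hz, n, rfl⟩ := (TopologicalSpace.denseRange_denseSeq (Eucl d)).exists_dist_lt y hδ |>.imp
        fun n hn => (⟨hn, n, rfl⟩ : _ ∧ ∃ m, m = n)
      exact mem_iUnion.2 ⟨n, hz⟩)
  refine ⟨SimpleFunc.nearestPt (TopologicalSpace.denseSeq (Eucl d)) (t.sup id), fun y hy => ?_⟩
  obtain ⟨n, hn, hyn⟩ := mem_iUnion₂.1 (ht hy)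
  have h := SimpleFunc.edist_nearestPt_le (TopologicalSpace.denseSeq (Eucl d)) y (k := n) (N := t.sup id)
    (Finset.le_sup (f := id) hn)
  rw [edist_dist, edist_dist, ENNReal.ofReal_le_ofReal_iff dist_nonneg] at h
  rw [← dist_eq_norm, dist_comm]
  rw [mem_ball, dist_comm] at hyn
  exact h.trans hyn.le

lemma integral_mul_comp_simpleFunc {χ : Eucl d → ℝ} (hχ : Integrable χ)
    (σ : SimpleFunc (Eucl d) (Eucl d)) (h : Eucl d → ℝ) :
    ∫ y, χ y * h (σ y) = ∑ v ∈ σ.range, (∫ y in σ ⁻¹' {v}, χ y) * h v := by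
  have h1 : ∀ y, χ y * h (σ y) = ∑ v ∈ σ.range, (σ ⁻¹' {v}).indicator χ y * h v := by
    intro y
    rw [Finset.sum_eq_single (σ y)]
    · simp
    · intro v _ hv
      rw [indicator_of_notMem (by simpa using hv.symm), zero_mul]
    · intro hy; exact absurd (σ.mem_range_self y) hy
  simp_rw [h1]
  rw [integral_finsetSum]
  · refine Finset.sum_congr rfl fun v _ => ?_
    rw [integral_mul_const, integral_indicator (σ.measurableSet_fiber v)]
  · intro v _
    exact (hχ.indicator (σ.measurableSet_fiber v)).mul_const _

namespace FiniteOrder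

variable {T : (Eucl d → ℝ) → ℝ}

lemma continuous_translate (hT : FiniteOrder T) {θ : Eucl d → ℝ} (hθ : IsTest θ) :
    Continuous fun y => T fun x => θ (x - y) := by
  obtain ⟨N, C, hC, h⟩ := hT.bound
  obtain ⟨B, hB0, hB⟩ := exists_derivBound hθ.1 hθ.2 (N + 1)
  refine LipschitzWith.continuous (K := (C * B).toNNReal) (LipschitzWith.of_dist_le_mul fun y z => ?_)
  rw [Real.dist_eq, Real.coe_toNNReal _ (by positivity),
    ← hT.sub_apply (hθ.comp_sub y) (hθ.comp_sub z), mul_assoc]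
  refine h _ _ ((hθ.comp_sub y).sub (hθ.comp_sub z)) fun k hk x => ?_
  rw [iteratedFDeriv_sub_apply ((hθ.comp_sub y).1.contDiffAt.of_le (by exact_mod_cast le_top))
    ((hθ.comp_sub z).1.contDiffAt.of_le (by exact_mod_cast le_top)),
    iteratedFDeriv_comp_sub, iteratedFDeriv_comp_sub]
  refine (hB.norm_iteratedFDeriv_sub_le hθ.1 hk _ _).trans_eq ?_
  rw [dist_eq_norm, ← norm_neg (y - z)]
  congr 2; abel

/-- A functional of finite order commutes with averages of translates of a test function. The
average is approximated by Riemann sums, that is, by the averages along a simple function close to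
the identity, for which the statement is linearity. -/
theorem apply_average (hT : FiniteOrder T) {χ θ : Eucl d → ℝ} (hθ : IsTest θ) (hχ : Continuous χ)
    (hχc : HasCompactSupport χ) :
    T (fun x => ∫ y, χ y * θ (x - y)) = ∫ y, χ y * T fun x => θ (x - y) := by
  obtain ⟨N, C, hC, h⟩ := hT.bound
  obtain ⟨B, hB0, hB⟩ := exists_derivBound hθ.1 hθ.2 (N + 1)
  have hχi : Integrable χ := hχ.integrable_of_hasCompactSupport hχc
  set I : ℝ := ∫ y, ‖χ y‖ with hI
  have hI0 : 0 ≤ I := integral_nonneg fun _ => norm_nonneg _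
  have key : ∀ δ > 0, |T (fun x => ∫ y, χ y * θ (x - y)) - ∫ y, χ y * T fun x => θ (x - y)| ≤
      2 * (C * (B * δ * I)) := by
    intro δ hδ
    obtain ⟨σ, hσ⟩ := exists_simpleFunc_dist_le hχc.isCompact hδ
    have hw : (fun x => ∫ y, χ y * θ (x - σ y)) =
        ∑ v ∈ σ.range, (∫ y in σ ⁻¹' {v}, χ y) • fun x => θ (x - v) := by
      ext x
      rw [integral_mul_comp_simpleFunc hχi σ fun v => θ (x - v)]
      simp [Finset.sum_apply]
    have hwt : IsTest fun x => ∫ y, χ y * θ (x - σ y) := by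
      rw [hw]; exact IsTest.sum _ fun v _ => (hθ.comp_sub v).smul _
    have hTw : T (fun x => ∫ y, χ y * θ (x - σ y)) = ∫ y, χ y * T fun x => θ (x - σ y) := by
      rw [hw, hT.sum_apply _ fun v _ => (hθ.comp_sub v).smul _,
        integral_mul_comp_simpleFunc hχi σ fun v => T fun x => θ (x - v)]
      exact Finset.sum_congr rfl fun v _ => hT.smul _ (hθ.comp_sub v)
    have hdiff : ∀ y, χ y ≠ 0 → ‖y - σ y‖ ≤ δ := fun y hy => hσ y (subset_tsupport _ hy)
    have hat := isTest_average hχ hχc hθ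
    have e1 : |T (fun x => ∫ y, χ y * θ (x - y)) - T (fun x => ∫ y, χ y * θ (x - σ y))| ≤
        C * (B * δ * I) := by
      rw [← hT.sub_apply hat hwt]
      refine h _ _ (hat.sub hwt) fun k hk x => ?_
      rw [iteratedFDeriv_sub_apply (hat.1.contDiffAt.of_le (by exact_mod_cast le_top))
        (hwt.1.contDiffAt.of_le (by exact_mod_cast le_top))]
      have a1 := congrFun (iteratedFDeriv_integral_translate hχi measurable_id hθ.1 hθ.2 k) x
      have a2 := congrFun (iteratedFDeriv_integral_translate hχi σ.measurable hθ.1 hθ.2 k) x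
      simp only [smul_eq_mul, id] at a1 a2
      have hi : ∀ s : Eucl d → Eucl d, Measurable s →
          Integrable fun y => χ y • iteratedFDeriv ℝ k θ (x - s y) := by
        intro s hs
        have hm : AEStronglyMeasurable (fun y => iteratedFDeriv ℝ k θ (x - s y)) volume :=
          ((hθ.1.continuous_iteratedFDeriv (m := k)
            (by exact_mod_cast le_top)).stronglyMeasurable_of_hasCompactSupport
              (hθ.2.iteratedFDeriv k)).comp_measurable (measurable_const.sub hs)
            |>.aestronglyMeasurable
        refine (hχi.norm.mul_const B).mono' (hχi.1.smul hm) (ae_of_all _ fun y => ?_)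
        rw [norm_smul]
        exact mul_le_mul_of_nonneg_left (hB k (by omega) _) (norm_nonneg _)
      have hs := integral_sub (hi id measurable_id) (hi σ σ.measurable)
      simp only [id] at hs
      rw [a1, a2, ← hs, hI, ← integral_const_mul]
      refine norm_integral_le_of_norm_le (hχi.norm.const_mul _) (ae_of_all _ fun y => ?_)
      rw [← smul_sub, norm_smul, mul_comm]
      by_cases hy : χ y = 0
      · simp [hy]
      refine mul_le_mul_of_nonneg_right ?_ (norm_nonneg _)
      refine (hB.norm_iteratedFDeriv_sub_le hθ.1 hk _ _).trans ?_
      refine mul_le_mul_of_nonneg_left ?_ hB0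
      rw [← norm_neg, show -(x - y - (x - σ y)) = y - σ y by abel]
      exact hdiff y hy
    have e2 : |(∫ y, χ y * T fun x => θ (x - σ y)) - ∫ y, χ y * T fun x => θ (x - y)| ≤
        C * (B * δ * I) := by
      have i1 : Integrable fun y => χ y * T fun x => θ (x - y) :=
        (hχ.mul (hT.continuous_translate hθ)).integrable_of_hasCompactSupport hχc.mul_right
      have i2 : Integrable fun y => χ y * T fun x => θ (x - σ y) := by
        refine hχi.mul_bdd (c := C * B) ?_ (ae_of_all _ fun y => ?_)
        · exact ((hT.continuous_translate hθ).measurable.comp σ.measurable).aestronglyMeasurable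
        · refine h _ _ (hθ.comp_sub _) fun k hk x => ?_
          rw [iteratedFDeriv_comp_sub]
          exact hB k (by omega) _
      rw [← integral_sub i2 i1, hI, ← integral_const_mul, ← integral_const_mul, ← Real.norm_eq_abs]
      refine norm_integral_le_of_norm_le ((hχi.norm.const_mul _).const_mul _)
        (ae_of_all _ fun y => ?_)
      rw [← mul_sub, norm_mul]
      by_cases hy : χ y = 0
      · simp [hy]
      rw [← hT.sub_apply (hθ.comp_sub _) (hθ.comp_sub _), mul_comm, ← mul_assoc]
      refine mul_le_mul_of_nonneg_right ?_ (norm_nonneg _)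
      refine h _ _ ((hθ.comp_sub _).sub (hθ.comp_sub _)) fun k hk x => ?_
      rw [iteratedFDeriv_sub_apply ((hθ.comp_sub _).1.contDiffAt.of_le (by exact_mod_cast le_top))
        ((hθ.comp_sub _).1.contDiffAt.of_le (by exact_mod_cast le_top)),
        iteratedFDeriv_comp_sub, iteratedFDeriv_comp_sub]
      refine (hB.norm_iteratedFDeriv_sub_le hθ.1 hk _ _).trans ?_
      refine mul_le_mul_of_nonneg_left ?_ hB0
      rw [show x - σ y - (x - y) = y - σ y by abel]
      exact hdiff y hy
    rw [hTw] at e1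
    have := abs_sub_le (T (fun x => ∫ y, χ y * θ (x - y))) (∫ y, χ y * T fun x => θ (x - σ y))
      (∫ y, χ y * T fun x => θ (x - y))
    linarith
  rw [← sub_eq_zero, ← abs_eq_zero]
  refine le_antisymm (le_of_forall_pos_le_add fun ε hε => ?_) (abs_nonneg _)
  have hpos : 0 < 2 * (C * (B * I)) + 1 := by positivity
  refine (key (ε / (2 * (C * (B * I)) + 1)) (by positivity)).trans ?_
  rw [zero_add]
  have : 2 * (C * (B * (ε / (2 * (C * (B * I)) + 1)) * I)) =
      (2 * (C * (B * I))) / (2 * (C * (B * I)) + 1) * ε := by ring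
  rw [this]
  refine mul_le_of_le_one_left hε.le ?_
  rw [div_le_one hpos]; linarith

/-- Exchange of the two kernels in `∫ T(θ(· - y)) χ(y - z) dy = T(θ ⋆ χ(· - z))`, by commutativity
of convolution. -/
lemma integral_translate_comm (hT : FiniteOrder T) {χ θ : Eucl d → ℝ} (hθ : IsTest θ)
    (hχ : IsTest χ) (z : Eucl d) :
    ∫ y, (T fun x => θ (x - y)) * χ (y - z) = ∫ y, (T fun x => χ (x - y)) * θ (y - z) := by
  have h1 := hT.apply_average hθ (hχ.comp_sub z).continuous (hχ.comp_sub z).2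
  have h2 := hT.apply_average hχ (hθ.comp_sub z).continuous (hθ.comp_sub z).2
  simp_rw [mul_comm (T _)]
  rw [← h1, ← h2]
  congr 1
  ext x
  rw [← integral_sub_left_eq_self _ _ (x + z)]
  refine integral_congr_ae (ae_of_all _ fun y => ?_)
  simp only
  rw [mul_comm]
  congr 2 <;> abel

end FiniteOrder

end

section

variable {d : ℕ} {V : Type*} [NormedAddCommGroup V] [NormedSpace ℝ V]

/-! ### Rescaled test functions -/

lemma rescaled_eq_comp_sub (f : Eucl d → ℝ) (l : ℝ) (x : Eucl d) :
    rescaled f l x = fun y => rescaled f l 0 (y - x) := by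
  ext y; simp [rescaled]

lemma IsTest.rescale {f : Eucl d → ℝ} (hf : IsTest f) {l : ℝ} (hl : 0 < l) (x : Eucl d) :
    IsTest (rescaled f l x) := by
  rw [rescaled_eq_comp_sub]
  refine IsTest.comp_sub ?_ x
  have h : rescaled f l 0 = (l ^ d)⁻¹ • fun y => f (l⁻¹ • y) := by ext y; simp [rescaled]
  rw [h]
  exact IsTest.smul _ ⟨hf.1.comp (contDiff_const_smul _), hf.2.comp_smul (by positivity)⟩

lemma rescaled_rescaled (f : Eucl d → ℝ) (a l : ℝ) (x : Eucl d) :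
    rescaled (rescaled f a 0) l x = rescaled f (a * l) x := by
  ext y
  simp only [rescaled, sub_zero, smul_smul, mul_inv_rev, mul_pow]
  rw [mul_comm l⁻¹ a⁻¹]; ring

lemma rescaled_sum {ι : Type*} (s : Finset ι) (c : ι → ℝ) (f : ι → Eucl d → ℝ) (l : ℝ)
    (x : Eucl d) :
    rescaled (∑ i ∈ s, c i • f i) l x = ∑ i ∈ s, c i • rescaled (f i) l x := by
  ext y
  simp only [rescaled, Finset.sum_apply, Pi.smul_apply, smul_eq_mul, Finset.mul_sum]
  exact Finset.sum_congr rfl fun i _ => by ring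

lemma norm_sub_le_of_rescaled_ne_zero {f : Eucl d → ℝ} {ρ : ℝ}
    (hf : ∀ y, f y ≠ 0 → ‖y‖ ≤ ρ) {l : ℝ} (hl : 0 < l) {x y : Eucl d}
    (h : rescaled f l x y ≠ 0) : ‖y - x‖ ≤ ρ * l := by
  have := hf _ (right_ne_zero_of_mul h)
  rwa [norm_smul, norm_inv, Real.norm_of_nonneg hl.le, inv_mul_le_iff₀ hl, mul_comm] at this

lemma exists_norm_le_of_hasCompactSupport {f : Eucl d → ℝ} (hf : HasCompactSupport f) :
    ∃ ρ, 0 < ρ ∧ ∀ y, f y ≠ 0 → ‖y‖ ≤ ρ := by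
  obtain ⟨ρ, hρ0, hρ⟩ := hf.isCompact.isBounded.exists_pos_norm_le
  exact ⟨ρ, hρ0, fun y hy => hρ y (subset_tsupport _ hy)⟩

/-- Change of variables `y = l t`. -/
lemma integral_rescaled_smul (f : Eucl d → ℝ) {l : ℝ} (hl : 0 < l) (g : Eucl d → V) :
    ∫ y, rescaled f l 0 y • g y = ∫ t, f t • g (l • t) := by
  have h := Measure.integral_comp_inv_smul volume (fun t => f t • g (l • t)) l
  have e : ∀ y, rescaled f l 0 y • g y = (l ^ d)⁻¹ • (f (l⁻¹ • y) • g (l • l⁻¹ • y)) := by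
    intro y
    simp only [rescaled, sub_zero, smul_smul, mul_inv_cancel₀ hl.ne', one_smul]
  simp_rw [e]
  rw [integral_smul, h, finrank_euclideanSpace_fin, abs_of_pos (by positivity), smul_smul,
    inv_mul_cancel₀ (by positivity), one_smul]

lemma integral_abs_rescaled (f : Eucl d → ℝ) {l : ℝ} (hl : 0 < l) (x : Eucl d) :
    ∫ y, |rescaled f l x y| = ∫ y, |f y| := by
  have h := integral_rescaled_smul (fun y => |f y|) hl fun _ => (1 : ℝ)
  simp only [smul_eq_mul, mul_one] at h
  rw [← h, rescaled_eq_comp_sub, integral_sub_right_eq_self fun y => |rescaled f l 0 y|]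
  refine integral_congr_ae (ae_of_all _ fun y => ?_)
  simp only [rescaled, abs_mul]
  rw [abs_of_pos (by positivity)]

/-! ### Regularization by convolution -/

/-- The convolution of real functions on `ℝ^d`, written so that the kernel comes first. -/
def smear (κ u : Eucl d → ℝ) : Eucl d → ℝ := fun x => ∫ t, κ t * u (x - t)

lemma smear_comm (κ u : Eucl d → ℝ) : smear κ u = smear u κ := by
  ext x
  simp only [smear]
  rw [← integral_sub_left_eq_self _ _ x]
  refine integral_congr_ae (ae_of_all _ fun y => ?_)
  simp only [sub_sub_cancel]
  ring

lemma IsTest.smear {κ u : Eucl d → ℝ} (hκ : IsTest κ) (hu : IsTest u) : IsTest (smear κ u) :=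
  isTest_average hκ.continuous hκ.2 hu

lemma iteratedFDeriv_smear {κ u : Eucl d → ℝ} (hκ : IsTest κ) (hu : IsTest u) (k : ℕ)
    (x : Eucl d) : iteratedFDeriv ℝ k (smear κ u) x = ∫ t, κ t • iteratedFDeriv ℝ k u (x - t) :=
  congrFun (iteratedFDeriv_integral_translate hκ.integrable measurable_id hu.1 hu.2 k) x

lemma DerivBound.smear {κ u : Eucl d → ℝ} (hκ : IsTest κ) (hu : IsTest u) {N : ℕ} {B : ℝ}
    (hB : DerivBound N B u) : DerivBound N ((∫ t, |κ t|) * B) (smear κ u) := by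
  intro k hk x
  rw [iteratedFDeriv_smear hκ hu, ← integral_mul_const]
  refine norm_integral_le_of_norm_le (hκ.integrable.norm.mul_const _) (ae_of_all _ fun t => ?_)
  rw [norm_smul]
  exact mul_le_mul_of_nonneg_left (hB k hk _) (norm_nonneg _)

/-- Convolution with the rescaled kernel `φ^ε`, `∫ φ = 1`, is within `O(ε)` of the identity in
every `C^N` norm. -/
lemma derivBound_smear_rescaled_sub {φ : Eucl d → ℝ} (hφ : IsTest φ) (h1 : ∫ t, φ t = 1) {ρ : ℝ}
    (hρ : ∀ y, φ y ≠ 0 → ‖y‖ ≤ ρ) {u : Eucl d → ℝ} (hu : IsTest u) {N : ℕ} {B : ℝ}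
    (hB : DerivBound (N + 1) B u) {ε : ℝ} (hε : 0 < ε) :
    DerivBound N ((∫ t, |φ t|) * (B * (ρ * ε))) (smear (rescaled φ ε 0) u - u) := by
  intro k hk x
  have hφε := hφ.rescale hε (0 : Eucl d)
  have hcont := hu.1.continuous_iteratedFDeriv (m := k) (by exact_mod_cast le_top)
  have hone : ∫ t, rescaled φ ε 0 t = 1 := by
    simpa [h1] using integral_rescaled_smul φ hε fun _ => (1 : ℝ)
  rw [iteratedFDeriv_sub_apply ((hφε.smear hu).1.contDiffAt.of_le (by exact_mod_cast le_top))
    (hu.1.contDiffAt.of_le (by exact_mod_cast le_top)), iteratedFDeriv_smear hφε hu]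
  have e : iteratedFDeriv ℝ k u x = ∫ t, rescaled φ ε 0 t • iteratedFDeriv ℝ k u x := by
    rw [integral_smul_const, hone, one_smul]
  have hi : Integrable fun t => rescaled φ ε 0 t • iteratedFDeriv ℝ k u (x - t) :=
    (hφε.continuous.smul (hcont.comp (continuous_const.sub continuous_id))
      ).integrable_of_hasCompactSupport hφε.2.smul_right
  rw [e, ← integral_sub hi (hφε.integrable.smul_const _), ← integral_abs_rescaled φ hε 0, ← integral_mul_const]
  refine norm_integral_le_of_norm_le (hφε.integrable.norm.mul_const _) (ae_of_all _ fun t => ?_)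
  rw [← smul_sub, norm_smul]
  by_cases ht : rescaled φ ε 0 t = 0
  · simp [ht]
  refine mul_le_mul_of_nonneg_left ?_ (norm_nonneg _)
  refine (hB.norm_iteratedFDeriv_sub_le hu.1 hk _ _).trans ?_
  refine mul_le_mul_of_nonneg_left ?_ hB.nonneg
  have := norm_sub_le_of_rescaled_ne_zero hρ hε ht
  simpa using this

namespace FiniteOrder

variable {T : (Eucl d → ℝ) → ℝ}

lemma apply_smear (hT : FiniteOrder T) {χ θ : Eucl d → ℝ} (hχ : IsTest χ) (hθ : IsTest θ) :
    T (smear χ θ) = ∫ y, χ y * T fun x => θ (x - y) :=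
  hT.apply_average hθ hχ.continuous hχ.2

/-- `T(φ^ε ⋆ (φ^{ε'} ⋆ u))` converges to `T(u)`, at linear rate. -/
lemma abs_smear_smear_sub_le (hT : FiniteOrder T) {φ : Eucl d → ℝ} (hφ : IsTest φ)
    (h1 : ∫ t, φ t = 1) {u : Eucl d → ℝ} (hu : IsTest u) :
    ∃ C, ∀ ε ε' : ℝ, 0 < ε → 0 < ε' →
      |T (smear (rescaled φ ε 0) (smear (rescaled φ ε' 0) u)) - T u| ≤ C * (ε + ε') := by
  obtain ⟨N, C, hC, h⟩ := hT.bound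
  obtain ⟨B, hB0, hB⟩ := exists_derivBound hu.1 hu.2 (N + 1)
  obtain ⟨ρ, hρ0, hρ⟩ := exists_norm_le_of_hasCompactSupport hφ.2
  set I : ℝ := ∫ t, |φ t|
  have hI : 0 ≤ I := integral_nonneg fun _ => abs_nonneg _
  refine ⟨C * (I * (I + 1) * B * ρ), fun ε ε' hε hε' => ?_⟩
  have hε'u := (hφ.rescale hε' (0 : Eucl d)).smear hu
  have b1 := derivBound_smear_rescaled_sub hφ h1 hρ hu hB hε'
  have b2 : DerivBound (N + 1) (I * B) (smear (rescaled φ ε' 0) u) := by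
    have := hB.smear (hφ.rescale hε' 0) hu
    rwa [integral_abs_rescaled φ hε'] at this
  have b3 := derivBound_smear_rescaled_sub hφ h1 hρ hε'u b2 hε
  have k1 := h _ _ (hε'u.sub hu) b1
  have k2 := h _ _ (((hφ.rescale hε (0 : Eucl d)).smear hε'u).sub hε'u) b3
  rw [hT.sub_apply hε'u hu] at k1
  rw [hT.sub_apply ((hφ.rescale hε (0 : Eucl d)).smear hε'u) hε'u] at k2
  refine (abs_sub_le _ (T (smear (rescaled φ ε' 0) u)) _).trans ?_
  have p1 : 0 ≤ C * (I * B * ρ) * ε := by positivity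
  have p2 : 0 ≤ C * (I * I * B * ρ) * ε' := by positivity
  calc _ ≤ C * (I * (I * B * (ρ * ε))) + C * (I * (B * (ρ * ε'))) := add_le_add k2 k1
    _ ≤ C * (I * (I + 1) * B * ρ) * (ε + ε') := by nlinarith

/-- A functional of finite order that is `O(ε^γ)`, `γ > 0`, on the bumps `θ^ε_z` centred in the
support of `u` vanishes at `u`. -/
theorem eq_zero_of_rescaled_le (hT : FiniteOrder T) {θ : Eucl d → ℝ} (hθ : IsTest θ)
    (h1 : ∫ t, θ t = 1) {u : Eucl d → ℝ} (hu : IsTest u) {C γ ε₀ : ℝ} (hγ : 0 < γ) (hε₀ : 0 < ε₀)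
    (h : ∀ z ∈ tsupport u, ∀ ε, 0 < ε → ε ≤ ε₀ → |T (rescaled θ ε z)| ≤ C * ε ^ γ) : T u = 0 := by
  obtain ⟨N, C', hC', hb⟩ := hT.bound
  obtain ⟨B, hB0, hB⟩ := exists_derivBound hu.1 hu.2 (N + 1)
  obtain ⟨ρ, hρ0, hρ⟩ := exists_norm_le_of_hasCompactSupport hθ.2
  set D : ℝ := C' * ((∫ t, |θ t|) * (B * ρ))
  set I : ℝ := ∫ t, |u t|
  have key : ∀ ε, 0 < ε → ε ≤ ε₀ → |T u| ≤ I * (C * ε ^ γ) + D * ε := by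
    intro ε hε hε1
    have hθε := hθ.rescale hε (0 : Eucl d)
    have k1 := hb _ _ ((hθε.smear hu).sub hu) (derivBound_smear_rescaled_sub hθ h1 hρ hu hB hε)
    rw [hT.sub_apply (hθε.smear hu) hu] at k1
    have k2 : |T (smear (rescaled θ ε 0) u)| ≤ I * (C * ε ^ γ) := by
      rw [smear_comm, hT.apply_smear hu hθε, ← integral_mul_const, ← Real.norm_eq_abs]
      refine norm_integral_le_of_norm_le (hu.integrable.norm.mul_const _) (ae_of_all _ fun y => ?_)
      rw [norm_mul]
      by_cases hy : u y = 0
      · simp [hy]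
      refine mul_le_mul_of_nonneg_left ?_ (norm_nonneg _)
      rw [← rescaled_eq_comp_sub]
      exact h y (subset_tsupport _ hy) ε hε hε1
    have k3 := abs_sub_abs_le_abs_sub (T u) (T (smear (rescaled θ ε 0) u))
    rw [abs_sub_comm] at k3
    have : C' * ((∫ t, |θ t|) * (B * (ρ * ε))) = D * ε := by simp only [D]; ring
    linarith
  have hlim : Tendsto (fun ε : ℝ => I * (C * ε ^ γ) + D * ε) (𝓝[>] 0) (𝓝 0) := by
    have : ContinuousAt (fun ε : ℝ => I * (C * ε ^ γ) + D * ε) 0 :=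
      ((((continuousAt_id).rpow_const (Or.inr hγ.le)).const_mul C).const_mul I).add
        (continuousAt_id.const_mul D)
    have h0 : I * (C * (0 : ℝ) ^ γ) + D * 0 = 0 := by simp [Real.zero_rpow hγ.ne']
    have := this.tendsto
    simp only [h0] at this
    exact this.mono_left nhdsWithin_le_nhds
  have : |T u| ≤ 0 := by
    refine ge_of_tendsto hlim ?_
    filter_upwards [Ioc_mem_nhdsGT hε₀] with ε hε using key ε hε.1 hε.2
  exact abs_eq_zero.1 (le_antisymm this (abs_nonneg _))

end FiniteOrder

/-! ### Kernels with vanishing moments -/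

/-- Weights `c` for the nodes `1 / (i + 1)` such that `∑ c_i P(1 / (i + 1)) = P(0)` for all
polynomials `P` of degree less than `r`. -/
lemma exists_extrapolation_weights (r : ℕ) : ∃ c : ℕ → ℝ, ∀ k < r,
    ∑ i ∈ Finset.range r, c i * (1 / ((i : ℝ) + 1)) ^ k = if k = 0 then 1 else 0 := by
  classical
  set v : ℕ → ℝ := fun i => 1 / ((i : ℝ) + 1)
  have hv : Set.InjOn v (Finset.range r) := by
    intro i _ j _ h
    have : (i : ℝ) + 1 = j + 1 := by simpa [v] using h
    exact_mod_cast add_right_cancel this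
  refine ⟨fun i => (Lagrange.basis (Finset.range r) v i).eval 0, fun k hk => ?_⟩
  have h := Lagrange.eq_interpolate (f := (Polynomial.X : Polynomial ℝ) ^ k) hv (by
    rw [Polynomial.degree_X_pow, Finset.card_range]; exact_mod_cast hk)
  have h' := congrArg (Polynomial.eval 0) h
  rw [Lagrange.interpolate_apply, Polynomial.eval_finsetSum] at h'
  simp only [Polynomial.eval_pow, Polynomial.eval_X, Polynomial.eval_mul, Polynomial.eval_C] at h'
  rw [← zero_pow_eq, h']
  exact Finset.sum_congr rfl fun i _ => mul_comm _ _

/-- Extrapolation to `0` of a smooth function along the nodes `ε / (i + 1)`. -/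
lemma abs_extrapolation_sub_le {r : ℕ} (hr : 0 < r) {c : ℕ → ℝ}
    (hc : ∀ k < r, ∑ i ∈ Finset.range r, c i * (1 / ((i : ℝ) + 1)) ^ k = if k = 0 then 1 else 0)
    {g : ℝ → ℝ} (hg : ContDiff ℝ ∞ g) {B : ℝ} (hB : ∀ s, ‖iteratedDeriv r g s‖ ≤ B) {ε : ℝ}
    (hε : 0 < ε) :
    |∑ i ∈ Finset.range r, c i * g (1 / ((i : ℝ) + 1) * ε) - g 0| ≤
      (∑ i ∈ Finset.range r, |c i|) * (B * ε ^ r) := by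
  obtain ⟨n, rfl⟩ := Nat.exists_eq_succ_of_ne_zero hr.ne'
  have hB0 : 0 ≤ B := (norm_nonneg _).trans (hB 0)
  set a : ℕ → ℝ := fun k => (k.factorial : ℝ)⁻¹ * iteratedDerivWithin k g (Icc 0 ε) 0
  have hT : ∀ x ∈ Icc 0 ε, |g x - ∑ k ∈ Finset.range (n + 1), a k * x ^ k| ≤ B * ε ^ (n + 1) := by
    intro x hx
    have h := taylor_mean_remainder_bound (n := n) (C := B) hε.le
      (hg.contDiffOn.of_le (by exact_mod_cast le_top)) hx (fun y hy => by
        rw [iteratedDerivWithin_eq_iteratedDeriv (uniqueDiffOn_Icc hε)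
          (hg.contDiffAt.of_le (by exact_mod_cast le_top)) hy]
        exact hB y)
    rw [taylor_within_apply] at h
    have e : ∑ k ∈ Finset.range (n + 1), a k * x ^ k = ∑ k ∈ Finset.range (n + 1),
        ((k.factorial : ℝ)⁻¹ * (x - 0) ^ k) • iteratedDerivWithin k g (Icc 0 ε) 0 :=
      Finset.sum_congr rfl fun k _ => by simp only [a, smul_eq_mul, sub_zero]; ring
    rw [e]
    refine h.trans ?_
    rw [sub_zero]
    have hf : (1 : ℝ) ≤ n.factorial := by exact_mod_cast Nat.one_le_iff_ne_zero.2 n.factorial_ne_zero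
    refine (div_le_self (by have := hx.1; positivity) hf).trans ?_
    exact mul_le_mul_of_nonneg_left (pow_le_pow_left₀ hx.1 hx.2 _) hB0
  have h0 : g 0 = ∑ i ∈ Finset.range (n + 1), c i *
      ∑ k ∈ Finset.range (n + 1), a k * (1 / ((i : ℝ) + 1) * ε) ^ k := by
    simp_rw [Finset.mul_sum]
    rw [Finset.sum_comm]
    have e : ∀ k ∈ Finset.range (n + 1), ∑ i ∈ Finset.range (n + 1),
        c i * (a k * (1 / ((i : ℝ) + 1) * ε) ^ k) = a k * ε ^ k * if k = 0 then 1 else 0 := by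
      intro k hk
      rw [← hc k (Finset.mem_range.1 hk), Finset.mul_sum]
      exact Finset.sum_congr rfl fun i _ => by rw [mul_pow]; ring
    rw [Finset.sum_congr rfl e, Finset.sum_eq_single 0]
    · simp [a, iteratedDerivWithin_zero]
    · intro k _ hk; simp [hk]
    · simp
  rw [h0, ← Finset.sum_sub_distrib, Finset.sum_mul]
  refine (Finset.abs_sum_le_sum_abs _ _).trans (Finset.sum_le_sum fun i _ => ?_)
  rw [← mul_sub, abs_mul]
  refine mul_le_mul_of_nonneg_left (hT _ ⟨by positivity, ?_⟩) (abs_nonneg _)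
  refine mul_le_of_le_one_left hε.le ?_
  rw [div_le_one (by positivity)]
  linarith [(Nat.cast_nonneg i : (0 : ℝ) ≤ i)]

lemma norm_iteratedDeriv_line_le {r : ℕ} {u : Eucl d → ℝ} (hu : ContDiff ℝ ∞ u) {B : ℝ}
    (hB : ∀ x, ‖iteratedFDeriv ℝ r u x‖ ≤ B) (y w : Eucl d) (s : ℝ) :
    ‖iteratedDeriv r (fun s : ℝ => u (y - s • w)) s‖ ≤ B * ‖w‖ ^ r := by
  set L : ℝ →L[ℝ] Eucl d := ContinuousLinearMap.toSpanSingleton ℝ (-w)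
  have e : (fun s : ℝ => u (y - s • w)) = (fun x => u (x + y)) ∘ L := by
    ext s; simp [L, sub_eq_add_neg, add_comm]
  have hu' : ContDiff ℝ ∞ fun x => u (x + y) := hu.comp (contDiff_id.add contDiff_const)
  rw [← norm_iteratedFDeriv_eq_norm_iteratedDeriv, e,
    L.iteratedFDeriv_comp_right hu' s (by exact_mod_cast le_top), iteratedFDeriv_comp_add_right]
  refine (ContinuousMultilinearMap.norm_compContinuousLinearMap_le _ _).trans ?_
  simp only [Finset.prod_const, Finset.card_univ, Fintype.card_fin]
  have hL : ‖L‖ = ‖w‖ := by simp [L]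
  rw [hL]
  exact mul_le_mul_of_nonneg_right (hB _) (by positivity)

/-- From any test function with nonzero integral, a linear combination of rescalings yields a kernel
of integral one whose convolutions approximate smooth functions to order `r`. -/
theorem exists_kernel_of_order {f : Eucl d → ℝ} (hf : IsTest f) (h0 : ∫ x, f x ≠ 0) {r : ℕ}
    (hr : 0 < r) :
    ∃ c : ℕ → ℝ, ∃ φ : Eucl d → ℝ,
      φ = ∑ i ∈ Finset.range r, c i • rescaled f (1 / ((i : ℝ) + 1)) 0 ∧ IsTest φ ∧
      ∫ x, φ x = 1 ∧ ∃ C, 0 ≤ C ∧ ∀ u : Eucl d → ℝ, IsTest u → ∀ B,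
        (∀ x, ‖iteratedFDeriv ℝ r u x‖ ≤ B) → ∀ ε, 0 < ε → ∀ y,
          |smear (rescaled φ ε 0) u y - u y| ≤ C * (B * ε ^ r) := by
  obtain ⟨c, hc⟩ := exists_extrapolation_weights r
  set I : ℝ := ∫ x, f x with hI
  -- Convolution with `φ^ε` averages `u(y - s w)`, extrapolated in `s` from the nodes
  -- `s = ε / (i + 1)` to `s = 0`, against `f(w) / ∫ f`.
  set φ : Eucl d → ℝ := ∑ i ∈ Finset.range r, (c i / I) • rescaled f (1 / ((i : ℝ) + 1)) 0 with hφ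
  have hpos : ∀ i : ℕ, (0 : ℝ) < 1 / ((i : ℝ) + 1) := fun i => by positivity
  have hφt : IsTest φ := IsTest.sum _ fun i _ => (hf.rescale (hpos i) 0).smul _
  have hfor : ∀ (ε : ℝ), 0 < ε → ∀ u : Eucl d → ℝ, Continuous u → ∀ y,
      smear (rescaled φ ε 0) u y = I⁻¹ * ∫ w, f w * ∑ i ∈ Finset.range r,
        c i * u (y - (1 / ((i : ℝ) + 1) * ε) • w) := by
    intro ε hε u hu y
    have hi : ∀ i : ℕ, Integrable fun t =>
        rescaled f (1 / ((i : ℝ) + 1) * ε) 0 t * u (y - t) := fun i => by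
      have ht := hf.rescale (mul_pos (hpos i) hε) (0 : Eucl d)
      exact (ht.continuous.mul (hu.comp (continuous_const.sub continuous_id))
        ).integrable_of_hasCompactSupport ht.2.mul_right
    have hi' : ∀ i : ℕ, Integrable fun w => f w * u (y - (1 / ((i : ℝ) + 1) * ε) • w) := fun i =>
      (hf.continuous.mul (hu.comp (continuous_const.sub (continuous_const_smul _)))
        ).integrable_of_hasCompactSupport hf.2.mul_right
    have e1 : ∀ t, rescaled φ ε 0 t * u (y - t) = ∑ i ∈ Finset.range r,
        c i / I * (rescaled f (1 / ((i : ℝ) + 1) * ε) 0 t * u (y - t)) := by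
      intro t
      rw [hφ, rescaled_sum]
      simp only [rescaled_rescaled, Finset.sum_apply, Pi.smul_apply, smul_eq_mul, Finset.sum_mul]
      exact Finset.sum_congr rfl fun i _ => by ring
    simp only [smear]
    simp_rw [e1, Finset.mul_sum]
    rw [integral_finsetSum _ fun i _ => (hi i).const_mul _, integral_finsetSum _ fun i _ => by
      have := (hi' i).const_mul (c i)
      refine this.congr (ae_of_all _ fun w => ?_); simp only; ring, Finset.mul_sum]
    refine Finset.sum_congr rfl fun i _ => ?_
    rw [integral_const_mul]
    have := integral_rescaled_smul f (mul_pos (hpos i) hε) fun t => u (y - t)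
    simp only [smul_eq_mul] at this
    rw [this, ← integral_const_mul, ← integral_const_mul]
    refine integral_congr_ae (ae_of_all _ fun w => ?_)
    simp only; ring
  have hsum : ∑ i ∈ Finset.range r, c i = 1 := by simpa using hc 0 hr
  refine ⟨fun i => c i / I, φ, hφ, hφt, ?_, |I⁻¹| * ((∑ i ∈ Finset.range r, |c i|) *
    ∫ w, |f w| * ‖w‖ ^ r), ?_, ?_⟩
  · have h := hfor 1 one_pos (fun _ => 1) continuous_const 0
    have e : smear (rescaled φ 1 0) (fun _ => 1) 0 = ∫ x, φ x := by
      simp [smear, rescaled]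
    rw [e] at h
    simp only [mul_one, hsum] at h
    rw [h, ← hI, inv_mul_cancel₀ h0]
  · have : 0 ≤ ∫ w, |f w| * ‖w‖ ^ r := integral_nonneg fun w => by positivity
    have : 0 ≤ ∑ i ∈ Finset.range r, |c i| := Finset.sum_nonneg fun _ _ => abs_nonneg _
    positivity
  · intro u hu B hB ε hε y
    rw [hfor ε hε u hu.continuous y]
    have e : u y = I⁻¹ * ∫ w, f w * u y := by
      rw [integral_mul_const, ← hI, ← mul_assoc, inv_mul_cancel₀ h0, one_mul]
    have i1 : Integrable fun w => f w * ∑ i ∈ Finset.range r,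
        c i * u (y - (1 / ((i : ℝ) + 1) * ε) • w) :=
      (hf.continuous.mul (continuous_finsetSum _ fun i _ => (hu.continuous.comp
        (continuous_const.sub (continuous_const_smul _))).const_mul _)
        ).integrable_of_hasCompactSupport hf.2.mul_right
    have i2 : Integrable fun w => |f w| * ‖w‖ ^ r :=
      (hf.continuous.abs.mul (continuous_norm.pow r)).integrable_of_hasCompactSupport
        (hf.2.abs.mul_right)
    rw [e, ← mul_sub, ← integral_sub i1 (hf.integrable.mul_const _), abs_mul, mul_assoc]
    refine mul_le_mul_of_nonneg_left ?_ (abs_nonneg _)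
    rw [mul_right_comm, ← integral_const_mul, ← Real.norm_eq_abs]
    refine norm_integral_le_of_norm_le ((i2.const_mul _)) (ae_of_all _ fun w => ?_)
    have hg : ContDiff ℝ ∞ fun s : ℝ => u (y - s • w) :=
      hu.1.comp (contDiff_const.sub (contDiff_id.smul contDiff_const))
    have h := abs_extrapolation_sub_le hr hc hg (norm_iteratedDeriv_line_le hu.1 hB y w) hε
    simp only [zero_smul, sub_zero] at h
    rw [← mul_sub, norm_mul]
    refine (mul_le_mul_of_nonneg_left h (norm_nonneg _)).trans_eq ?_
    rw [Real.norm_eq_abs]; ring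

end

section

variable {d : ℕ}

/-! ### Pairing a germ with a test function at scale `ε` -/

/-- `u` is a test function concentrated at scale `l` around `x`: it is supported in the ball of
radius `B l` and its derivatives up to order `r` have the size `A l^{-d-k}` of those of
`h^l_x`. -/
structure ScaledTest (r : ℕ) (A B l : ℝ) (x : Eucl d) (u : Eucl d → ℝ) : Prop where
  isTest : IsTest u
  tsupport_subset : tsupport u ⊆ closedBall x (B * l)
  bound : ∀ k ≤ r, ∀ y, ‖iteratedFDeriv ℝ k u y‖ ≤ A * (l ^ (d + k))⁻¹

/-- A measurable family of functionals of finite order that satisfies the coherence estimate with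
the kernel `φ` for base points in `K₁` and scales up to `η`. -/
structure CoherentOn (γ a C η : ℝ) (φ : Eucl d → ℝ) (K₁ : Set (Eucl d))
    (F : Eucl d → (Eucl d → ℝ) → ℝ) : Prop where
  finiteOrder : ∀ z, FiniteOrder (F z)
  measurable : ∀ u, IsTest u → Measurable fun z => F z u
  isTest : IsTest φ
  le_min : a ≤ min 0 γ
  nonneg : 0 ≤ C
  bound : ∀ z ∈ K₁, ∀ y ∈ K₁, ∀ ε, 0 < ε → ε ≤ η →
    |F z (rescaled φ ε y) - F y (rescaled φ ε y)| ≤ C * (ε ^ a * (dist z y + ε) ^ (γ - a))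

/-- The kernel average `∫∫ (F_z - F_x)(φ^ε_y) κ(y - z) u(z) dy dz`. For `κ = φ^{2ε}` and `ε → 0` it
tends to `(R - F_x)(u)`, where `R` is the reconstruction of `F`. -/
def pairing (F : Eucl d → (Eucl d → ℝ) → ℝ) (φ : Eucl d → ℝ) (ε : ℝ) (κ : Eucl d → ℝ)
    (x : Eucl d) (u : Eucl d → ℝ) : ℝ :=
  ∫ p : Eucl d × Eucl d, (F p.1 (rescaled φ ε p.2) - F x (rescaled φ ε p.2)) *
    (κ (p.2 - p.1) * u p.1)

lemma integrable_kernel {κ u : Eucl d → ℝ} (hκ : IsTest κ) (hu : IsTest u) :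
    Integrable fun p : Eucl d × Eucl d => κ (p.2 - p.1) * u p.1 := by
  have hc : Continuous fun p : Eucl d × Eucl d => κ (p.2 - p.1) * u p.1 :=
    (hκ.continuous.comp (continuous_snd.sub continuous_fst)).mul (hu.continuous.comp continuous_fst)
  refine hc.integrable_of_hasCompactSupport (HasCompactSupport.intro
    (K := (fun q : Eucl d × Eucl d => (q.2, q.1 + q.2)) '' (tsupport κ ×ˢ tsupport u))
    ((hκ.2.isCompact.prod hu.2.isCompact).image (by fun_prop)) fun p hp => ?_)
  by_contra h
  refine hp ⟨(p.2 - p.1, p.1), ⟨subset_tsupport _ (left_ne_zero_of_mul h),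
    subset_tsupport _ (right_ne_zero_of_mul h)⟩, by simp⟩

lemma integral_abs_kernel {κ u : Eucl d → ℝ} (hκ : IsTest κ) (hu : IsTest u) :
    ∫ p : Eucl d × Eucl d, |κ (p.2 - p.1) * u p.1| = (∫ t, |κ t|) * ∫ z, |u z| := by
  rw [Measure.volume_eq_prod, integral_prod _ (by
    rw [← Measure.volume_eq_prod]; exact (integrable_kernel hκ hu).abs), ← integral_const_mul]
  refine integral_congr_ae (ae_of_all _ fun z => ?_)
  simp only [abs_mul]
  rw [integral_mul_const, integral_sub_right_eq_self fun y => |κ y|]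

lemma integrable_mul_kernel {κ u : Eucl d → ℝ} (hκ : IsTest κ) (hu : IsTest u)
    {H : Eucl d × Eucl d → ℝ} (hH : Measurable H) {M : ℝ}
    (hM : ∀ z y, κ (y - z) ≠ 0 → u z ≠ 0 → |H (z, y)| ≤ M) :
    Integrable fun p : Eucl d × Eucl d => H p * (κ (p.2 - p.1) * u p.1) := by
  have hk := integrable_kernel hκ hu
  refine (hk.abs.const_mul M).mono' (hH.aestronglyMeasurable.mul hk.1) (ae_of_all _ fun p => ?_)
  rw [norm_mul, Real.norm_eq_abs, Real.norm_eq_abs]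
  by_cases h : κ (p.2 - p.1) * u p.1 = 0
  · simp [h]
  · exact mul_le_mul_of_nonneg_right
      (hM _ _ (left_ne_zero_of_mul h) (right_ne_zero_of_mul h)) (abs_nonneg _)

lemma abs_integral_mul_kernel_le {κ u : Eucl d → ℝ} (hκ : IsTest κ) (hu : IsTest u)
    {H : Eucl d × Eucl d → ℝ} {M : ℝ}
    (hM : ∀ z y, κ (y - z) ≠ 0 → u z ≠ 0 → |H (z, y)| ≤ M) :
    |∫ p : Eucl d × Eucl d, H p * (κ (p.2 - p.1) * u p.1)| ≤
      M * ((∫ t, |κ t|) * ∫ z, |u z|) := by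
  rw [← integral_abs_kernel hκ hu, ← integral_const_mul, ← Real.norm_eq_abs]
  refine norm_integral_le_of_norm_le ((integrable_kernel hκ hu).abs.const_mul M)
    (ae_of_all _ fun p => ?_)
  rw [norm_mul, Real.norm_eq_abs, Real.norm_eq_abs]
  by_cases h : κ (p.2 - p.1) * u p.1 = 0
  · simp [h]
  · exact mul_le_mul_of_nonneg_right
      (hM _ _ (left_ne_zero_of_mul h) (right_ne_zero_of_mul h)) (abs_nonneg _)

namespace ScaledTest

variable {r : ℕ} {A B l : ℝ} {x : Eucl d} {u : Eucl d → ℝ}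

lemma nonneg (h : ScaledTest r A B l x u) (hl : 0 < l) : 0 ≤ A := by
  have := (norm_nonneg _).trans (h.bound 0 (Nat.zero_le _) 0)
  exact nonneg_of_mul_nonneg_left this (by positivity)

lemma norm_sub_le (h : ScaledTest r A B l x u) {z : Eucl d} (hz : u z ≠ 0) : ‖z - x‖ ≤ B * l := by
  have := h.tsupport_subset (subset_tsupport _ hz)
  rwa [mem_closedBall, dist_eq_norm] at this

lemma integral_abs_le (h : ScaledTest r A B l x u) (hB : 0 ≤ B) (hl : 0 < l) :
    ∫ z, |u z| ≤ A * (B ^ d * volume.real (ball (0 : Eucl d) 1)) := by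
  have hA := h.nonneg hl
  have hi : IntegrableOn (fun _ => A * (l ^ d)⁻¹) (closedBall x (B * l)) volume :=
    integrableOn_const (measure_closedBall_lt_top.ne)
  calc ∫ z, |u z| ≤ ∫ z, (closedBall x (B * l)).indicator (fun _ => A * (l ^ d)⁻¹) z := by
        refine integral_mono h.isTest.integrable.abs
          (hi.integrable_indicator measurableSet_closedBall) fun z => ?_
        by_cases hz : u z = 0
        · simp only [hz, abs_zero]
          exact indicator_nonneg (fun _ _ => by positivity) _
        · rw [indicator_of_mem (h.tsupport_subset (subset_tsupport _ hz))]
          simpa using h.bound 0 (Nat.zero_le _) z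
    _ = A * (B ^ d * volume.real (ball (0 : Eucl d) 1)) := by
        rw [integral_indicator measurableSet_closedBall, setIntegral_const, measureReal_def,
          Measure.addHaar_closedBall _ _ (by positivity), ENNReal.toReal_mul,
          ENNReal.toReal_ofReal (by positivity), finrank_euclideanSpace_fin, smul_eq_mul,
          measureReal_def, mul_pow]
        field_simp

end ScaledTest

namespace CoherentOn

variable {γ a C η : ℝ} {φ : Eucl d → ℝ} {K K₁ : Set (Eucl d)} {F : Eucl d → (Eucl d → ℝ) → ℝ}

lemma exponent_nonneg (h : CoherentOn γ a C η φ K₁ F) : 0 ≤ γ - a :=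
  sub_nonneg.2 (h.le_min.trans (min_le_right _ _))

lemma measurable_uncurry (h : CoherentOn γ a C η φ K₁ F) {ε : ℝ} (hε : 0 < ε) :
    Measurable fun p : Eucl d × Eucl d => F p.1 (rescaled φ ε p.2) := by
  have := measurable_uncurry_of_continuous_of_measurable
    (u := fun (y z : Eucl d) => F z (rescaled φ ε y)) (fun z => by
      have := (h.finiteOrder z).continuous_translate (h.isTest.rescale hε 0)
      simpa only [← rescaled_eq_comp_sub] using this)
    (fun y => h.measurable _ (h.isTest.rescale hε y))
  exact this.comp measurable_swap

lemma measurable_diff (h : CoherentOn γ a C η φ K₁ F) {ε : ℝ} (hε : 0 < ε) (x : Eucl d) :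
    Measurable fun y => F x (rescaled φ ε y) := by
  have := (h.finiteOrder x).continuous_translate (h.isTest.rescale hε 0)
  simpa only [← rescaled_eq_comp_sub] using this.measurable

lemma bound_near (h : CoherentOn γ a C η φ K₁ F) {z y : Eucl d} (hz : z ∈ K₁) (hy : y ∈ K₁)
    {ε m : ℝ} (hε : 0 < ε) (hεη : ε ≤ η) (hm : 0 ≤ m) (hzy : ‖y - z‖ ≤ m * ε) :
    |F z (rescaled φ ε y) - F y (rescaled φ ε y)| ≤ C * (m + 1) ^ (γ - a) * ε ^ γ := by
  refine (h.bound z hz y hy ε hε hεη).trans ?_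
  rw [mul_assoc]
  refine mul_le_mul_of_nonneg_left ?_ h.nonneg
  have h1 : (dist z y + ε) ^ (γ - a) ≤ ((m + 1) * ε) ^ (γ - a) := by
    refine Real.rpow_le_rpow (by positivity) ?_ h.exponent_nonneg
    rw [dist_comm, dist_eq_norm]; linarith
  refine (mul_le_mul_of_nonneg_left h1 (by positivity)).trans_eq ?_
  rw [Real.mul_rpow (by positivity) hε.le, Real.rpow_sub hε]
  field_simp

lemma bound_far (h : CoherentOn γ a C η φ K₁ F) {x y : Eucl d} (hx : x ∈ K₁) (hy : y ∈ K₁)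
    {ε m l : ℝ} (hε : 0 < ε) (hεη : ε ≤ η) (hm : 0 ≤ m) (hεl : ε ≤ l) (hxy : ‖y - x‖ ≤ m * l) :
    |F y (rescaled φ ε y) - F x (rescaled φ ε y)| ≤
      C * (m + 1) ^ (γ - a) * (ε ^ a * l ^ (γ - a)) := by
  rw [abs_sub_comm]
  refine (h.bound x hx y hy ε hε hεη).trans ?_
  rw [mul_assoc]
  refine mul_le_mul_of_nonneg_left ?_ h.nonneg
  have hl : 0 < l := hε.trans_le hεl
  have h1 : (dist x y + ε) ^ (γ - a) ≤ ((m + 1) * l) ^ (γ - a) := by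
    refine Real.rpow_le_rpow (by positivity) ?_ h.exponent_nonneg
    rw [dist_comm, dist_eq_norm]; linarith
  refine (mul_le_mul_of_nonneg_left h1 (by positivity)).trans_eq ?_
  rw [Real.mul_rpow (by positivity) hl.le]
  ring

variable {δ : ℝ}

lemma integrable_pairing (h : CoherentOn γ a C η φ K₁ F) (hK : IsCompact K)
    (hK₁ : ∀ z ∈ K, ∀ y, ‖y - z‖ ≤ δ → y ∈ K₁) (hδ : 0 < δ) {ε : ℝ} (hε : 0 < ε) (hεη : ε ≤ η)
    {κ u : Eucl d → ℝ} (hκ : IsTest κ) (hκδ : ∀ w, κ w ≠ 0 → ‖w‖ ≤ δ) (hu : IsTest u)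
    (huK : tsupport u ⊆ K) {x : Eucl d} (hx : x ∈ K) :
    Integrable fun p : Eucl d × Eucl d => (F p.1 (rescaled φ ε p.2) - F x (rescaled φ ε p.2)) *
      (κ (p.2 - p.1) * u p.1) := by
  obtain ⟨R, hR0, hR⟩ := hK.isBounded.exists_pos_norm_le
  have hself : ∀ z ∈ K, z ∈ K₁ := fun z hz => hK₁ z hz z (by simpa using hδ.le)
  set b : ℝ := C * (ε ^ a * (2 * R + δ + ε) ^ (γ - a))
  refine integrable_mul_kernel hκ hu (M := b + b)
    ((h.measurable_uncurry hε).sub ((h.measurable_diff hε x).comp measurable_snd)) fun z y h1 h2 => ?_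
  have hzK := huK (subset_tsupport _ h2)
  have hyz := hκδ _ h1
  have hy := hK₁ z hzK y hyz
  have hb : ∀ w ∈ K, |F w (rescaled φ ε y) - F y (rescaled φ ε y)| ≤ b := by
    intro w hw
    refine (h.bound w (hself w hw) y hy ε hε hεη).trans ?_
    refine mul_le_mul_of_nonneg_left (mul_le_mul_of_nonneg_left
      (Real.rpow_le_rpow (by positivity) ?_ h.exponent_nonneg) (by positivity)) h.nonneg
    have e : w - y = (w - z) - (y - z) := by abel
    have := norm_sub_le (w - z) (y - z)
    have := norm_sub_le w z
    rw [dist_eq_norm, e]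
    linarith [hR w hw, hR z hzK]
  have e := abs_sub_le (F z (rescaled φ ε y)) (F y (rescaled φ ε y)) (F x (rescaled φ ε y))
  have e2 := hb x hx
  rw [abs_sub_comm] at e2
  exact e.trans (add_le_add (hb z hzK) e2)

lemma pairing_comm (h : CoherentOn γ a C η φ K₁ F) (hK : IsCompact K)
    (hK₁ : ∀ z ∈ K, ∀ y, ‖y - z‖ ≤ δ → y ∈ K₁) (hδ : 0 < δ) {ε ε' : ℝ} (hε : 0 < ε) (hεη : ε ≤ η)
    (hε' : 0 < ε') (hεη' : ε' ≤ η) {ρ : ℝ} (hρ : ∀ y, φ y ≠ 0 → ‖y‖ ≤ ρ) (h1 : ρ * ε ≤ δ)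
    (h2 : ρ * ε' ≤ δ) {u : Eucl d → ℝ} (hu : IsTest u) (huK : tsupport u ⊆ K) {x : Eucl d}
    (hx : x ∈ K) :
    pairing F φ ε (rescaled φ ε' 0) x u = pairing F φ ε' (rescaled φ ε 0) x u := by
  have hs : ∀ {ε : ℝ}, 0 < ε → ρ * ε ≤ δ → ∀ w, rescaled φ ε 0 w ≠ 0 → ‖w‖ ≤ δ :=
    fun hε h w hw => by simpa using (norm_sub_le_of_rescaled_ne_zero hρ hε hw).trans h
  have i1 := h.integrable_pairing hK hK₁ hδ hε hεη (h.isTest.rescale hε' 0) (hs hε' h2) hu huK hx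
  have i2 := h.integrable_pairing hK hK₁ hδ hε' hεη' (h.isTest.rescale hε 0) (hs hε h1) hu huK hx
  rw [Measure.volume_eq_prod] at i1 i2
  rw [pairing, pairing, Measure.volume_eq_prod, integral_prod _ i1, integral_prod _ i2]
  refine integral_congr_ae (ae_of_all _ fun z => ?_)
  have := ((h.finiteOrder z).sub (h.finiteOrder x)).integral_translate_comm
    (h.isTest.rescale hε 0) (h.isTest.rescale hε' 0) z
  simp only [← rescaled_eq_comp_sub] at this
  simp only [← mul_assoc]
  rw [integral_mul_const, integral_mul_const, this]

/-- The dependence of the pairing on the base point: the difference is a regularization of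
`(F_{x'} - F_x)(u)`. -/
lemma pairing_sub_pairing (h : CoherentOn γ a C η φ K₁ F) (hK : IsCompact K)
    (hK₁ : ∀ z ∈ K, ∀ y, ‖y - z‖ ≤ δ → y ∈ K₁) (hδ : 0 < δ) {ε ε' : ℝ} (hε : 0 < ε) (hεη : ε ≤ η)
    (hε' : 0 < ε') {ρ : ℝ} (hρ : ∀ y, φ y ≠ 0 → ‖y‖ ≤ ρ)
    (h2 : ρ * ε' ≤ δ) {u : Eucl d → ℝ} (hu : IsTest u) (huK : tsupport u ⊆ K) {x x' : Eucl d}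
    (hx : x ∈ K) (hx' : x' ∈ K) :
    pairing F φ ε (rescaled φ ε' 0) x u - pairing F φ ε (rescaled φ ε' 0) x' u =
      F x' (smear (rescaled φ ε 0) (smear (rescaled φ ε' 0) u)) -
        F x (smear (rescaled φ ε 0) (smear (rescaled φ ε' 0) u)) := by
  have hs : ∀ w, rescaled φ ε' 0 w ≠ 0 → ‖w‖ ≤ δ :=
    fun w hw => by simpa using (norm_sub_le_of_rescaled_ne_zero hρ hε' hw).trans h2
  have hκ := h.isTest.rescale hε' 0
  have i1 := h.integrable_pairing hK hK₁ hδ hε hεη hκ hs hu huK hx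
  have i2 := h.integrable_pairing hK hK₁ hδ hε hεη hκ hs hu huK hx'
  have i3 := i1.sub i2
  have hT := (h.finiteOrder x').sub (h.finiteOrder x)
  rw [smear_comm (rescaled φ ε 0), hT.apply_smear (hκ.smear hu) (h.isTest.rescale hε 0), pairing,
    pairing, ← integral_sub i1 i2]
  rw [Measure.volume_eq_prod] at i3 ⊢
  have e := integral_prod_symm _ i3
  simp only [Pi.sub_apply] at e
  rw [e]
  refine integral_congr_ae (ae_of_all _ fun y => ?_)
  simp only [← rescaled_eq_comp_sub]
  rw [smear, ← integral_mul_const, ← integral_sub_left_eq_self _ _ y]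
  refine integral_congr_ae (ae_of_all _ fun z => ?_)
  simp only [sub_sub_cancel]
  ring

end CoherentOn

end

section

variable {d : ℕ}

/-- For `ε ≤ l` and `r ≥ γ - a`, the factor `(ε / l)^r` gained from the moments of the kernel makes
up for the loss `(l / ε)^(γ - a)` in the coherence bound at distance `l`. -/
lemma rpow_scale_le {γ a ε l : ℝ} {r : ℕ} (hε : 0 < ε) (hεl : ε ≤ l) (hr : γ - a ≤ r) :
    ε ^ a * l ^ (γ - a) * ε ^ r * (l ^ r)⁻¹ ≤ ε ^ γ := by
  have hl : 0 < l := hε.trans_le hεl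
  have e1 : l ^ (γ - a) * (l ^ r)⁻¹ = l ^ (γ - a - r) := by
    rw [Real.rpow_sub_natCast hl.ne', div_eq_mul_inv]
  have e2 : ε ^ a * ε ^ r * ε ^ (γ - a - r) = ε ^ γ := by
    rw [← Real.rpow_natCast, ← Real.rpow_add hε, ← Real.rpow_add hε]
    congr 1; ring
  calc ε ^ a * l ^ (γ - a) * ε ^ r * (l ^ r)⁻¹
      = ε ^ a * ε ^ r * (l ^ (γ - a) * (l ^ r)⁻¹) := by ring
    _ ≤ ε ^ a * ε ^ r * ε ^ (γ - a - r) := by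
        rw [e1]
        exact mul_le_mul_of_nonneg_left
          (Real.rpow_le_rpow_of_nonpos hε hεl (by linarith)) (by positivity)
    _ = ε ^ γ := e2

namespace CoherentOn

variable {γ a C η δ : ℝ} {φ : Eucl d → ℝ} {K K₁ : Set (Eucl d)} {F : Eucl d → (Eucl d → ℝ) → ℝ}

/-- The two parts `F_z - F_y` and `F_y - F_x` of `F_z - F_x` at the kernel `φ^ε_y`, when `z` lies
in the support of a test function at scale `l` around `x` and `y` is within `O(ε)` of `z`. -/
lemma bound_parts (h : CoherentOn γ a C η φ K₁ F)
    (hK₁ : ∀ z ∈ K, ∀ y, ‖y - z‖ ≤ δ → y ∈ K₁) (hδ : 0 < δ) {ρ B : ℝ} (hρ : 0 ≤ ρ) (hB : 0 ≤ B)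
    {x z y : Eucl d} (hx : x ∈ K) (hz : z ∈ K) {ε l : ℝ} (hε : 0 < ε) (hεη : ε ≤ η)
    (hεδ : 2 * ρ * ε ≤ δ) (hεl : ε ≤ l) (hyz : ‖y - z‖ ≤ 2 * ρ * ε) (hzx : ‖z - x‖ ≤ B * l) :
    y ∈ K₁ ∧ ‖y - x‖ ≤ (B + 2 * ρ) * l ∧
    |F z (rescaled φ ε y) - F y (rescaled φ ε y)| ≤ C * (2 * ρ + 1) ^ (γ - a) * ε ^ γ ∧
    |F y (rescaled φ ε y) - F x (rescaled φ ε y)| ≤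
      C * (B + 2 * ρ + 1) ^ (γ - a) * (ε ^ a * l ^ (γ - a)) := by
  have hself : ∀ z ∈ K, z ∈ K₁ := fun z hz => hK₁ z hz z (by simpa using hδ.le)
  have hy := hK₁ z hz y (hyz.trans hεδ)
  have hyx : ‖y - x‖ ≤ (B + 2 * ρ) * l := by
    have e : y - x = (y - z) + (z - x) := by abel
    have := norm_add_le (y - z) (z - x)
    rw [e]
    nlinarith [mul_le_mul_of_nonneg_left hεl (mul_nonneg zero_le_two hρ)]
  exact ⟨hy, hyx, h.bound_near (hself z hz) hy hε hεη (by positivity) hyz,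
    h.bound_far (hself x hx) hy hε hεη (by positivity) hεl hyx⟩

/-- Size of the pairing at scale `ε` below the scale `l` of the test function. -/
lemma abs_pairing_le (h : CoherentOn γ a C η φ K₁ F)
    (hK₁ : ∀ z ∈ K, ∀ y, ‖y - z‖ ≤ δ → y ∈ K₁) (hδ : 0 < δ) {ρ B : ℝ} (hρ0 : 0 ≤ ρ)
    (hρ : ∀ y, φ y ≠ 0 → ‖y‖ ≤ ρ) (hB : 0 ≤ B) :
    ∃ C', 0 ≤ C' ∧ ∀ x ∈ K, ∀ r A l u, 0 < l → ScaledTest r A B l x u → tsupport u ⊆ K →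
      ∀ ε, 0 < ε → ε ≤ η → 2 * ρ * ε ≤ δ → ε ≤ l →
        |pairing F φ ε (rescaled φ (2 * ε) 0) x u| ≤
          C' * A * (ε ^ γ + ε ^ a * l ^ (γ - a)) := by
  set I : ℝ := ∫ t, |φ t|
  have hI : 0 ≤ I := integral_nonneg fun _ => abs_nonneg _
  set v : ℝ := volume.real (ball (0 : Eucl d) 1)
  have hv : 0 ≤ v := measureReal_nonneg
  set c₁ : ℝ := C * (2 * ρ + 1) ^ (γ - a)
  set c₂ : ℝ := C * (B + 2 * ρ + 1) ^ (γ - a)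
  have hC := h.nonneg
  have hc₁ : 0 ≤ c₁ := by positivity
  have hc₂ : 0 ≤ c₂ := by positivity
  refine ⟨(c₁ + c₂) * (I * (B ^ d * v)), by positivity, ?_⟩
  intro x hx r A l u hl hu huK ε hε hεη hεδ hεl
  have hA := hu.nonneg hl
  have key := abs_integral_mul_kernel_le (h.isTest.rescale (by positivity : 0 < 2 * ε) 0) hu.isTest
    (H := fun p => F p.1 (rescaled φ ε p.2) - F x (rescaled φ ε p.2))
    (M := c₁ * ε ^ γ + c₂ * (ε ^ a * l ^ (γ - a))) (fun z y h1 h2 => by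
      have hyz := norm_sub_le_of_rescaled_ne_zero hρ (by positivity) h1
      rw [sub_zero, show ρ * (2 * ε) = 2 * ρ * ε by ring] at hyz
      obtain ⟨-, -, b1, b2⟩ := h.bound_parts hK₁ hδ hρ0 hB hx (huK (subset_tsupport _ h2)) hε hεη
        hεδ hεl hyz (hu.norm_sub_le h2)
      exact (abs_sub_le _ (F y (rescaled φ ε y)) _).trans (add_le_add b1 b2))
  rw [integral_abs_rescaled φ (by positivity)] at key
  have hu1 := hu.integral_abs_le hB hl
  have p1 : 0 ≤ ε ^ γ := by positivity
  have p2 : 0 ≤ ε ^ a * l ^ (γ - a) := by positivity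
  refine key.trans ?_
  calc (c₁ * ε ^ γ + c₂ * (ε ^ a * l ^ (γ - a))) * (I * ∫ z, |u z|)
      ≤ ((c₁ + c₂) * (ε ^ γ + ε ^ a * l ^ (γ - a))) * (I * (A * (B ^ d * v))) := by
        refine mul_le_mul ?_ (mul_le_mul_of_nonneg_left hu1 hI) ?_ (by positivity)
        · nlinarith [mul_nonneg hc₁ p2, mul_nonneg hc₂ p1]
        · exact mul_nonneg hI (integral_nonneg fun _ => abs_nonneg _)
    _ = _ := by ring

/-- Replacing the kernel `φ^{2ε}` by `φ^{ε/2}` changes the pairing by `O(ε^γ)`. Near the diagonal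
this is coherence; the remaining part `F_y - F_x` is paired with `(φ^{ε/2} - φ^{2ε}) ⋆ u`, which is
small because `φ` has vanishing moments. -/
lemma abs_pairing_sub_le (h : CoherentOn γ a C η φ K₁ F) (hK : IsCompact K)
    (hK₁ : ∀ z ∈ K, ∀ y, ‖y - z‖ ≤ δ → y ∈ K₁) (hδ : 0 < δ) {ρ B : ℝ} (hρ0 : 0 ≤ ρ)
    (hρ : ∀ y, φ y ≠ 0 → ‖y‖ ≤ ρ) (hB : 0 ≤ B) {r : ℕ} (hr : γ - a ≤ r) {m : ℝ} (hm0 : 0 ≤ m)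
    (hm : ∀ u : Eucl d → ℝ, IsTest u → ∀ b, (∀ x, ‖iteratedFDeriv ℝ r u x‖ ≤ b) →
      ∀ ε, 0 < ε → ∀ y, |smear (rescaled φ ε 0) u y - u y| ≤ m * (b * ε ^ r)) :
    ∃ C', 0 ≤ C' ∧ ∀ x ∈ K, ∀ A l u, 0 < l → ScaledTest r A B l x u → tsupport u ⊆ K →
      ∀ ε, 0 < ε → ε ≤ η → 2 * ρ * ε ≤ δ → ε ≤ l →
        |pairing F φ ε (rescaled φ (ε / 2) 0) x u - pairing F φ ε (rescaled φ (2 * ε) 0) x u| ≤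
          C' * A * ε ^ γ := by
  set I : ℝ := ∫ t, |φ t|
  have hI : 0 ≤ I := integral_nonneg fun _ => abs_nonneg _
  set v : ℝ := volume.real (ball (0 : Eucl d) 1)
  have hv : 0 ≤ v := measureReal_nonneg
  set c₁ : ℝ := C * (2 * ρ + 1) ^ (γ - a)
  set c₂ : ℝ := C * (B + 2 * ρ + 1) ^ (γ - a)
  have hC := h.nonneg
  have hc₁ : 0 ≤ c₁ := by positivity
  have hc₂ : 0 ≤ c₂ := by positivity
  set c₃ : ℝ := m * ((1 / 2) ^ r + 2 ^ r)
  have hc₃ : 0 ≤ c₃ := by positivity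
  refine ⟨c₁ * (2 * I * (B ^ d * v)) + c₂ * c₃ * ((B + 2 * ρ) ^ d * v), by positivity, ?_⟩
  intro x hx A l u hl hu huK ε hε hεη hεδ hεl
  have hA := hu.nonneg hl
  have hε1 : 0 < ε / 2 := by positivity
  have hε2 : 0 < 2 * ε := by positivity
  have t1 := h.isTest.rescale hε1 0
  have t2 := h.isTest.rescale hε2 0
  have s1 : ∀ w, rescaled φ (ε / 2) 0 w ≠ 0 → ‖w‖ ≤ 2 * ρ * ε := fun w hw => by
    have := norm_sub_le_of_rescaled_ne_zero hρ hε1 hw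
    rw [sub_zero] at this
    nlinarith [mul_nonneg hρ0 hε.le]
  have s2 : ∀ w, rescaled φ (2 * ε) 0 w ≠ 0 → ‖w‖ ≤ 2 * ρ * ε := fun w hw => by
    have := norm_sub_le_of_rescaled_ne_zero hρ hε2 hw
    rw [sub_zero] at this
    linarith
  set κ : Eucl d → ℝ := rescaled φ (ε / 2) 0 - rescaled φ (2 * ε) 0
  have hκ : IsTest κ := t1.sub t2
  have hκs : ∀ w, κ w ≠ 0 → ‖w‖ ≤ 2 * ρ * ε := fun w hw => by
    by_cases h1 : rescaled φ (ε / 2) 0 w = 0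
    · by_cases h2 : rescaled φ (2 * ε) 0 w = 0
      · exact absurd (by simp [κ, h1, h2]) hw
      · exact s2 w h2
    · exact s1 w h1
  have hκI : ∫ t, |κ t| ≤ 2 * I := by
    have e1 := integral_abs_rescaled φ hε1 0
    have e2 := integral_abs_rescaled φ hε2 0
    calc ∫ t, |κ t| ≤ ∫ t, (|rescaled φ (ε / 2) 0 t| + |rescaled φ (2 * ε) 0 t|) :=
          integral_mono hκ.integrable.abs (t1.integrable.abs.add t2.integrable.abs)
            fun t => abs_sub _ _
      _ = 2 * I := by rw [integral_add t1.integrable.abs t2.integrable.abs, e1, e2]; ring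
  set D : Eucl d → ℝ := fun y => F y (rescaled φ ε y) - F x (rescaled φ ε y)
  set H : Eucl d × Eucl d → ℝ := fun p => F p.1 (rescaled φ ε p.2) - F p.2 (rescaled φ ε p.2)
  have hDm : Measurable D :=
    ((h.measurable_uncurry hε).comp (measurable_id.prodMk measurable_id)).sub
      (h.measurable_diff hε x)
  have hHm : Measurable H := (h.measurable_uncurry hε).sub
    ((h.measurable_uncurry hε).comp (measurable_snd.prodMk measurable_snd))
  have hparts : ∀ z y, κ (y - z) ≠ 0 → u z ≠ 0 → ‖y - x‖ ≤ (B + 2 * ρ) * l ∧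
      |H (z, y)| ≤ c₁ * ε ^ γ ∧ |D y| ≤ c₂ * (ε ^ a * l ^ (γ - a)) := fun z y h1 h2 =>
    (h.bound_parts hK₁ hδ hρ0 hB hx (huK (subset_tsupport _ h2)) hε hεη hεδ hεl (hκs _ h1)
      (hu.norm_sub_le h2)).2
  have i1 := integrable_mul_kernel hκ hu.isTest hHm fun z y h1 h2 => (hparts z y h1 h2).2.1
  have i2 := integrable_mul_kernel hκ hu.isTest (hDm.comp measurable_snd)
    fun z y h1 h2 => (hparts z y h1 h2).2.2
  have j1 := h.integrable_pairing hK hK₁ hδ hε hεη t1 (fun w hw => (s1 w hw).trans hεδ) hu.isTest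
    huK hx
  have j2 := h.integrable_pairing hK hK₁ hδ hε hεη t2 (fun w hw => (s2 w hw).trans hεδ) hu.isTest
    huK hx
  -- `F_z - F_x = (F_z - F_y) + (F_y - F_x)`, where the second part can be integrated over `z` first.
  have split : pairing F φ ε (rescaled φ (ε / 2) 0) x u -
      pairing F φ ε (rescaled φ (2 * ε) 0) x u =
      (∫ p : Eucl d × Eucl d, H p * (κ (p.2 - p.1) * u p.1)) + ∫ y, D y * smear κ u y := by
    have e2 : ∫ y, D y * smear κ u y =
        ∫ p : Eucl d × Eucl d, (D ∘ Prod.snd) p * (κ (p.2 - p.1) * u p.1) := by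
      rw [Measure.volume_eq_prod] at i2 ⊢
      rw [integral_prod_symm _ i2]
      refine integral_congr_ae (ae_of_all _ fun y => ?_)
      simp only [Function.comp_apply]
      rw [integral_const_mul, smear, ← integral_sub_left_eq_self _ _ y]
      simp only [sub_sub_cancel]
    rw [e2, ← integral_add i1 i2, pairing, pairing, ← integral_sub j1 j2]
    refine integral_congr_ae (ae_of_all _ fun p => ?_)
    simp only [H, D, κ, Pi.sub_apply, Function.comp_apply]
    ring
  have b1 : |∫ p : Eucl d × Eucl d, H p * (κ (p.2 - p.1) * u p.1)| ≤
      c₁ * (2 * I * (B ^ d * v)) * A * ε ^ γ := by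
    refine (abs_integral_mul_kernel_le hκ hu.isTest
      fun z y h1 h2 => (hparts z y h1 h2).2.1).trans ?_
    calc c₁ * ε ^ γ * ((∫ t, |κ t|) * ∫ z, |u z|)
        ≤ c₁ * ε ^ γ * (2 * I * (A * (B ^ d * v))) := by
          refine mul_le_mul_of_nonneg_left (mul_le_mul hκI (hu.integral_abs_le hB hl)
            (integral_nonneg fun _ => abs_nonneg _) (by positivity)) (by positivity)
      _ = _ := by ring
  have b2 : |∫ y, D y * smear κ u y| ≤ c₂ * c₃ * ((B + 2 * ρ) ^ d * v) * A * ε ^ γ := by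
    set S : ℝ := c₃ * (A * (l ^ (d + r))⁻¹ * ε ^ r) with hS
    have hS0 : 0 ≤ S := by positivity
    have hsm : ∀ y, |smear κ u y| ≤ S := by
      intro y
      have m1 := hm u hu.isTest _ (hu.bound r le_rfl) _ hε1 y
      have m2 := hm u hu.isTest _ (hu.bound r le_rfl) _ hε2 y
      have e : smear κ u y = (smear (rescaled φ (ε / 2) 0) u y - u y) -
          (smear (rescaled φ (2 * ε) 0) u y - u y) := by
        have hi : ∀ {θ : Eucl d → ℝ}, IsTest θ → Integrable fun t => θ t * u (y - t) :=
          fun hθ => (hθ.continuous.mul (hu.isTest.continuous.comp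
            (continuous_const.sub continuous_id))).integrable_of_hasCompactSupport hθ.2.mul_right
        rw [sub_sub_sub_cancel_right, smear, smear, smear, ← integral_sub (hi t1) (hi t2)]
        refine integral_congr_ae (ae_of_all _ fun t => ?_)
        simp only [κ, Pi.sub_apply]; ring
      rw [e]
      refine ((abs_sub _ _).trans (add_le_add m1 m2)).trans_eq ?_
      rw [hS]; simp only [c₃]
      rw [mul_pow, div_pow, div_pow, one_pow]; ring
    set M : ℝ := c₂ * (ε ^ a * l ^ (γ - a)) with hM
    have hM0 : 0 ≤ M := by positivity
    have hi : IntegrableOn (fun _ : Eucl d => M * S) (closedBall x ((B + 2 * ρ) * l)) volume :=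
      integrableOn_const (measure_closedBall_lt_top.ne)
    have hle : |∫ y, D y * smear κ u y| ≤
        ∫ y, (closedBall x ((B + 2 * ρ) * l)).indicator (fun _ => M * S) y := by
      rw [← Real.norm_eq_abs]
      refine norm_integral_le_of_norm_le (hi.integrable_indicator measurableSet_closedBall)
        (ae_of_all _ fun y => ?_)
      by_cases hy : smear κ u y = 0
      · rw [hy, mul_zero, norm_zero]
        exact indicator_nonneg (fun _ _ => by positivity) _
      · obtain ⟨t, ht⟩ : ∃ t, κ t * u (y - t) ≠ 0 := by
          by_contra hcon
          push Not at hcon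
          exact hy (by simp [smear, hcon])
        have hp := hparts (y - t) y (by simpa using left_ne_zero_of_mul ht)
          (right_ne_zero_of_mul ht)
        rw [indicator_of_mem (by rw [mem_closedBall, dist_eq_norm]; exact hp.1), norm_mul]
        exact mul_le_mul hp.2.2 (hsm y) (norm_nonneg _) hM0
    refine hle.trans ?_
    rw [integral_indicator measurableSet_closedBall, setIntegral_const, measureReal_def,
      Measure.addHaar_closedBall _ _ (by positivity), ENNReal.toReal_mul,
      ENNReal.toReal_ofReal (by positivity), finrank_euclideanSpace_fin, smul_eq_mul,
      ← measureReal_def]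
    have hsc := rpow_scale_le hε hεl hr
    have e : ((B + 2 * ρ) * l) ^ d * volume.real (ball (0 : Eucl d) 1) * (M * S) =
        c₂ * c₃ * ((B + 2 * ρ) ^ d * v) * A *
          (ε ^ a * l ^ (γ - a) * ε ^ r * (l ^ r)⁻¹) := by
      rw [hM, hS, mul_pow, pow_add]
      simp only [v]
      field_simp
    rw [e]
    exact mul_le_mul_of_nonneg_left hsc (by positivity)
  rw [split]
  refine (abs_add_le _ _).trans ((add_le_add b1 b2).trans_eq ?_)
  ring

end CoherentOn

end

section

variable {d : ℕ}

/-! ### Reconstruction on a compact set of `ℝ^d` -/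

/-- Coherence passes from `f` to linear combinations of rescalings of `f`. -/
lemma CoherentOn.sum_rescaled {γ a C η : ℝ} {f : Eucl d → ℝ} {K₁ : Set (Eucl d)}
    {F : Eucl d → (Eucl d → ℝ) → ℝ} (h : CoherentOn γ a C η f K₁ F) (r : ℕ) (c : ℕ → ℝ) :
    ∃ C', CoherentOn γ a C' η (∑ i ∈ Finset.range r, c i • rescaled f (1 / ((i : ℝ) + 1)) 0)
      K₁ F := by
  have hpos : ∀ i : ℕ, (0 : ℝ) < 1 / ((i : ℝ) + 1) := fun i => by positivity
  have hle : ∀ i : ℕ, 1 / ((i : ℝ) + 1) ≤ 1 := fun i => by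
    rw [div_le_one (by positivity)]; linarith [(Nat.cast_nonneg i : (0 : ℝ) ≤ i)]
  have hC := h.nonneg
  refine ⟨∑ i ∈ Finset.range r, |c i| * (C * (1 / ((i : ℝ) + 1)) ^ a), h.finiteOrder, h.measurable,
    IsTest.sum _ fun i _ => (h.isTest.rescale (hpos i) 0).smul _, h.le_min,
    Finset.sum_nonneg fun i _ => by positivity, ?_⟩
  intro z hz y hy ε hε hεη
  have ht : ∀ i ∈ Finset.range r, IsTest (c i • rescaled f (1 / ((i : ℝ) + 1) * ε) y) :=
    fun i _ => (h.isTest.rescale (mul_pos (hpos i) hε) y).smul _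
  rw [rescaled_sum]
  simp only [rescaled_rescaled]
  rw [(h.finiteOrder z).sum_apply _ ht, (h.finiteOrder y).sum_apply _ ht,
    ← Finset.sum_sub_distrib, Finset.sum_mul]
  refine (Finset.abs_sum_le_sum_abs _ _).trans (Finset.sum_le_sum fun i _ => ?_)
  have hi := mul_pos (hpos i) hε
  rw [(h.finiteOrder z).smul _ (h.isTest.rescale hi y),
    (h.finiteOrder y).smul _ (h.isTest.rescale hi y), ← mul_sub, abs_mul, mul_assoc]
  refine mul_le_mul_of_nonneg_left ?_ (abs_nonneg _)
  have hiε : 1 / ((i : ℝ) + 1) * ε ≤ ε := mul_le_of_le_one_left hε.le (hle i)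
  refine (h.bound z hz y hy _ hi (hiε.trans hεη)).trans ?_
  rw [mul_assoc]
  refine mul_le_mul_of_nonneg_left ?_ hC
  rw [Real.mul_rpow (hpos i).le hε.le, mul_assoc]
  gcongr
  exact h.exponent_nonneg

/-- The pairings at the scales `2^{-n}` converge, and the limit is of order `l^γ` for test functions
at scale `l`: starting from the scale `2^{-n}` comparable with `l`, the increments decay
geometrically. -/
lemma CoherentOn.exists_tendsto_pairing {γ a C η δ : ℝ} {φ : Eucl d → ℝ} {K K₁ : Set (Eucl d)}
    {F : Eucl d → (Eucl d → ℝ) → ℝ} (h : CoherentOn γ a C η φ K₁ F) (hγ : 0 < γ) (hη : 0 < η)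
    (hK : IsCompact K) (hK₁ : ∀ z ∈ K, ∀ y, ‖y - z‖ ≤ δ → y ∈ K₁) (hδ : 0 < δ) {r : ℕ}
    (hr : γ - a ≤ r) {m : ℝ} (hm0 : 0 ≤ m)
    (hm : ∀ u : Eucl d → ℝ, IsTest u → ∀ b, (∀ x, ‖iteratedFDeriv ℝ r u x‖ ≤ b) →
      ∀ ε, 0 < ε → ∀ y, |smear (rescaled φ ε 0) u y - u y| ≤ m * (b * ε ^ r))
    {B : ℝ} (hB : 0 ≤ B) :
    ∃ C', 0 ≤ C' ∧ ∀ x ∈ K, ∀ A l u, 0 < l → l ≤ 1 → ScaledTest r A B l x u → tsupport u ⊆ K →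
      ∃ L, Tendsto (fun n : ℕ => pairing F φ ((1 / 2) ^ n) (rescaled φ (2 * (1 / 2) ^ n) 0) x u)
        atTop (𝓝 L) ∧ |L| ≤ C' * A * l ^ γ := by
  obtain ⟨ρ, hρ0, hρ⟩ := exists_norm_le_of_hasCompactSupport h.isTest.2
  obtain ⟨C₁, hC₁, h₁⟩ := h.abs_pairing_sub_le hK hK₁ hδ hρ0.le hρ hB hr hm0 hm
  obtain ⟨C₂, hC₂, h₂⟩ := h.abs_pairing_le hK₁ hδ hρ0.le hρ hB
  set η₀ : ℝ := min 1 (min η (δ / (2 * ρ)))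
  have hη₀ : 0 < η₀ := by positivity
  have hη₀1 : η₀ ≤ 1 := min_le_left _ _
  have hη₀η : η₀ ≤ η := (min_le_right _ _).trans (min_le_left _ _)
  have hη₀δ : 2 * ρ * η₀ ≤ δ := by
    have : η₀ ≤ δ / (2 * ρ) := (min_le_right _ _).trans (min_le_right _ _)
    rwa [le_div_iff₀ (by positivity), mul_comm] at this
  set θ : ℝ := (1 / 2) ^ γ with hθ
  have hθ0 : 0 < θ := by positivity
  have hθ1 : θ < 1 := Real.rpow_lt_one (by norm_num) (by norm_num) hγ
  refine ⟨C₂ * (1 + (η₀ / 2) ^ a) + C₁ / (1 - θ), by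
    have : 0 < 1 - θ := by linarith
    positivity, ?_⟩
  intro x hx A l u hl hl1 hu huK
  have hA := hu.nonneg hl
  set e : ℕ → ℝ := fun n => (1 / 2) ^ n
  have he : ∀ n, 0 < e n := fun n => by positivity
  set q : ℕ → ℝ := fun n => pairing F φ (e n) (rescaled φ (2 * e n) 0) x u
  obtain ⟨n₀, hn1, hn2⟩ := exists_nat_pow_near_of_lt_one (mul_pos hη₀ hl)
    (mul_le_one₀ hη₀1 hl.le hl1) (by norm_num : (0 : ℝ) < 1 / 2) (by norm_num)
  -- At the scale `e N`, comparable with `l`, the pairing is bounded directly.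
  set N := n₀ + 1
  have heN : e N ≤ η₀ * l := hn1.le
  have heN' : η₀ / 2 * l ≤ e N := by
    have : e N = e n₀ / 2 := by simp only [e, N, pow_succ]; ring
    rw [this]; linarith
  have hmono : ∀ k, e (N + k) ≤ e N := fun k =>
    pow_le_pow_of_le_one (by norm_num) (by norm_num) (Nat.le_add_right _ _)
  have hsmall : ∀ {s}, s ≤ e N → s ≤ η ∧ 2 * ρ * s ≤ δ ∧ s ≤ l := fun {s} hs => by
    have h1 : s ≤ η₀ := hs.trans (heN.trans (mul_le_of_le_one_right hη₀.le hl1))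
    refine ⟨h1.trans hη₀η, ?_, hs.trans (heN.trans (mul_le_of_le_one_left hl.le hη₀1))⟩
    exact (mul_le_mul_of_nonneg_left h1 (by positivity)).trans hη₀δ
  have heNl : e N ^ γ ≤ l ^ γ := Real.rpow_le_rpow (he N).le (hsmall le_rfl).2.2 hγ.le
  have hstep : ∀ k, dist (q (N + k)) (q (N + (k + 1))) ≤ C₁ * A * l ^ γ * θ ^ k := by
    intro k
    obtain ⟨a1, a2, a3⟩ := hsmall (hmono k)
    obtain ⟨b1, b2, -⟩ := hsmall (hmono (k + 1))
    have hhalf : e (N + (k + 1)) = e (N + k) / 2 := by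
      simp only [e, ← add_assoc, pow_succ]; ring
    -- Exchanging the scales `e (N + k + 1)` and `2 e (N + k + 1) = e (N + k)` makes consecutive
    -- pairings differ in the inner kernel only.
    have hq : q (N + (k + 1)) = pairing F φ (e (N + k)) (rescaled φ (e (N + k) / 2) 0) x u := by
      have h2 : 2 * e (N + (k + 1)) = e (N + k) := by rw [hhalf]; ring
      simp only [q]
      rw [h2, h.pairing_comm hK hK₁ hδ (he _) b1 (he _) a1 hρ
        (by nlinarith [mul_pos hρ0 (he (N + (k + 1)))])
        (by nlinarith [mul_pos hρ0 (he (N + k))]) hu.isTest huK hx, hhalf]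
    rw [dist_comm, Real.dist_eq, hq]
    refine (h₁ x hx A l u hl hu huK _ (he _) a1 a2 a3).trans ?_
    have : e (N + k) ^ γ = e N ^ γ * θ ^ k := by
      have : e (N + k) = e N * (1 / 2) ^ k := by simp only [e, pow_add]
      rw [this, Real.mul_rpow (he N).le (by positivity), hθ, ← Real.rpow_natCast,
        ← Real.rpow_natCast, ← Real.rpow_mul (by norm_num), ← Real.rpow_mul (by norm_num),
        mul_comm γ]
    rw [this, ← mul_assoc]
    gcongr
  obtain ⟨L, hL⟩ := cauchySeq_tendsto_of_complete (cauchySeq_of_le_geometric θ _ hθ1 hstep)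
  refine ⟨L, (tendsto_add_atTop_iff_nat (f := q) N).1 (by simpa only [add_comm] using hL), ?_⟩
  have hdist := dist_le_of_le_geometric_of_tendsto₀ θ _ hθ1 hstep hL
  obtain ⟨a1, a2, a3⟩ := hsmall le_rfl
  have hstart : |q N| ≤ C₂ * (1 + (η₀ / 2) ^ a) * A * l ^ γ := by
    refine (h₂ x hx r A l u hl hu huK _ (he N) a1 a2 a3).trans ?_
    have : e N ^ a * l ^ (γ - a) ≤ (η₀ / 2) ^ a * l ^ γ := by
      have h1 : e N ^ a ≤ (η₀ / 2 * l) ^ a := Real.rpow_le_rpow_of_nonpos (by positivity) heN'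
        (h.le_min.trans (min_le_left _ _))
      refine (mul_le_mul_of_nonneg_right h1 (by positivity)).trans_eq ?_
      rw [Real.mul_rpow (by positivity) hl.le, mul_assoc, ← Real.rpow_add hl]
      congr 2; ring
    calc C₂ * A * (e N ^ γ + e N ^ a * l ^ (γ - a))
        ≤ C₂ * A * (l ^ γ + (η₀ / 2) ^ a * l ^ γ) := by gcongr
      _ = _ := by ring
  rw [add_zero, Real.dist_eq, abs_sub_comm] at hdist
  have := abs_sub_abs_le_abs_sub L (q N)
  have e3 : (C₂ * (1 + (η₀ / 2) ^ a) + C₁ / (1 - θ)) * A * l ^ γ =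
      C₂ * (1 + (η₀ / 2) ^ a) * A * l ^ γ + C₁ * A * l ^ γ / (1 - θ) := by ring
  rw [e3]
  linarith

/-- `R` is a reconstruction of the germ `F` on the compact set `K`: it is linear on test functions
supported in `K`, and `R - F_x` is of order `l^γ` on test functions at scale `l` around `x ∈ K`,
uniformly. -/
structure ReconstructsOn (γ : ℝ) (K : Set (Eucl d)) (F : Eucl d → (Eucl d → ℝ) → ℝ)
    (R : (Eucl d → ℝ) → ℝ) : Prop where
  add : ∀ ⦃u v⦄, IsTest u → tsupport u ⊆ K → IsTest v → tsupport v ⊆ K → R (u + v) = R u + R v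
  smul : ∀ (c : ℝ) ⦃u⦄, IsTest u → tsupport u ⊆ K → R (c • u) = c * R u
  bound : ∃ r : ℕ, ∀ B, 0 ≤ B → ∃ C, 0 ≤ C ∧ ∀ x ∈ K, ∀ A l u, 0 < l → l ≤ 1 →
    ScaledTest r A B l x u → tsupport u ⊆ K → |R u - F x u| ≤ C * A * l ^ γ

/-- A coherent family of functionals on `ℝ^d` has a reconstruction on each compact set whose
neighbourhood is covered by the coherence bounds. -/
theorem CoherentOn.exists_reconstructsOn {γ a C η δ : ℝ} {f : Eucl d → ℝ} {K K₁ : Set (Eucl d)}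
    {F : Eucl d → (Eucl d → ℝ) → ℝ} (hf : CoherentOn γ a C η f K₁ F) (h0 : ∫ x, f x ≠ 0)
    (hγ : 0 < γ) (hη : 0 < η) (hK : IsCompact K)
    (hK₁ : ∀ z ∈ K, ∀ y, ‖y - z‖ ≤ δ → y ∈ K₁) (hδ : 0 < δ) :
    ∃ R, ReconstructsOn γ K F R := by
  rcases K.eq_empty_or_nonempty with rfl | ⟨x₀, hx₀⟩
  · exact ⟨fun _ => 0, fun _ _ _ _ _ _ => by simp, fun _ _ _ _ => by simp, 0,
      fun _ _ => ⟨0, le_rfl, fun x hx => hx.elim⟩⟩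
  obtain ⟨r, hr⟩ := exists_nat_ge (max (γ - a) 1)
  have hr1 : 0 < r := by
    have : (1 : ℝ) ≤ r := (le_max_right _ _).trans hr
    exact_mod_cast this
  obtain ⟨c, φ, hφ, hφt, hφ1, m, hm0, hm⟩ := exists_kernel_of_order hf.isTest h0 hr1
  obtain ⟨C', h⟩ := hf.sum_rescaled r c
  rw [← hφ] at h
  have hr' : γ - a ≤ r := (le_max_left _ _).trans hr
  obtain ⟨ρ, hρ0, hρ⟩ := exists_norm_le_of_hasCompactSupport hφt.2
  set q : ℕ → Eucl d → (Eucl d → ℝ) → ℝ := fun n x u =>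
    pairing F φ ((1 / 2) ^ n) (rescaled φ (2 * (1 / 2) ^ n) 0) x u
  obtain ⟨R₀, hR₀, hKR⟩ := hK.isBounded.exists_pos_norm_le
  have hlim : ∀ x ∈ K, ∀ u, IsTest u → tsupport u ⊆ K → ∃ L, Tendsto (fun n => q n x u) atTop (𝓝 L) := by
    intro x hx u hu huK
    obtain ⟨A, hA0, hA⟩ := exists_derivBound hu.1 hu.2 r
    obtain ⟨C'', -, hC''⟩ := h.exists_tendsto_pairing hγ hη hK hK₁ hδ hr' hm0 hm
      (B := 2 * R₀) (by positivity)
    obtain ⟨L, hL, -⟩ := hC'' x hx A 1 u one_pos le_rfl ⟨hu, fun z hz => by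
      rw [mem_closedBall, dist_eq_norm]
      have := norm_sub_le z x
      linarith [hKR z (huK hz), hKR x hx], fun k hk y => by simpa using hA k hk y⟩ huK
    exact ⟨L, hL⟩
  have hpow : Tendsto (fun n : ℕ => ((1 : ℝ) / 2) ^ n) atTop (𝓝 0) :=
    tendsto_pow_atTop_nhds_zero_of_lt_one (by norm_num) (by norm_num)
  have hev : ∀ᶠ n : ℕ in atTop, ((1 : ℝ) / 2) ^ n ≤ η ∧ ρ * (2 * (1 / 2) ^ n) ≤ δ := by
    filter_upwards [hpow.eventually (ge_mem_nhds hη),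
      hpow.eventually (ge_mem_nhds (by positivity : 0 < δ / (2 * ρ)))] with n h1 h2
    refine ⟨h1, ?_⟩
    rw [le_div_iff₀ (by positivity)] at h2
    linarith
  have hint : ∀ n : ℕ, ((1 : ℝ) / 2) ^ n ≤ η → ρ * (2 * (1 / 2) ^ n) ≤ δ → ∀ u, IsTest u →
      tsupport u ⊆ K → _ := fun n h1 h2 u hu huK =>
    h.integrable_pairing hK hK₁ hδ (by positivity : (0 : ℝ) < (1 / 2) ^ n) h1
      (h.isTest.rescale (by positivity : (0 : ℝ) < 2 * (1 / 2) ^ n) 0)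
      (fun w hw => by
        simpa using (norm_sub_le_of_rescaled_ne_zero hρ (by positivity) hw).trans h2) hu huK hx₀
  set R : (Eucl d → ℝ) → ℝ := fun u => F x₀ u + limUnder atTop fun n => q n x₀ u
  have hR : ∀ u, IsTest u → tsupport u ⊆ K → Tendsto (fun n => q n x₀ u) atTop (𝓝 (R u - F x₀ u)) := by
    intro u hu huK
    obtain ⟨L, hL⟩ := hlim x₀ hx₀ u hu huK
    simpa [R, hL.limUnder_eq] using hL
  -- The limit does not depend on the base point.
  have hRx : ∀ x ∈ K, ∀ u, IsTest u → tsupport u ⊆ K →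
      Tendsto (fun n => q n x u) atTop (𝓝 (R u - F x u)) := by
    intro x hx u hu huK
    have hsm : Tendsto (fun n : ℕ => (F x₀ (smear (rescaled φ ((1 / 2) ^ n) 0)
        (smear (rescaled φ (2 * (1 / 2) ^ n) 0) u)) - F x (smear (rescaled φ ((1 / 2) ^ n) 0)
        (smear (rescaled φ (2 * (1 / 2) ^ n) 0) u)))) atTop (𝓝 (F x₀ u - F x u)) := by
      obtain ⟨C₀, hC₀⟩ := ((h.finiteOrder x₀).sub (h.finiteOrder x)).abs_smear_smear_sub_le
        hφt hφ1 hu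
      rw [tendsto_iff_dist_tendsto_zero]
      refine squeeze_zero (fun _ => dist_nonneg) (fun n => hC₀ _ _ (by positivity) (by positivity)) ?_
      simpa using ((hpow.add (hpow.const_mul 2)).const_mul C₀)
    have hsum := (hR u hu huK).add hsm
    have e : R u - F x₀ u + (F x₀ u - F x u) = R u - F x u := by ring
    rw [e] at hsum
    refine hsum.congr' ?_
    filter_upwards [hev] with n hn
    have := h.pairing_sub_pairing hK hK₁ hδ (by positivity) hn.1 (by positivity) hρ hn.2 hu huK hx
      hx₀
    rw [← this]
    simp only [q]; ring
  refine ⟨R, ?_, ?_, r, ?_⟩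
  · intro u v hu huK hv hvK
    have hs := (hR u hu huK).add (hR v hv hvK)
    have hs' := hR (u + v) (hu.add hv) ((tsupport_add u v).trans (union_subset huK hvK))
    have := tendsto_nhds_unique (hs'.congr' ?_) hs
    · rw [(h.finiteOrder x₀).add hu hv] at this; linarith
    · filter_upwards [hev] with n hn
      simp only [q, pairing]
      rw [← integral_add (hint n hn.1 hn.2 u hu huK) (hint n hn.1 hn.2 v hv hvK)]
      refine integral_congr_ae (ae_of_all _ fun p => ?_)
      simp only [Pi.add_apply]; ring
  · intro c u hu huK
    have hs := (hR u hu huK).const_mul c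
    have hs' := hR (c • u) (hu.smul c) ((tsupport_smul_subset_right (fun _ => c) u).trans huK)
    have := tendsto_nhds_unique (hs'.congr fun n => ?_) hs
    · rw [(h.finiteOrder x₀).smul c hu] at this; linarith
    · simp only [q, pairing]
      rw [← integral_const_mul]
      refine integral_congr_ae (ae_of_all _ fun p => ?_)
      simp only [Pi.smul_apply, smul_eq_mul]; ring
  · intro B hB
    obtain ⟨C'', hC''0, hC''⟩ := h.exists_tendsto_pairing hγ hη hK hK₁ hδ hr' hm0 hm hB
    refine ⟨C'', hC''0, fun x hx A l u hl hl1 hu huK => ?_⟩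
    obtain ⟨L, hL, hLb⟩ := hC'' x hx A l u hl hl1 hu huK
    rwa [tendsto_nhds_unique (hRx x hx u hu.isTest huK) hL]

end

section

variable {d : ℕ}

/-! ### Products, cutoffs and rescalings of test functions -/

lemma IsTest.mul {u v : Eucl d → ℝ} (hu : IsTest u) (hv : IsTest v) : IsTest (u * v) :=
  ⟨hu.1.mul hv.1, hu.2.mul_right⟩

lemma DerivBound.mono {N N' : ℕ} {B : ℝ} {u : Eucl d → ℝ} (h : DerivBound N B u) (hN : N' ≤ N) :
    DerivBound N' B u := fun k hk => h k (hk.trans hN)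

lemma norm_iteratedFDeriv_mul_le_of_le {χ u : Eucl d → ℝ} (hχ : IsTest χ) (hu : IsTest u) {k : ℕ}
    {A : ℝ} (hA : DerivBound k A χ) {b : ℝ} {x : Eucl d}
    (hb : ∀ i ≤ k, ‖iteratedFDeriv ℝ i u x‖ ≤ b) :
    ‖iteratedFDeriv ℝ k (χ * u) x‖ ≤ 2 ^ k * A * b := by
  refine (norm_iteratedFDeriv_mul_le hχ.1 hu.1 x (n := k) (by exact_mod_cast le_top)).trans ?_
  have h2 : (2 : ℝ) ^ k = ∑ i ∈ Finset.range (k + 1), (k.choose i : ℝ) := by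
    exact_mod_cast (Nat.sum_range_choose k).symm
  rw [h2, Finset.sum_mul, Finset.sum_mul]
  refine Finset.sum_le_sum fun i hi => ?_
  have hA0 := hA.nonneg
  refine mul_le_mul (mul_le_mul_of_nonneg_left (hA i (by
    have := Finset.mem_range.1 hi; omega) x) (by positivity)) (hb _ (Nat.sub_le _ _))
    (norm_nonneg _) (by positivity)

lemma DerivBound.mul {N : ℕ} {A B : ℝ} {χ u : Eucl d → ℝ} (hχ : IsTest χ) (hu : IsTest u)
    (hA : DerivBound N A χ) (hB : DerivBound N B u) : DerivBound N (2 ^ N * A * B) (χ * u) := by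
  intro k hk x
  refine (norm_iteratedFDeriv_mul_le_of_le hχ hu (hA.mono hk) fun i hi => hB i (hi.trans hk) x).trans
    ?_
  have := hA.nonneg
  have := hB.nonneg
  gcongr
  norm_num

/-- A smooth cutoff between a compact set and an open neighbourhood. -/
lemma exists_cutoff {K U : Set (Eucl d)} (hK : IsCompact K) (hU : IsOpen U) (hKU : K ⊆ U) :
    ∃ χ : Eucl d → ℝ, IsTest χ ∧ tsupport χ ⊆ U ∧ ∀ x ∈ K, χ x = 1 := by
  obtain ⟨L, hL, hKL, hLU⟩ := exists_compact_between hK hU hKU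
  obtain ⟨χ, hχ, -, hs, h1⟩ := exists_contMDiff_support_eq_eq_one_iff (𝓡 d) (n := ⊤)
    (isOpen_interior (s := L)) hK.isClosed hKL
  have hts : tsupport χ ⊆ L := by
    rw [tsupport, hs]; exact closure_minimal interior_subset hL.isClosed
  exact ⟨χ, ⟨contMDiff_iff_contDiff.1 hχ, hL.of_isClosed_subset (isClosed_tsupport _) hts⟩,
    hts.trans hLU, fun x hx => (h1 x).1 hx⟩

lemma mul_eq_of_eq_one_on_tsupport {χ u : Eucl d → ℝ} (h : ∀ x ∈ tsupport u, χ x = 1) :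
    χ * u = u := by
  ext x
  by_cases hx : x ∈ tsupport u
  · simp [h x hx]
  · simp [image_eq_zero_of_notMem_tsupport hx]

lemma tsupport_rescaled_subset {θ : Eucl d → ℝ} {ρ : ℝ} (hρ : ∀ y, θ y ≠ 0 → ‖y‖ ≤ ρ) {l : ℝ}
    (hl : 0 < l) (x : Eucl d) : tsupport (rescaled θ l x) ⊆ closedBall x (ρ * l) := by
  refine closure_minimal (fun y hy => ?_) isClosed_closedBall
  rw [mem_closedBall, dist_eq_norm]
  exact norm_sub_le_of_rescaled_ne_zero hρ hl hy

lemma scaledTest_rescaled {θ : Eucl d → ℝ} (hθ : IsTest θ) {ρ : ℝ} (hρ : ∀ y, θ y ≠ 0 → ‖y‖ ≤ ρ)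
    {r : ℕ} {A : ℝ} (hA : DerivBound r A θ) {l : ℝ} (hl : 0 < l) (x : Eucl d) :
    ScaledTest r A ρ l x (rescaled θ l x) := by
  refine ⟨hθ.rescale hl x, tsupport_rescaled_subset hρ hl x, fun k hk y => ?_⟩
  set L : Eucl d →L[ℝ] Eucl d := l⁻¹ • ContinuousLinearMap.id ℝ (Eucl d)
  have hL : ‖L‖ ≤ l⁻¹ := by
    refine (norm_smul_le l⁻¹ (ContinuousLinearMap.id ℝ (Eucl d))).trans ?_
    rw [Real.norm_of_nonneg (by positivity)]
    exact mul_le_of_le_one_right (by positivity) ContinuousLinearMap.norm_id_le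
  have hc : ContDiff ℝ ∞ (θ ∘ L) := hθ.1.comp L.contDiff
  have e0 : rescaled θ l 0 = (l ^ d)⁻¹ • (θ ∘ L) := by ext y; simp [rescaled, L]
  rw [rescaled_eq_comp_sub, iteratedFDeriv_comp_sub, e0,
    iteratedFDeriv_const_smul_apply (hc.contDiffAt.of_le (by exact_mod_cast le_top)),
    L.iteratedFDeriv_comp_right hθ.1 _ (by exact_mod_cast le_top), norm_smul,
    Real.norm_of_nonneg (by positivity), pow_add, mul_inv, mul_left_comm]
  refine mul_le_mul_of_nonneg_left ?_ (by positivity)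
  refine (ContinuousMultilinearMap.norm_compContinuousLinearMap_le _ _).trans ?_
  simp only [Finset.prod_const, Finset.card_univ, Fintype.card_fin]
  rw [← inv_pow]
  exact mul_le_mul (hA k hk _) (pow_le_pow_left₀ (norm_nonneg _) hL k) (by positivity) hA.nonneg

/-! ### Distributions on open sets as functionals -/

open TopologicalSpace (Opens Compacts)

open Classical in
/-- The value of a distribution on `Ω` at a function that is a test function on `Ω`; zero at all
other functions. -/
def evalOn {Ω : Opens (Eucl d)} (T : 𝓓'(Ω, ℝ)) (u : Eucl d → ℝ) : ℝ :=
  if h : IsTest u ∧ tsupport u ⊆ Ω then T ⟨u, h.1.1, h.1.2, h.2⟩ else 0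

section evalOn

variable {Ω : Opens (Eucl d)} (T : 𝓓'(Ω, ℝ)) {u v : Eucl d → ℝ}

lemma isTest_coe (h : 𝓓(Ω, ℝ)) : IsTest h := ⟨h.contDiff, h.hasCompactSupport⟩

lemma evalOn_eq (hu : IsTest u) (hs : tsupport u ⊆ Ω) :
    evalOn T u = T ⟨u, hu.1, hu.2, hs⟩ := dif_pos ⟨hu, hs⟩

lemma evalOn_coe (h : 𝓓(Ω, ℝ)) : evalOn T h = T h :=
  evalOn_eq T (isTest_coe h) h.tsupport_subset

lemma evalOn_add (hu : IsTest u) (hus : tsupport u ⊆ Ω) (hv : IsTest v) (hvs : tsupport v ⊆ Ω) :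
    evalOn T (u + v) = evalOn T u + evalOn T v := by
  rw [evalOn_eq T (hu.add hv) ((tsupport_add u v).trans (union_subset hus hvs)),
    evalOn_eq T hu hus, evalOn_eq T hv hvs, ← map_add]
  rfl

lemma evalOn_smul (c : ℝ) (hu : IsTest u) (hus : tsupport u ⊆ Ω) :
    evalOn T (c • u) = c * evalOn T u := by
  rw [evalOn_eq T (hu.smul c) ((tsupport_smul_subset_right (fun _ => c) u).trans hus),
    evalOn_eq T hu hus, ← smul_eq_mul, ← map_smul]
  rfl

/-- On a compact subset, a distribution has finite order. -/
lemma exists_evalOn_bound {K : Set (Eucl d)} (hK : IsCompact K) (hKΩ : K ⊆ Ω) :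
    ∃ (N : ℕ) (C : ℝ), 0 ≤ C ∧ ∀ u B, IsTest u → tsupport u ⊆ K → DerivBound N B u →
      |evalOn T u| ≤ C * B := by
  set K' : Compacts (Eucl d) := ⟨K, hK⟩
  set S : 𝓓_{K'}(Eucl d, ℝ) →L[ℝ] ℝ :=
    ⟨T.toLinearMap ∘ₗ (TestFunction.ofSupportedInCLM ℝ hKΩ).toLinearMap,
      T.cont.comp (TestFunction.ofSupportedInCLM ℝ hKΩ).cont⟩
  obtain ⟨s, C, -, hC⟩ := Seminorm.bound_of_continuous
    (ContDiffMapSupportedIn.withSeminorms ℝ (Eucl d) ℝ ⊤ K')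
    ((normSeminorm ℝ ℝ).comp S.toLinearMap) (by
      change Continuous fun u => ‖S u‖
      exact S.continuous.norm)
  refine ⟨s.sup id, C, C.2, fun u B hu hus hB => ?_⟩
  set u' : 𝓓_{K'}(Eucl d, ℝ) := .of_support_subset hu.1 ((subset_tsupport u).trans hus)
  have h1 := hC u'
  rw [evalOn_eq T hu (hus.trans hKΩ)]
  have h2 : (s.sup (ContDiffMapSupportedIn.seminorm ℝ (Eucl d) ℝ ⊤ K')) u' ≤ B := by
    refine Seminorm.finset_sup_apply_le hB.nonneg fun i hi => ?_
    rw [ContDiffMapSupportedIn.seminorm_top_le_iff ℝ hB.nonneg]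
    exact fun x _ => hB i (Finset.le_sup (f := id) hi) x
  exact h1.trans (mul_le_mul_of_nonneg_left h2 C.2)

lemma finiteOrder_cutoff {χ : Eucl d → ℝ} (hχ : IsTest χ) (hs : tsupport χ ⊆ Ω) :
    FiniteOrder fun u => evalOn T (χ * u) where
  add u v hu hv := by
    simp only [mul_add]
    exact evalOn_add T (hχ.mul hu) (tsupport_mul_subset_left.trans hs) (hχ.mul hv)
      (tsupport_mul_subset_left.trans hs)
  smul c u hu := by
    simp only [mul_smul_comm]
    exact evalOn_smul T c (hχ.mul hu) (tsupport_mul_subset_left.trans hs)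
  bound := by
    obtain ⟨N, C, hC, h⟩ := exists_evalOn_bound T hχ.2.isCompact hs
    obtain ⟨A, hA0, hA⟩ := exists_derivBound hχ.1 hχ.2 N
    refine ⟨N, C * (2 ^ N * A), by positivity, fun u B hu hB => ?_⟩
    rw [mul_assoc]
    exact h _ _ (hχ.mul hu) tsupport_mul_subset_left (hA.mul hχ hu hB)

/-- A functional that is linear and of finite order on the test functions supported in each compact
subset of `Ω` is a distribution on `Ω`. -/
lemma exists_distribution {T : (Eucl d → ℝ) → ℝ}
    (hadd : ∀ u v, IsTest u → tsupport u ⊆ Ω → IsTest v → tsupport v ⊆ Ω → T (u + v) = T u + T v)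
    (hsmul : ∀ (c : ℝ) u, IsTest u → tsupport u ⊆ Ω → T (c • u) = c * T u)
    (hb : ∀ K : Set (Eucl d), IsCompact K → K ⊆ Ω → ∃ (N : ℕ) (C : ℝ), 0 ≤ C ∧ ∀ u B, IsTest u →
      tsupport u ⊆ K → DerivBound N B u → |T u| ≤ C * B) :
    ∃ D : 𝓓'(Ω, ℝ), ∀ h : 𝓓(Ω, ℝ), D h = T h := by
  refine ⟨TestFunction.mkCLM ℝ (fun h : 𝓓(Ω, ℝ) => T h)
    (fun f g => hadd _ _ (isTest_coe f) f.tsupport_subset (isTest_coe g) g.tsupport_subset)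
    (fun c f => hsmul c _ (isTest_coe f) f.tsupport_subset) (fun K hK => ?_), fun h => rfl⟩
  obtain ⟨N, C, hC, h⟩ := hb K K.isCompact hK
  have ht : ∀ f : 𝓓_{K}(Eucl d, ℝ), IsTest f := fun f => ⟨f.contDiff, f.compact_supp⟩
  refine (ContDiffMapSupportedIn.mkCLMtoNormedSpace ℝ (fun f : 𝓓_{K}(Eucl d, ℝ) => T f)
    (fun f g => hadd _ _ (ht f) (f.tsupport_subset.trans hK) (ht g) (g.tsupport_subset.trans hK))
    (fun c f => hsmul c _ (ht f) (f.tsupport_subset.trans hK))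
    ⟨Finset.range (N + 1), C, hC, fun f => ?_⟩).continuous
  refine h f _ (ht f) f.tsupport_subset fun k hk x => ?_
  refine (ContDiffMapSupportedIn.norm_iteratedFDeriv_apply_le_seminorm_top ℝ).trans ?_
  exact Seminorm.le_finset_sup_apply (Finset.mem_range.2 (by omega))

end evalOn

end

section

variable {d : ℕ} {M : Type*} [TopologicalSpace M] [ChartedSpace (Eucl d) M]

/-! ### Transport of test functions between charts -/

/-- The transition map `φ' ∘ φ⁻¹` between two charts. -/
abbrev transition (c c' : SmoothChart d M) : OpenPartialHomeomorph (Eucl d) (Eucl d) :=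
  c.1.symm.trans c'.1

lemma mem_transition_source {c c' : SmoothChart d M} {x : Eucl d} :
    x ∈ (transition c c').source ↔ x ∈ c.1.target ∧ c.1.symm x ∈ c'.1.source := by
  simp [transition]

lemma transition_mem_source {c c' : SmoothChart d M} {x : Eucl d}
    (hx : x ∈ (transition c c').source) : transition c c' x ∈ (transition c' c).source := by
  rw [mem_transition_source] at hx ⊢
  exact ⟨c'.1.map_source hx.2, by simpa [hx.2] using c.1.map_target hx.1⟩

lemma transition_transition {a c c' : SmoothChart d M} {x : Eucl d}
    (hx : x ∈ (transition a c).source) : transition c c' (transition a c x) = transition a c' x := by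
  rw [mem_transition_source] at hx
  simp [transition, hx.2]

lemma transition_self {c : SmoothChart d M} {x : Eucl d} (hx : x ∈ c.1.target) :
    transition c c x = x := by simp [transition, hx]

lemma transition_left_inv {c c' : SmoothChart d M} {x : Eucl d}
    (hx : x ∈ (transition c c').source) : transition c' c (transition c c' x) = x := by
  rw [transition_transition hx, transition_self (mem_transition_source.1 hx).1]

lemma symm_transition {c c' : SmoothChart d M} {x : Eucl d}
    (hx : x ∈ (transition c c').source) : c'.1.symm (transition c c' x) = c.1.symm x := by
  rw [mem_transition_source] at hx
  simp [transition, hx.2]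

lemma contDiffOn_transition (c c' : SmoothChart d M) :
    ContDiffOn ℝ ∞ (transition c c') (transition c c').source := by
  rw [← contMDiffOn_iff_contDiffOn]
  refine (contMDiffOn_of_mem_maximalAtlas c'.2).comp
    ((contMDiffOn_symm_of_mem_maximalAtlas c.2).mono fun x hx =>
      (mem_transition_source.1 hx).1) fun x hx => (mem_transition_source.1 hx).2

lemma differentiableAt_transition {c c' : SmoothChart d M} {x : Eucl d}
    (hx : x ∈ (transition c c').source) : DifferentiableAt ℝ (transition c c') x :=
  ((contDiffOn_transition c c').contDiffAt ((transition c c').open_source.mem_nhds hx)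
    ).differentiableAt (by simp)

lemma fderiv_transition_comp {a c c' : SmoothChart d M} {x : Eucl d}
    (h1 : x ∈ (transition a c).source) (h2 : x ∈ (transition a c').source) :
    fderiv ℝ (transition a c') x =
      (fderiv ℝ (transition c c') (transition a c x)).comp (fderiv ℝ (transition a c) x) := by
  have h3 : transition a c x ∈ (transition c c').source := by
    rw [mem_transition_source]
    refine ⟨(mem_transition_source.1 (transition_mem_source h1)).1, ?_⟩
    rw [symm_transition h1]
    exact (mem_transition_source.1 h2).2
  rw [← fderiv_comp x (differentiableAt_transition h3) (differentiableAt_transition h1)]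
  refine Filter.EventuallyEq.fderiv_eq ?_
  filter_upwards [(transition a c).open_source.mem_nhds h1] with y hy
  exact (transition_transition hy).symm

lemma det_fderiv_transition_ne_zero {c c' : SmoothChart d M} {x : Eucl d}
    (hx : x ∈ (transition c c').source) : (fderiv ℝ (transition c c') x).det ≠ 0 := by
  have hxt := (mem_transition_source.1 hx).1
  have h2 : x ∈ (transition c c).source := mem_transition_source.2 ⟨hxt, c.1.map_target hxt⟩
  have h := fderiv_transition_comp hx h2
  have hid : fderiv ℝ (transition c c) x = ContinuousLinearMap.id ℝ _ := by
    rw [← fderiv_id (𝕜 := ℝ) (x := x)]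
    refine Filter.EventuallyEq.fderiv_eq ?_
    filter_upwards [c.1.open_target.mem_nhds hxt] with y hy
    exact transition_self hy
  rw [hid] at h
  intro h0
  have hdet := congrArg ContinuousLinearMap.det h
  rw [ContinuousLinearMap.det, ContinuousLinearMap.det] at hdet
  rw [ContinuousLinearMap.det] at h0
  simp only [ContinuousLinearMap.toLinearMap_comp, LinearMap.det_comp, h0, mul_zero,
    ContinuousLinearMap.coe_id, LinearMap.det_id] at hdet
  exact one_ne_zero hdet

lemma contDiff_det : ContDiff ℝ ∞ fun L : Eucl d →L[ℝ] Eucl d => L.det := by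
  have e : (fun L : Eucl d →L[ℝ] Eucl d => L.det) = fun L =>
      ∑ σ : Equiv.Perm (Fin d), Equiv.Perm.sign σ • ∏ i,
        (L (EuclideanSpace.basisFun (Fin d) ℝ i)) (σ i) := by
    ext L
    rw [ContinuousLinearMap.det,
      ← LinearMap.det_toMatrix (EuclideanSpace.basisFun (Fin d) ℝ).toBasis, Matrix.det_apply]
    simp [LinearMap.toMatrix_apply]
  rw [e]
  refine ContDiff.sum fun σ _ => ContDiff.const_smul _ (contDiff_prod fun i _ => ?_)
  have h1 : ContDiff ℝ ∞ fun L : Eucl d →L[ℝ] Eucl d => L (EuclideanSpace.basisFun (Fin d) ℝ i) :=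
    contDiff_id.clm_apply contDiff_const
  exact (EuclideanSpace.proj (𝕜 := ℝ) (σ i)).contDiff.comp h1

/-- The Jacobian factor of the transition map is smooth. -/
lemma contDiffOn_abs_det (c c' : SmoothChart d M) :
    ContDiffOn ℝ ∞ (fun x => |(fderiv ℝ (transition c c') x).det|) (transition c c').source := by
  have h1 : ContDiffOn ℝ ∞ (fderiv ℝ (transition c c')) (transition c c').source :=
    (contDiffOn_transition c c').fderiv_of_isOpen (transition c c').open_source (by simp)
  have h2 := contDiff_det.comp_contDiffOn h1
  intro x hx
  exact (contDiffAt_abs (det_fderiv_transition_ne_zero hx)).comp_contDiffWithinAt x (h2 x hx)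

lemma transportTest_apply {c c' : SmoothChart d M} {h : Eucl d → ℝ} {x : Eucl d}
    (hx : x ∈ (transition c c').source) :
    transportTest c c' h x = |(fderiv ℝ (transition c c') x).det| * h (transition c c' x) :=
  indicator_of_mem hx _

lemma transportTest_of_notMem {c c' : SmoothChart d M} {h : Eucl d → ℝ} {x : Eucl d}
    (hx : x ∉ (transition c c').source) : transportTest c c' h x = 0 :=
  indicator_of_notMem hx _

lemma transportTest_add (c c' : SmoothChart d M) (u v : Eucl d → ℝ) :
    transportTest c c' (u + v) = transportTest c c' u + transportTest c c' v := by
  ext x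
  by_cases hx : x ∈ (transition c c').source
  · simp only [Pi.add_apply, transportTest_apply hx, mul_add]
  · simp only [Pi.add_apply, transportTest_of_notMem hx, add_zero]

lemma transportTest_smul (c c' : SmoothChart d M) (a : ℝ) (u : Eucl d → ℝ) :
    transportTest c c' (a • u) = a • transportTest c c' u := by
  ext x
  by_cases hx : x ∈ (transition c c').source
  · simp only [Pi.smul_apply, transportTest_apply hx, smul_eq_mul, mul_left_comm]
  · simp only [Pi.smul_apply, transportTest_of_notMem hx, smul_zero]

lemma mem_image_of_transportTest_ne_zero {c c' : SmoothChart d M} {h : Eucl d → ℝ} {x : Eucl d}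
    (hx : transportTest c c' h x ≠ 0) :
    x ∈ (transition c c').source ∧ x ∈ transition c' c '' Function.support h := by
  have hs : x ∈ (transition c c').source := by
    by_contra hs; exact hx (transportTest_of_notMem hs)
  rw [transportTest_apply hs] at hx
  exact ⟨hs, _, right_ne_zero_of_mul hx, transition_left_inv hs⟩

lemma isCompact_transition_image {c c' : SmoothChart d M} {W : Set (Eucl d)} (hW : IsCompact W)
    (hWs : W ⊆ (transition c' c).source) : IsCompact (transition c' c '' W) :=
  hW.image_of_continuousOn ((transition c' c).continuousOn.mono hWs)

lemma transition_image_subset {c c' : SmoothChart d M} {W : Set (Eucl d)}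
    (hWs : W ⊆ (transition c' c).source) : transition c' c '' W ⊆ (transition c c').source := by
  rintro _ ⟨y, hy, rfl⟩
  exact transition_mem_source (hWs hy)

lemma tsupport_transportTest_subset {c c' : SmoothChart d M} {h : Eucl d → ℝ}
    (hh : HasCompactSupport h) (hs : tsupport h ⊆ (transition c' c).source) :
    tsupport (transportTest c c' h) ⊆ transition c' c '' tsupport h := by
  refine closure_minimal (fun x hx => ?_) (isCompact_transition_image hh hs).isClosed
  exact image_mono (subset_tsupport h) (mem_image_of_transportTest_ne_zero hx).2

/-- Transport is functorial. -/
lemma transportTest_transportTest {a c c' : SmoothChart d M}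
    {h : Eucl d → ℝ} (hs : Function.support h ⊆ (transition c' c).source) :
    transportTest a c (transportTest c c' h) = transportTest a c' h := by
  ext x
  by_cases hac' : x ∈ (transition a c').source
  · rw [transportTest_apply hac']
    by_cases hac : x ∈ (transition a c).source
    · rw [transportTest_apply hac, transportTest_apply (by
        rw [mem_transition_source, symm_transition hac]
        exact ⟨(mem_transition_source.1 (transition_mem_source hac)).1,
          (mem_transition_source.1 hac').2⟩), transition_transition hac,
        fderiv_transition_comp hac hac', ← mul_assoc, ← abs_mul]
      congr 2
      simp only [ContinuousLinearMap.det, ContinuousLinearMap.toLinearMap_comp, LinearMap.det_comp]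
      ring
    · rw [transportTest_of_notMem hac]
      have : h (transition a c' x) = 0 := by
        by_contra h0
        have h1 := mem_transition_source.1 (hs h0)
        rw [symm_transition hac'] at h1
        exact hac (mem_transition_source.2 ⟨(mem_transition_source.1 hac').1, h1.2⟩)
      rw [this, mul_zero]
  · rw [transportTest_of_notMem hac']
    by_cases hac : x ∈ (transition a c).source
    · rw [transportTest_apply hac, transportTest_of_notMem, mul_zero]
      intro h1
      rw [mem_transition_source, symm_transition hac] at h1
      exact hac' (mem_transition_source.2 ⟨(mem_transition_source.1 hac).1, h1.2⟩)
    · rw [transportTest_of_notMem hac]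

lemma isTest_transportTest {c c' : SmoothChart d M} {h : Eucl d → ℝ} (hh : IsTest h)
    (hs : tsupport h ⊆ (transition c' c).source) : IsTest (transportTest c c' h) := by
  have hV := isCompact_transition_image hh.2 hs
  have hts := tsupport_transportTest_subset hh.2 hs
  refine ⟨contDiff_iff_contDiffAt.2 fun x => ?_, hV.of_isClosed_subset (isClosed_tsupport _) hts⟩
  by_cases hx : x ∈ tsupport (transportTest c c' h)
  swap
  · exact contDiffAt_const.congr_of_eventuallyEq (notMem_tsupport_iff_eventuallyEq.1 hx)
  have hxs := transition_image_subset hs (hts hx)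
  have ho := (transition c c').open_source
  have h1 : ContDiffOn ℝ ∞ (fun x => |(fderiv ℝ (transition c c') x).det| *
      h (transition c c' x)) (transition c c').source :=
    (contDiffOn_abs_det c c').mul (hh.1.comp_contDiffOn (contDiffOn_transition c c'))
  refine (h1.contDiffAt (ho.mem_nhds hxs)).congr_of_eventuallyEq ?_
  filter_upwards [ho.mem_nhds hxs] with y hy using transportTest_apply hy

/-- On functions supported in a fixed compact set, transport is bounded in every `C^r` norm. -/
lemma exists_transportTest_bound {c c' : SmoothChart d M} {W : Set (Eucl d)} (hW : IsCompact W)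
    (hWs : W ⊆ (transition c' c).source) (r : ℕ) :
    ∃ C, 0 ≤ C ∧ ∀ h, IsTest h → tsupport h ⊆ W → ∀ k ≤ r, ∀ b,
      (∀ i ≤ k, ∀ y, ‖iteratedFDeriv ℝ i h y‖ ≤ b) →
        ∀ x, ‖iteratedFDeriv ℝ k (transportTest c c' h) x‖ ≤ C * b := by
  set S := (transition c c').source
  have hSo : IsOpen S := (transition c c').open_source
  have hV := isCompact_transition_image hW hWs
  have hVS := transition_image_subset hWs
  set V := transition c' c '' W
  have hbd : ∀ {G : Type} [NormedAddCommGroup G] [NormedSpace ℝ G] (w : Eucl d → G),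
      ContDiffOn ℝ ∞ w S → ∃ D, 1 ≤ D ∧ ∀ k ≤ r, ∀ x ∈ V, ‖iteratedFDerivWithin ℝ k w S x‖ ≤ D := by
    intro G _ _ w hw
    have h : ∀ k : ℕ, ∃ D, ∀ x ∈ V, ‖iteratedFDerivWithin ℝ k w S x‖ ≤ D := fun k =>
      hV.exists_bound_of_continuousOn ((hw.continuousOn_iteratedFDerivWithin
        (by exact_mod_cast le_top) hSo.uniqueDiffOn).mono hVS)
    choose D hD using h
    refine ⟨1 + ∑ k ∈ Finset.range (r + 1), |D k|, by
      have : 0 ≤ ∑ k ∈ Finset.range (r + 1), |D k| := Finset.sum_nonneg fun _ _ => abs_nonneg _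
      linarith, fun k hk x hx => (hD k x hx).trans ((le_abs_self _).trans ?_)⟩
    have := Finset.single_le_sum (f := fun k => |D k|) (fun _ _ => abs_nonneg _)
      (Finset.mem_range.2 (by omega : k < r + 1))
    linarith
  have hJ := contDiffOn_abs_det c c'
  have hτ := contDiffOn_transition c c'
  obtain ⟨A, hA1, hA⟩ := hbd _ hJ
  obtain ⟨D, hD1, hD⟩ := hbd _ hτ
  refine ⟨2 ^ r * A * (r.factorial * D ^ r), by positivity, fun h hh hhW k hk b hb x => ?_⟩
  have hb0 : 0 ≤ b := (norm_nonneg _).trans (hb 0 (Nat.zero_le _) 0)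
  by_cases hx : x ∈ V
  swap
  · have hx' : x ∉ tsupport (transportTest c c' h) := fun h' =>
      hx (image_mono hhW (tsupport_transportTest_subset hh.2 (hhW.trans hWs) h'))
    rw [image_eq_zero_of_notMem_tsupport (fun h' => hx' (tsupport_iteratedFDeriv_subset k h')),
      norm_zero]
    positivity
  have hxS := hVS hx
  have hcomp : ContDiffOn ℝ ∞ (h ∘ transition c c') S := hh.1.comp_contDiffOn hτ
  have heq : iteratedFDeriv ℝ k (transportTest c c' h) x = iteratedFDerivWithin ℝ k
      (fun y => |(fderiv ℝ (transition c c') y).det| * (h ∘ transition c c') y) S x := by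
    rw [← iteratedFDerivWithin_of_isOpen k hSo hxS]
    exact iteratedFDerivWithin_congr (fun y hy => transportTest_apply hy) hxS k
  have hcb : ∀ j ≤ k, ‖iteratedFDerivWithin ℝ j (h ∘ transition c c') S x‖ ≤
      r.factorial * D ^ r * b := by
    intro j hj
    have := norm_iteratedFDerivWithin_comp_le (t := univ) (n := j) (C := b) (D := D)
      hh.1.contDiffOn hτ (by exact_mod_cast le_top) uniqueDiffOn_univ hSo.uniqueDiffOn
      (mapsTo_univ _ _) hxS (fun i hi => by
        rw [iteratedFDerivWithin_univ]; exact hb i (hi.trans hj) _)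
      (fun i hi1 hi => (hD i (by omega) x hx).trans (le_self_pow₀ hD1 (by omega)))
    refine this.trans ?_
    rw [mul_right_comm]
    refine mul_le_mul_of_nonneg_right ?_ hb0
    exact mul_le_mul (by exact_mod_cast Nat.factorial_le (hj.trans hk))
      (pow_le_pow_right₀ hD1 (hj.trans hk)) (by positivity) (by positivity)
  rw [heq]
  refine (norm_iteratedFDerivWithin_mul_le hJ hcomp hSo.uniqueDiffOn hxS (n := k)
    (by exact_mod_cast le_top)).trans ?_
  have h2 : (2 : ℝ) ^ k = ∑ i ∈ Finset.range (k + 1), (k.choose i : ℝ) := by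
    exact_mod_cast (Nat.sum_range_choose k).symm
  calc ∑ i ∈ Finset.range (k + 1), (k.choose i : ℝ) * ‖iteratedFDerivWithin ℝ i
        (fun y => |(fderiv ℝ (transition c c') y).det|) S x‖ *
          ‖iteratedFDerivWithin ℝ (k - i) (h ∘ transition c c') S x‖
      ≤ ∑ i ∈ Finset.range (k + 1), (k.choose i : ℝ) * A * (r.factorial * D ^ r * b) := by
        refine Finset.sum_le_sum fun i hi => ?_
        have hi' := Finset.mem_range.1 hi
        exact mul_le_mul (mul_le_mul_of_nonneg_left (hA i (by omega) x hx) (by positivity))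
          (hcb _ (Nat.sub_le _ _)) (norm_nonneg _) (by positivity)
    _ = 2 ^ k * A * (r.factorial * D ^ r * b) := by
        rw [h2, Finset.sum_mul, Finset.sum_mul]
    _ ≤ 2 ^ r * A * (r.factorial * D ^ r * b) := by
        gcongr
        norm_num
    _ = _ := by ring

/-- The compatibility of a distribution on `M` with changes of charts. -/
lemma evalOn_push_transportTest (T : ManifoldDistribution d M)
    {c c' : SmoothChart d M} {h : Eucl d → ℝ} (hh : IsTest h)
    (hs : tsupport h ⊆ (transition c' c).source) :
    evalOn (T.push c') h = evalOn (T.push c) (transportTest c c' h) := by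
  have h1 : tsupport h ⊆ c'.image := fun x hx => (mem_transition_source.1 (hs hx)).1
  have h2 : tsupport (transportTest c c' h) ⊆ c.image := fun x hx =>
    (mem_transition_source.1 (transition_image_subset hs
      (tsupport_transportTest_subset hh.2 hs hx))).1
  rw [evalOn_eq _ hh h1, evalOn_eq _ (isTest_transportTest hh hs) h2]
  exact T.overlap c c' _ _ hs rfl

end

section

variable {d : ℕ} {M : Type*} [TopologicalSpace M] [ChartedSpace (Eucl d) M]

/-! ### Reconstruction in a single chart -/

/-- The germ `F` read in the chart `c`, as a family of functionals indexed by points of `ℝ^d`. -/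
def chartGerm (F : M → ManifoldDistribution d M) (c : SmoothChart d M) (x : Eucl d)
    (u : Eucl d → ℝ) : ℝ :=
  evalOn ((F (c.1.symm x)).push c) u

lemma ReconstructsOn.congr {γ : ℝ} {K : Set (Eucl d)} {F G : Eucl d → (Eucl d → ℝ) → ℝ}
    {R : (Eucl d → ℝ) → ℝ} (h : ReconstructsOn γ K F R)
    (hFG : ∀ x ∈ K, ∀ u, IsTest u → tsupport u ⊆ K → F x u = G x u) : ReconstructsOn γ K G R := by
  refine ⟨h.add, h.smul, ?_⟩
  obtain ⟨r, hr⟩ := h.bound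
  refine ⟨r, fun B hB => ?_⟩
  obtain ⟨C, hC, hb⟩ := hr B hB
  refine ⟨C, hC, fun x hx A l u hl hl1 hu hus => ?_⟩
  rw [← hFG x hx u hu.isTest hus]
  exact hb x hx A l u hl hl1 hu hus

variable [MeasurableSpace M] [BorelSpace M]

lemma measurable_indicator_comp_symm {c : SmoothChart d M} {K : Set (Eucl d)} (hK : IsCompact K)
    (hKc : K ⊆ c.1.target) {m : M → ℝ} (hm : Measurable m) :
    Measurable (K.indicator fun z => m (c.1.symm z)) := by
  refine measurable_of_restrict_of_restrict_compl hK.measurableSet ?_ ?_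
  · have h : K.domRestrict (K.indicator fun z => m (c.1.symm z)) =
        m ∘ K.domRestrict c.1.symm := by
      ext ⟨z, hz⟩; simp [hz]
    rw [h]
    exact hm.comp (continuousOn_iff_continuous_domRestrict.1
      (c.1.continuousOn_symm.mono hKc)).measurable
  · have h : Kᶜ.domRestrict (K.indicator fun z => m (c.1.symm z)) = fun _ => 0 := by
      ext ⟨z, hz⟩; exact indicator_of_notMem hz _
    rw [h]
    exact measurable_const

/-- A coherent germ, read in a chart of the atlas, has a reconstruction on each compact subset of the
image of the chart. -/
theorem exists_reconstructsOn_chartGerm {A : Set (SmoothChart d M)} {γ : ℝ} (hγ : 0 < γ)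
    {F : M → ManifoldDistribution d M} (hF : IsGerm F) (hcoh : IsCoherent A γ F)
    {c : SmoothChart d M} (hc : c ∈ A) {K : Set (Eucl d)} (hK : IsCompact K)
    (hKc : K ⊆ c.1.target) : ∃ R, ReconstructsOn γ K (chartGerm F c) R := by
  rcases K.eq_empty_or_nonempty with rfl | ⟨x₀, hx₀⟩
  · exact ⟨fun _ => 0, fun _ _ _ _ _ _ => by simp, fun _ _ _ _ => by simp, 0,
      fun _ _ => ⟨0, le_rfl, fun x hx => hx.elim⟩⟩
  obtain ⟨f, hf0, hf⟩ := hcoh c hc ⟨_, c.1.map_target (hKc hx₀)⟩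
  obtain ⟨δ₀, hδ₀, hδ₀K⟩ := hK.exists_cthickening_subset_open c.1.open_target hKc
  set δ := δ₀ / 2
  have hδ : 0 < δ := by positivity
  have hK₂ : IsCompact (cthickening δ₀ K) := hK.cthickening
  have hK₁ : IsCompact (cthickening δ K) := hK.cthickening
  have h12 : cthickening δ K ⊆ cthickening δ₀ K := cthickening_mono (by simp only [δ]; linarith) K
  have hK1c := h12.trans hδ₀K
  obtain ⟨χ, hχ, hχs, hχ1⟩ := exists_cutoff hK₂ c.1.open_target hδ₀K
  obtain ⟨ρ, hρ, hfρ⟩ := exists_norm_le_of_hasCompactSupport (isTest_coe f).2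
  -- The coherence bound is applied on `cthickening δ K`; another margin `δ` leaves room for the
  -- supports of the kernels `f^ε_y` with `y` in this set.
  obtain ⟨a, ha, C, η, hη, -, hC⟩ := hf (c.1.symm '' cthickening δ K)
    (hK₁.image_of_continuousOn (c.1.continuousOn_symm.mono hK1c))
    (by rintro _ ⟨y, hy, rfl⟩; exact c.1.map_target (hK1c hy))
  have hχu : ∀ u, tsupport u ⊆ cthickening δ₀ K → χ * u = u := fun u hu =>
    mul_eq_of_eq_one_on_tsupport fun x hx => hχ1 x (hu hx)
  -- The values outside a compact neighbourhood of `K` are discarded, for the sake of measurability.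
  set G : Eucl d → (Eucl d → ℝ) → ℝ := fun z u =>
    (cthickening δ K).indicator (fun z => chartGerm F c z (χ * u)) z
  have hG : CoherentOn γ a |C| (min η (δ / ρ)) f (cthickening δ K) G := by
    refine ⟨fun z => ?_, fun u hu => ?_, isTest_coe f, ha, abs_nonneg C, fun z hz y hy ε hε hεη => ?_⟩
    · by_cases hz : z ∈ cthickening δ K
      · simp only [G, indicator_of_mem hz]
        exact finiteOrder_cutoff _ hχ hχs
      · simp only [G, indicator_of_notMem hz]
        exact ⟨fun _ _ _ _ => by simp, fun _ _ _ => by simp, 0, 0, le_rfl, fun _ _ _ _ => by simp⟩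
    · have e : (fun z => chartGerm F c z (χ * u)) = fun z =>
          (fun p => (F p).push c ⟨χ * u, (hχ.mul hu).1, (hχ.mul hu).2,
            tsupport_mul_subset_left.trans hχs⟩) (c.1.symm z) := by
        ext z
        exact evalOn_eq _ (hχ.mul hu) (tsupport_mul_subset_left.trans hχs)
      simp only [G, e]
      exact measurable_indicator_comp_symm hK₁ hK1c (hF c _)
    · have hs : tsupport (rescaled f ε y) ⊆ cthickening δ₀ K := by
        refine (tsupport_rescaled_subset hfρ hε y).trans ?_
        have h1 : ρ * ε ≤ δ := by
          rw [← le_div_iff₀' hρ]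
          exact hεη.trans (min_le_right _ _)
        intro w hw
        have h2 := cthickening_cthickening_subset hδ.le hδ.le K
          (closedBall_subset_cthickening hy δ (closedBall_subset_closedBall h1 hw))
        simpa [δ] using h2
      have ht := (isTest_coe f).rescale hε y
      have h1 := hC _ (mem_image_of_mem _ hz) _ (mem_image_of_mem _ hy) ε hε
        (hεη.trans (min_le_left _ _)) ⟨_, ht.1, ht.2, hs.trans hδ₀K⟩
        (by rw [c.1.right_inv (hK1c hy)]; rfl)
      rw [c.1.right_inv (hK1c hy), c.1.right_inv (hK1c hz)] at h1
      simp only [G, indicator_of_mem hz, indicator_of_mem hy, hχu _ hs, chartGerm,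
        evalOn_eq (Ω := c.image) _ ht (hs.trans hδ₀K)]
      refine h1.trans (mul_le_mul_of_nonneg_right (le_abs_self C) ?_)
      have := dist_nonneg (x := z) (y := y)
      positivity
  obtain ⟨R, hR⟩ := hG.exists_reconstructsOn hf0 hγ (by positivity) hK (fun z hz y hy =>
    closedBall_subset_cthickening hz δ (by rwa [mem_closedBall, dist_eq_norm])) hδ
  refine ⟨R, hR.congr fun x hx u hu hus => ?_⟩
  simp only [G, indicator_of_mem (self_subset_cthickening K hx)]
  rw [hχu u (hus.trans (self_subset_cthickening K))]

end

section

variable {d : ℕ} {M : Type*} [TopologicalSpace M] [ChartedSpace (Eucl d) M]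

/-! ### Independence of the chart -/

lemma exists_normed_bump (x : Eucl d) {ρ : ℝ} (hρ : 0 < ρ) :
    ∃ θ : Eucl d → ℝ, IsTest θ ∧ ∫ y, θ y = 1 ∧ tsupport θ ⊆ closedBall x ρ := by
  set f : ContDiffBump x := ⟨ρ / 2, ρ, by positivity, by linarith⟩
  refine ⟨f.normed volume, ⟨f.contDiff_normed, f.hasCompactSupport_normed⟩, f.integral_normed, ?_⟩
  rw [f.tsupport_normed_eq]

section

variable {γ : ℝ} {F : M → ManifoldDistribution d M} {c c' : SmoothChart d M} {K K' : Set (Eucl d)}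
  {R R' : (Eucl d → ℝ) → ℝ}

lemma ReconstructsOn.map_zero {F : Eucl d → (Eucl d → ℝ) → ℝ} (h : ReconstructsOn γ K F R) :
    R 0 = 0 := by
  have := h.smul 0 IsTest.zero (by simp [tsupport])
  simpa using this

/-- A local reconstruction is of finite order: compare it with one element of the germ, at unit
scale. -/
lemma ReconstructsOn.exists_bound (h : ReconstructsOn γ K (chartGerm F c) R) (hK : IsCompact K)
    (hKc : K ⊆ c.1.target) : ∃ (N : ℕ) (C : ℝ), 0 ≤ C ∧ ∀ u B, IsTest u → tsupport u ⊆ K →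
      DerivBound N B u → |R u| ≤ C * B := by
  rcases K.eq_empty_or_nonempty with rfl | ⟨x₀, hx₀⟩
  · refine ⟨0, 0, le_rfl, fun u B hu hus hB => ?_⟩
    have h0 : u = 0 := by
      rw [← tsupport_eq_empty_iff]; exact subset_empty_iff.1 hus
    rw [h0, h.map_zero, abs_zero, zero_mul]
  obtain ⟨D, hD⟩ := hK.isBounded.subset_closedBall x₀
  obtain ⟨r, hr⟩ := h.bound
  obtain ⟨C, hC, hb⟩ := hr (max D 0) (le_max_right _ _)
  obtain ⟨N, C₁, hC₁, hb₁⟩ := exists_evalOn_bound ((F (c.1.symm x₀)).push c) hK hKc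
  refine ⟨max r N, C + C₁, by positivity, fun u B hu hus hB => ?_⟩
  have h1 := hb x₀ hx₀ B 1 u one_pos le_rfl ⟨hu, hus.trans (hD.trans
    (closedBall_subset_closedBall (by simp))), fun k hk y => by
      simpa using hB k (hk.trans (le_max_left _ _)) y⟩ hus
  have h2 := hb₁ u B hu hus (hB.mono (le_max_right _ _))
  rw [Real.one_rpow, mul_one] at h1
  have h3 := abs_sub_abs_le_abs_sub (R u) (chartGerm F c x₀ u)
  change |chartGerm F c x₀ u| ≤ _ at h2
  linarith

lemma ReconstructsOn.finiteOrder_cutoff (h : ReconstructsOn γ K (chartGerm F c) R)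
    (hK : IsCompact K) (hKc : K ⊆ c.1.target) {χ : Eucl d → ℝ} (hχ : IsTest χ)
    (hs : tsupport χ ⊆ K) : FiniteOrder fun v => R (χ * v) where
  add u v hu hv := by
    simp only [mul_add]
    exact h.add (hχ.mul hu) (tsupport_mul_subset_left.trans hs) (hχ.mul hv)
      (tsupport_mul_subset_left.trans hs)
  smul a u hu := by
    simp only [mul_smul_comm]
    exact h.smul a (hχ.mul hu) (tsupport_mul_subset_left.trans hs)
  bound := by
    obtain ⟨N, C, hC, hb⟩ := h.exists_bound hK hKc
    obtain ⟨A, hA0, hA⟩ := exists_derivBound hχ.1 hχ.2 N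
    refine ⟨N, C * (2 ^ N * A), by positivity, fun u B hu hB => ?_⟩
    rw [mul_assoc]
    exact hb _ _ (hχ.mul hu) (tsupport_mul_subset_left.trans hs) (hA.mul hχ hu hB)

lemma ReconstructsOn.finiteOrder_transport (h : ReconstructsOn γ K (chartGerm F c) R)
    (hK : IsCompact K) (hKc : K ⊆ c.1.target) {χ : Eucl d → ℝ} (hχ : IsTest χ)
    (hs : tsupport χ ⊆ (transition c' c).source) (hs' : MapsTo (transition c' c) (tsupport χ) K) :
    FiniteOrder fun v => R (transportTest c c' (χ * v)) := by
  have h1 : ∀ v : Eucl d → ℝ, tsupport (χ * v) ⊆ tsupport χ := fun v => tsupport_mul_subset_left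
  have ht : ∀ v, IsTest v → IsTest (transportTest c c' (χ * v)) := fun v hv =>
    isTest_transportTest (hχ.mul hv) ((h1 v).trans hs)
  have hts : ∀ v, IsTest v → tsupport (transportTest c c' (χ * v)) ⊆ K := fun v hv =>
    (tsupport_transportTest_subset (hχ.mul hv).2 ((h1 v).trans hs)).trans
      ((image_mono (h1 v)).trans hs'.image_subset)
  refine ⟨fun u v hu hv => ?_, fun a u hu => ?_, ?_⟩
  · simp only [mul_add, transportTest_add]
    exact h.add (ht u hu) (hts u hu) (ht v hv) (hts v hv)
  · simp only [mul_smul_comm, transportTest_smul]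
    exact h.smul a (ht u hu) (hts u hu)
  · obtain ⟨N, C, hC, hb⟩ := h.exists_bound hK hKc
    obtain ⟨A, hA0, hA⟩ := exists_derivBound hχ.1 hχ.2 N
    obtain ⟨C', hC', hb'⟩ := exists_transportTest_bound hχ.2.isCompact hs N
    refine ⟨N, C * (C' * (2 ^ N * A)), by positivity, fun u B hu hB => ?_⟩
    have h2 : DerivBound N (C' * (2 ^ N * A * B)) (transportTest c c' (χ * u)) := fun k hk x =>
      hb' _ (hχ.mul hu) (h1 u) k hk _ (fun i hi y => hA.mul hχ hu hB i (hi.trans hk) y) x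
    refine (hb _ _ (ht u hu) (hts u hu) h2).trans_eq ?_
    ring

/-- Transport turns test functions at scale `l` into test functions at scale `l`. -/
lemma exists_scaledTest_transportTest {W : Set (Eucl d)} (hW : IsCompact W)
    (hWs : W ⊆ (transition c' c).source) (r : ℕ) :
    ∃ C D, 0 ≤ C ∧ 0 ≤ D ∧ ∀ A l z v, 0 < l → l ≤ 1 → closedBall z l ⊆ W →
      ScaledTest r A 1 l z v →
        ScaledTest r (C * A) D l (transition c' c z) (transportTest c c' v) := by
  obtain ⟨C, hC, hb⟩ := exists_transportTest_bound hW hWs r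
  have hcont : ContinuousOn (fderiv ℝ (transition c' c)) W :=
    ((contDiffOn_transition c' c).continuousOn_fderiv_of_isOpen (transition c' c).open_source
      (by simp)).mono hWs
  obtain ⟨D, hD⟩ := hW.exists_bound_of_continuousOn hcont
  refine ⟨C, max D 0, hC, le_max_right _ _, fun A l z v hl hl1 hz hv => ?_⟩
  have hvs : tsupport v ⊆ closedBall z l := by simpa using hv.tsupport_subset
  have hA := hv.nonneg hl
  refine ⟨isTest_transportTest hv.isTest (hvs.trans (hz.trans hWs)), ?_, fun k hk y => ?_⟩
  · refine (tsupport_transportTest_subset hv.isTest.2 (hvs.trans (hz.trans hWs))).trans ?_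
    rintro _ ⟨y, hy, rfl⟩
    rw [mem_closedBall, dist_eq_norm]
    have hzl : z ∈ closedBall z l := mem_closedBall_self hl.le
    refine ((convex_closedBall z l).norm_image_sub_le_of_norm_fderiv_le (𝕜 := ℝ)
      (fun x hx => differentiableAt_transition (hWs (hz hx)))
      (fun x hx => (hD x (hz hx)).trans (le_max_left D 0)) hzl (hvs hy)).trans ?_
    have := hvs hy
    rw [mem_closedBall, dist_eq_norm] at this
    exact mul_le_mul_of_nonneg_left this (le_max_right _ _)
  · rw [mul_assoc]
    refine hb v hv.isTest (hvs.trans hz) k hk _ (fun i hi x => ?_) y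
    refine (hv.bound i (hi.trans hk) x).trans (mul_le_mul_of_nonneg_left ?_ hA)
    exact inv_anti₀ (by positivity) (pow_le_pow_of_le_one hl.le hl1 (by omega))

/-- Local reconstructions of the same germ in two charts correspond to each other under transport of
test functions: their difference is of order `ε^γ` at scale `ε`, hence zero. -/
theorem ReconstructsOn.eq_transportTest (hγ : 0 < γ) (hR : ReconstructsOn γ K (chartGerm F c) R)
    (hK : IsCompact K) (hKc : K ⊆ c.1.target) (hR' : ReconstructsOn γ K' (chartGerm F c') R')
    (hK' : IsCompact K') (hKc' : K' ⊆ c'.1.target) {u : Eucl d → ℝ} (hu : IsTest u)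
    (h1 : tsupport u ⊆ interior K') (h2 : tsupport u ⊆ (transition c' c).source)
    (h3 : MapsTo (transition c' c) (tsupport u) (interior K)) :
    R' u = R (transportTest c c' u) := by
  -- The difference of the two functionals, cut off near the support of `u`, is of finite order on
  -- all of `ℝ^d`.
  set O := interior K' ∩ ((transition c' c).source ∩ transition c' c ⁻¹' interior K)
  have hO : IsOpen O := isOpen_interior.inter ((transition c' c).isOpen_inter_preimage
    isOpen_interior)
  have huO : tsupport u ⊆ O := fun x hx => ⟨h1 hx, h2 hx, h3 hx⟩
  obtain ⟨W, hW, huW, hWO⟩ := exists_compact_between hu.2.isCompact hO huO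
  obtain ⟨χ, hχ, hχO, hχ1⟩ := exists_cutoff hW hO hWO
  have hχu : ∀ v : Eucl d → ℝ, tsupport v ⊆ W → χ * v = v := fun v hv =>
    mul_eq_of_eq_one_on_tsupport fun x hx => hχ1 x (hv hx)
  have hS : FiniteOrder fun v => R' (χ * v) - R (transportTest c c' (χ * v)) :=
    (hR'.finiteOrder_cutoff hK' hKc' hχ fun x hx => interior_subset (hχO hx).1).sub
      (hR.finiteOrder_transport hK hKc hχ (fun x hx => (hχO hx).2.1)
        fun x hx => interior_subset (hχO hx).2.2)
  obtain ⟨θ, hθ, hθ1, hθs⟩ := exists_normed_bump (0 : Eucl d) one_pos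
  have hθs' : ∀ y, θ y ≠ 0 → ‖y‖ ≤ 1 := fun y hy => by
    simpa using hθs (subset_tsupport θ hy)
  obtain ⟨δ, hδ, hδW⟩ := hu.2.isCompact.exists_cthickening_subset_open isOpen_interior huW
  obtain ⟨r', hr'⟩ := hR'.bound
  obtain ⟨C', hC', hb'⟩ := hr' 1 zero_le_one
  obtain ⟨r, hr⟩ := hR.bound
  obtain ⟨E, D, hE, hD, hED⟩ := exists_scaledTest_transportTest hW
    (fun x hx => (hWO hx).2.1 : W ⊆ (transition c' c).source) r
  obtain ⟨C, hC, hb⟩ := hr D hD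
  obtain ⟨A, hA0, hA⟩ := exists_derivBound hθ.1 hθ.2 (max r r')
  have key := hS.eq_zero_of_rescaled_le (C := C' * A + C * (E * A)) (ε₀ := min δ 1) hθ hθ1 hu hγ
    (by positivity) fun z hz ε hε hε' => ?_
  · rw [hχu u (huW.trans interior_subset)] at key
    linarith
  have hball : closedBall z ε ⊆ W := (closedBall_subset_closedBall (hε'.trans (min_le_left _ _))
    ).trans ((closedBall_subset_cthickening hz δ).trans (hδW.trans interior_subset))
  have hε1 : ε ≤ 1 := hε'.trans (min_le_right _ _)
  have hv := scaledTest_rescaled hθ hθs' (hA.mono (le_max_left r r')) hε z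
  have hv' := scaledTest_rescaled hθ hθs' (hA.mono (le_max_right r r')) hε z
  set v := rescaled θ ε z
  have hvW : tsupport v ⊆ W := by
    have := hv.tsupport_subset
    rw [one_mul] at this
    exact this.trans hball
  have hvs : tsupport v ⊆ (transition c' c).source := fun x hx => (hWO (hvW hx)).2.1
  rw [hχu v hvW]
  have hzO := huO hz
  have e1 := hb' z (interior_subset hzO.1) A ε v hε hε1 hv' fun x hx =>
    interior_subset (hWO (hvW hx)).1
  have e2 := hb _ (interior_subset hzO.2.2) _ ε _ hε hε1 (hED A ε z v hε hε1 hball hv) (by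
    refine (tsupport_transportTest_subset hv.isTest.2 hvs).trans ?_
    rintro _ ⟨y, hy, rfl⟩
    exact interior_subset (hWO (hvW hy)).2.2)
  -- The two local germs take the same value, as both read the distribution `F_p` with `φ'(p) = z`.
  have e3 : chartGerm F c' z v = chartGerm F c (transition c' c z) (transportTest c c' v) := by
    rw [chartGerm, chartGerm, symm_transition hzO.2.1]
    exact evalOn_push_transportTest _ hv.isTest hvs
  rw [e3] at e1
  calc |R' v - R (transportTest c c' v)|
      = |(R' v - chartGerm F c (transition c' c z) (transportTest c c' v)) -
          (R (transportTest c c' v) - chartGerm F c (transition c' c z) (transportTest c c' v))| := by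
        congr 1; ring
    _ ≤ _ := abs_sub _ _
    _ ≤ C' * A * ε ^ γ + C * (E * A) * ε ^ γ := add_le_add e1 e2
    _ = _ := by ring

end

end

section

variable {d : ℕ} {M : Type*} [TopologicalSpace M] [ChartedSpace (Eucl d) M]

/-! ### Localization by a partition of unity -/

lemma FiniteOrder.sum {ι : Type*} (s : Finset ι) {T : ι → (Eucl d → ℝ) → ℝ}
    (h : ∀ i ∈ s, FiniteOrder (T i)) : FiniteOrder fun u => ∑ i ∈ s, T i u := by
  classical
  have h0 : FiniteOrder fun _ : Eucl d → ℝ => 0 :=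
    ⟨fun _ _ _ _ => by simp, fun _ _ _ => by simp, 0, 0, le_rfl, fun _ _ _ _ => by simp⟩
  induction s using Finset.induction_on with
  | empty => simpa using h0
  | insert i s hi ih =>
    have := (h i (by simp)).sub (h0.sub (ih fun j hj => h j (by simp [hj])))
    simpa [Finset.sum_insert hi] using this

/-- The product of a function on `ℝ^d` with a function on `M`, read in the chart `c`. -/
def chartMul (c : SmoothChart d M) (u : Eucl d → ℝ) (w : M → ℝ) : Eucl d → ℝ :=
  fun x => u x * w (c.1.symm x)

lemma tsupport_chartMul_subset {c : SmoothChart d M} {u : Eucl d → ℝ} {w : M → ℝ} :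
    tsupport (chartMul c u w) ⊆ tsupport u :=
  closure_mono fun _ hx => left_ne_zero_of_mul hx

lemma symm_mem_tsupport_of_mem_tsupport_chartMul {c : SmoothChart d M} {u : Eucl d → ℝ} {w : M → ℝ}
    {x : Eucl d} (hx : x ∈ tsupport (chartMul c u w)) (hxc : x ∈ c.1.target) :
    c.1.symm x ∈ tsupport w := by
  by_contra h
  have h1 := (c.1.continuousAt_symm hxc).preimage_mem_nhds
    ((isClosed_tsupport w).isOpen_compl.mem_nhds h)
  obtain ⟨y, hy, hy'⟩ := mem_closure_iff_nhds.1 hx _ h1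
  exact hy (subset_tsupport w (right_ne_zero_of_mul hy'))

lemma isTest_chartMul {c : SmoothChart d M} {u : Eucl d → ℝ} {w : M → ℝ} (hu : IsTest u)
    (hs : tsupport u ⊆ c.1.target) (hw : ContMDiff (𝓡 d) 𝓘(ℝ) ∞ w) : IsTest (chartMul c u w) := by
  refine ⟨contDiff_iff_contDiffAt.2 fun x => ?_, hu.2.mul_right⟩
  by_cases hx : x ∈ tsupport u
  · refine hu.1.contDiffAt.mul ?_
    have h1 : ContMDiffOn 𝓘(ℝ, Eucl d) 𝓘(ℝ) ∞ (w ∘ c.1.symm) c.1.target :=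
      hw.comp_contMDiffOn (contMDiffOn_symm_of_mem_maximalAtlas c.2)
    exact (contMDiffOn_iff_contDiffOn.1 h1).contDiffAt (c.1.open_target.mem_nhds (hs hx))
  · exact contDiffAt_const.congr_of_eventuallyEq
      (notMem_tsupport_iff_eventuallyEq.1 fun h => hx (tsupport_chartMul_subset h))

lemma chartMul_mul (c : SmoothChart d M) (u v : Eucl d → ℝ) (w : M → ℝ) :
    chartMul c (v * u) w = chartMul c v w * u := by
  ext x; simp only [chartMul, Pi.mul_apply]; ring

lemma chartMul_eq_zero {c : SmoothChart d M} {u : Eucl d → ℝ} {w : M → ℝ}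
    (h : ∀ x ∈ tsupport u, w (c.1.symm x) = 0) : chartMul c u w = 0 := by
  ext x
  by_cases hx : x ∈ tsupport u
  · simp [chartMul, h x hx]
  · simp [chartMul, image_eq_zero_of_notMem_tsupport hx]

lemma chartMul_transportTest (c c' : SmoothChart d M) (h : Eucl d → ℝ) (w : M → ℝ) :
    chartMul c (transportTest c c' h) w = transportTest c c' (chartMul c' h w) := by
  ext x
  by_cases hx : x ∈ (transition c c').source
  · simp only [chartMul, transportTest_apply hx, symm_transition hx]
    ring
  · simp [chartMul, transportTest_of_notMem hx]

/-- Near a compact subset of a chart, only finitely many members of a partition of unity matter. -/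
lemma exists_finset_chartMul {ι : Type*} (w : SmoothPartitionOfUnity ι (𝓡 d) M)
    {c : SmoothChart d M} {L : Set (Eucl d)} (hL : IsCompact L) (hLc : L ⊆ c.1.target) :
    ∃ s : Finset ι, ∀ u : Eucl d → ℝ, tsupport u ⊆ L →
      (∀ i ∉ s, chartMul c u (w i) = 0) ∧ ∑ i ∈ s, chartMul c u (w i) = u := by
  have hfin := w.locallyFinite.finite_nonempty_inter_compact
    (hL.image_of_continuousOn (c.1.continuousOn_symm.mono hLc))
  refine ⟨hfin.toFinset, fun u hu => ?_⟩
  have h0 : ∀ i ∉ hfin.toFinset, ∀ x ∈ L, w i (c.1.symm x) = 0 := by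
    intro i hi x hx
    by_contra hne
    exact hi (hfin.mem_toFinset.2 ⟨_, hne, mem_image_of_mem _ hx⟩)
  refine ⟨fun i hi => chartMul_eq_zero fun x hx => h0 i hi x (hu hx), ?_⟩
  ext x
  rw [Finset.sum_apply]
  by_cases hx : x ∈ tsupport u
  · have h1 := w.sum_eq_one (mem_univ (c.1.symm x))
    rw [finsum_eq_sum_of_support_subset _ (s := hfin.toFinset) fun i hi => by
      by_contra h; exact hi (h0 i h x (hu hx))] at h1
    simp only [chartMul, ← Finset.mul_sum, h1, mul_one]
  · have := image_eq_zero_of_notMem_tsupport hx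
    simp [chartMul, this]

lemma transportTest_zero (c c' : SmoothChart d M) : transportTest c c' 0 = 0 := by
  simpa using transportTest_smul c c' 0 0

/-- A cover of `M` by charts of the atlas, with local reconstructions of the germ in these charts
and a partition of unity subordinate to the interiors of their domains. -/
structure Patches (A : Set (SmoothChart d M)) (γ : ℝ) (F : M → ManifoldDistribution d M) where
  /-- The chart around a point. -/
  chart : M → SmoothChart d M
  /-- The compact part of the image of the chart on which the germ is reconstructed. -/
  domain : M → Set (Eucl d)
  /-- The local reconstruction. -/
  recon : M → (Eucl d → ℝ) → ℝ
  /-- The partition of unity. -/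
  weight : SmoothPartitionOfUnity M (𝓡 d) M
  chart_mem : ∀ p, chart p ∈ A
  isCompact_domain : ∀ p, IsCompact (domain p)
  domain_subset : ∀ p, domain p ⊆ (chart p).1.target
  reconstructsOn : ∀ p, ReconstructsOn γ (domain p) (chartGerm F (chart p)) (recon p)
  tsupport_weight_subset : ∀ p, tsupport (weight p) ⊆
    (chart p).1.source ∩ (chart p).1 ⁻¹' interior (domain p)

lemma nonempty_patches [T2Space M] [SecondCountableTopology M] [IsManifold (𝓡 d) ∞ M]
    [MeasurableSpace M] [BorelSpace M] {A : Set (SmoothChart d M)} (hA : IsSmoothAtlas A) {γ : ℝ}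
    (hγ : 0 < γ) {F : M → ManifoldDistribution d M} (hF : IsGerm F) (hcoh : IsCoherent A γ F) :
    Nonempty (Patches A γ F) := by
  have : LocallyCompactSpace M := ChartedSpace.locallyCompactSpace (Eucl d) M
  choose a haA hap using hA
  have hK : ∀ p, ∃ K, IsCompact K ∧ {(a p).1 p} ⊆ interior K ∧ K ⊆ (a p).1.target := fun p =>
    exists_compact_between isCompact_singleton (a p).1.open_target
      (singleton_subset_iff.2 ((a p).1.map_source (hap p)))
  choose K hK hpK hKa using hK
  choose R hR using fun p => exists_reconstructsOn_chartGerm hγ hF hcoh (haA p) (hK p) (hKa p)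
  obtain ⟨w, hw⟩ := SmoothPartitionOfUnity.exists_isSubordinate (𝓡 d) (isClosed_univ (X := M))
    (fun p => (a p).1.source ∩ (a p).1 ⁻¹' interior (K p))
    (fun p => (a p).1.isOpen_inter_preimage isOpen_interior)
    (fun p _ => mem_iUnion.2 ⟨p, hap p, hpK p rfl⟩)
  exact ⟨⟨a, K, R, w, haA, hK, hKa, hR, hw⟩⟩

namespace Patches

variable {A : Set (SmoothChart d M)} {γ : ℝ} {F : M → ManifoldDistribution d M} (P : Patches A γ F)
  {c : SmoothChart d M} {u : Eucl d → ℝ}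

lemma isTest_chartMul_weight (hu : IsTest u) (hs : tsupport u ⊆ c.1.target) (p : M) :
    IsTest (chartMul c u (P.weight p)) :=
  isTest_chartMul hu hs (P.weight p).contMDiff

lemma tsupport_chartMul_weight_subset (hs : tsupport u ⊆ c.1.target) (p : M) :
    tsupport (chartMul c u (P.weight p)) ⊆ (transition c (P.chart p)).source := fun x hx => by
  have h1 := hs (tsupport_chartMul_subset hx)
  exact mem_transition_source.2 ⟨h1, (P.tsupport_weight_subset p
    (symm_mem_tsupport_of_mem_tsupport_chartMul hx h1)).1⟩

lemma mapsTo_interior_domain (hs : tsupport u ⊆ c.1.target) (p : M) :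
    MapsTo (transition c (P.chart p)) (tsupport (chartMul c u (P.weight p)))
      (interior (P.domain p)) := fun _ hx =>
  (P.tsupport_weight_subset p
    (symm_mem_tsupport_of_mem_tsupport_chartMul hx (hs (tsupport_chartMul_subset hx)))).2

/-- The global reconstruction in the chart `c`: the local reconstructions, glued by means of the
partition of unity. -/
def glue (c : SmoothChart d M) (u : Eucl d → ℝ) : ℝ :=
  ∑ᶠ p, P.recon p (transportTest (P.chart p) c (chartMul c u (P.weight p)))

lemma exists_glue_eq_sum {L : Set (Eucl d)} (hL : IsCompact L) (hLc : L ⊆ c.1.target) :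
    ∃ s : Finset M, ∀ u : Eucl d → ℝ, tsupport u ⊆ L →
      P.glue c u = ∑ p ∈ s, P.recon p (transportTest (P.chart p) c (chartMul c u (P.weight p))) ∧
        ∑ p ∈ s, chartMul c u (P.weight p) = u := by
  obtain ⟨s, hs⟩ := exists_finset_chartMul P.weight hL hLc
  refine ⟨s, fun u hu => ⟨?_, (hs u hu).2⟩⟩
  refine finsum_eq_sum_of_support_subset _ fun p hp => ?_
  by_contra h
  apply hp
  simp only
  rw [(hs u hu).1 p h, transportTest_zero, (P.reconstructsOn p).map_zero]

lemma exists_finiteOrder_glue {L : Set (Eucl d)} (hL : IsCompact L) (hLc : L ⊆ c.1.target) :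
    ∃ T, FiniteOrder T ∧ ∀ u, tsupport u ⊆ L → P.glue c u = T u := by
  obtain ⟨s, hs⟩ := P.exists_glue_eq_sum hL hLc
  obtain ⟨χ, hχ, hχs, hχ1⟩ := exists_cutoff hL c.1.open_target hLc
  refine ⟨fun u => ∑ p ∈ s, P.recon p (transportTest (P.chart p) c
    (chartMul c χ (P.weight p) * u)), FiniteOrder.sum s fun p _ => ?_, fun u hu => ?_⟩
  · exact (P.reconstructsOn p).finiteOrder_transport (P.isCompact_domain p) (P.domain_subset p)
      (P.isTest_chartMul_weight hχ hχs p) (P.tsupport_chartMul_weight_subset hχs p)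
      ((P.mapsTo_interior_domain hχs p).mono_right interior_subset)
  · rw [(hs u hu).1]
    simp only [← chartMul_mul, mul_eq_of_eq_one_on_tsupport fun x hx => hχ1 x (hu hx)]

lemma exists_distribution_glue (c : SmoothChart d M) :
    ∃ D : 𝓓'(c.image, ℝ), ∀ h : 𝓓(c.image, ℝ), D h = P.glue c h := by
  refine exists_distribution (fun u v hu hus hv hvs => ?_) (fun b u hu hus => ?_)
    fun K hK hKc => ?_
  · obtain ⟨T, hT, h⟩ := P.exists_finiteOrder_glue (hu.2.isCompact.union hv.2.isCompact)
      (union_subset hus hvs)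
    rw [h (u + v) (tsupport_add u v), h u subset_union_left, h v subset_union_right, hT.add hu hv]
  · obtain ⟨T, hT, h⟩ := P.exists_finiteOrder_glue hu.2.isCompact hus
    rw [h (b • u) (tsupport_smul_subset_right (fun _ => b) u), h u subset_rfl, hT.smul b hu]
  · obtain ⟨T, hT, h⟩ := P.exists_finiteOrder_glue hK hKc
    obtain ⟨N, C, hC, hb⟩ := hT.bound
    exact ⟨N, C, hC, fun u B hu hus hB => by rw [h u hus]; exact hb u B hu hB⟩

lemma glue_transportTest {c' : SmoothChart d M} {h : Eucl d → ℝ}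
    (hs : tsupport h ⊆ (transition c' c).source) :
    P.glue c (transportTest c c' h) = P.glue c' h := by
  refine finsum_congr fun p => ?_
  rw [chartMul_transportTest, transportTest_transportTest]
  exact (subset_tsupport _).trans (tsupport_chartMul_subset.trans hs)

lemma exists_manifoldDistribution : ∃ R : ManifoldDistribution d M, ∀ c (h : 𝓓(c.image, ℝ)),
    R.push c h = P.glue c h := by
  choose D hD using P.exists_distribution_glue
  refine ⟨⟨D, fun c c' h g hs hg => ?_⟩, hD⟩
  rw [hD, hD, hg, P.glue_transportTest hs]

/-- The glued distribution agrees with every local reconstruction in every chart. -/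
lemma glue_eq (hγ : 0 < γ) {K : Set (Eucl d)} {Q : (Eucl d → ℝ) → ℝ} (hK : IsCompact K)
    (hKc : K ⊆ c.1.target) (hQ : ReconstructsOn γ K (chartGerm F c) Q) (hu : IsTest u)
    (hus : tsupport u ⊆ interior K) : P.glue c u = Q u := by
  have huc : tsupport u ⊆ c.1.target := hus.trans (interior_subset.trans hKc)
  obtain ⟨s, hs⟩ := P.exists_glue_eq_sum hu.2.isCompact huc
  obtain ⟨χ, hχ, hχs, hχ1⟩ := exists_cutoff hu.2.isCompact isOpen_interior hus
  obtain ⟨e1, e2⟩ := hs u subset_rfl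
  have hT := hQ.finiteOrder_cutoff hK hKc hχ (hχs.trans interior_subset)
  have e3 := hT.sum_apply s (f := fun p => chartMul c u (P.weight p)) fun p _ =>
    P.isTest_chartMul_weight hu huc p
  rw [e2, mul_eq_of_eq_one_on_tsupport hχ1] at e3
  rw [e1, e3]
  refine Finset.sum_congr rfl fun p _ => ?_
  rw [mul_eq_of_eq_one_on_tsupport fun x hx => hχ1 x (tsupport_chartMul_subset hx)]
  exact ((P.reconstructsOn p).eq_transportTest hγ (P.isCompact_domain p) (P.domain_subset p) hQ hK
    hKc (P.isTest_chartMul_weight hu huc p) (tsupport_chartMul_subset.trans hus)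
    (P.tsupport_chartMul_weight_subset huc p) (P.mapsTo_interior_domain huc p)).symm

end Patches

end

section

variable {d : ℕ} {M : Type*} [TopologicalSpace M] [ChartedSpace (Eucl d) M]
  {A : Set (SmoothChart d M)} {γ : ℝ} {F : M → ManifoldDistribution d M}

/-! ### Existence -/

/-- The glued distribution inherits the bound of a local reconstruction on a compact neighbourhood of
`φ(K) ∪ L`, with which it agrees on test functions supported in `L`. -/
lemma Patches.isReconstruction [T2Space M] [MeasurableSpace M] [BorelSpace M] (P : Patches A γ F)
    (hγ : 0 < γ) (hF : IsGerm F) (hcoh : IsCoherent A γ F) {R : ManifoldDistribution d M}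
    (hR : ∀ c (h : 𝓓(c.image, ℝ)), R.push c h = P.glue c h) : IsReconstruction A γ F R := by
  intro c hc K hK hKc h L hL hLc
  have hK₀ : IsCompact (c.1 '' K ∪ L) :=
    (hK.image_of_continuousOn (c.1.continuousOn.mono hKc)).union hL
  have hK₀c : c.1 '' K ∪ L ⊆ c.1.target := by
    refine union_subset ?_ hLc
    rintro _ ⟨p, hp, rfl⟩
    exact c.1.map_source (hKc hp)
  obtain ⟨K', hK', hKK', hKc'⟩ := exists_compact_between hK₀ c.1.open_target hK₀c
  obtain ⟨Q, hQ⟩ := exists_reconstructsOn_chartGerm hγ hF hcoh hc hK' hKc'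
  obtain ⟨ρ, hρ, hhρ⟩ := exists_norm_le_of_hasCompactSupport (isTest_coe h).2
  obtain ⟨r, hr⟩ := hQ.bound
  obtain ⟨C, -, hC⟩ := hr ρ hρ.le
  obtain ⟨B, -, hB⟩ := exists_derivBound (isTest_coe h).1 (isTest_coe h).2 r
  refine ⟨C * B, fun p hp l hl hl1 u hu huL => ?_⟩
  have huK : tsupport u ⊆ interior K' := huL.trans (subset_union_right.trans hKK')
  have h1 := scaledTest_rescaled (isTest_coe h) hhρ hB hl (c.1 p)
  rw [← hu] at h1
  have h2 := hC (c.1 p) (interior_subset (hKK' (Or.inl (mem_image_of_mem _ hp)))) B l u hl hl1 h1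
    (huK.trans interior_subset)
  rw [chartGerm, c.1.left_inv (hKc hp), evalOn_coe] at h2
  rwa [hR, P.glue_eq hγ hK' hKc' hQ (isTest_coe u) huK]

/-! ### Uniqueness -/

/-- Two reconstructions of a germ agree in the charts of the atlas: tested at scale `ε` around a
point, they differ by `O(ε^γ)`. -/
lemma push_eq_push_of_mem (hγ : 0 < γ) {R S : ManifoldDistribution d M}
    (hR : IsReconstruction A γ F R) (hS : IsReconstruction A γ F S) {c : SmoothChart d M}
    (hc : c ∈ A) (u : 𝓓(c.image, ℝ)) : R.push c u = S.push c u := by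
  have hu := isTest_coe u
  have hus : tsupport u ⊆ c.1.target := u.tsupport_subset
  rcases (tsupport u).eq_empty_or_nonempty with h0 | ⟨x₀, hx₀⟩
  · have : u = 0 := by
      ext x
      rw [tsupport_eq_empty_iff.1 h0]
      rfl
    rw [this, map_zero, map_zero]
  obtain ⟨W, hW, huW, hWc⟩ := exists_compact_between hu.2.isCompact c.1.open_target hus
  obtain ⟨χ, hχ, hχs, hχ1⟩ := exists_cutoff hW c.1.open_target hWc
  have hχv : ∀ v : Eucl d → ℝ, tsupport v ⊆ W → χ * v = v := fun v hv =>
    mul_eq_of_eq_one_on_tsupport fun x hx => hχ1 x (hv hx)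
  -- The profile has to be a test function on the image of the chart itself.
  obtain ⟨r, hr, hrc⟩ := nhds_basis_closedBall.mem_iff.1 (c.1.open_target.mem_nhds (hus hx₀))
  obtain ⟨θ, hθ, hθ1, hθs⟩ := exists_normed_bump x₀ hr
  obtain ⟨ρ, hρ, hθρ⟩ := exists_norm_le_of_hasCompactSupport hθ.2
  obtain ⟨δ, hδ, hδW⟩ := hu.2.isCompact.exists_cthickening_subset_open isOpen_interior huW
  set K := c.1.symm '' tsupport u
  have hK : IsCompact K := hu.2.isCompact.image_of_continuousOn (c.1.continuousOn_symm.mono hus)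
  have hKc : K ⊆ c.1.source := by
    rintro _ ⟨y, hy, rfl⟩
    exact c.1.map_target (hus hy)
  obtain ⟨C, hC⟩ := hR c hc K hK hKc ⟨θ, hθ.1, hθ.2, hθs.trans hrc⟩ W hW hWc
  obtain ⟨C', hC'⟩ := hS c hc K hK hKc ⟨θ, hθ.1, hθ.2, hθs.trans hrc⟩ W hW hWc
  have key := ((finiteOrder_cutoff (R.push c) hχ hχs).sub
    (finiteOrder_cutoff (S.push c) hχ hχs)).eq_zero_of_rescaled_le (C := C + C')
    (ε₀ := min (δ / ρ) 1) hθ hθ1 hu hγ (by positivity) fun z hz ε hε hε' => ?_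
  · rw [hχv u (huW.trans interior_subset), evalOn_coe, evalOn_coe] at key
    linarith
  have hvW : tsupport (rescaled θ ε z) ⊆ W := by
    refine (tsupport_rescaled_subset hθρ hε z).trans ((closedBall_subset_closedBall ?_).trans
      ((closedBall_subset_cthickening hz δ).trans (hδW.trans interior_subset)))
    rw [← le_div_iff₀' hρ]
    exact hε'.trans (min_le_left _ _)
  have hv := hθ.rescale hε z
  have hε1 : ε ≤ 1 := hε'.trans (min_le_right _ _)
  set v : 𝓓(c.image, ℝ) := ⟨rescaled θ ε z, hv.1, hv.2, hvW.trans hWc⟩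
  have e : (v : Eucl d → ℝ) = rescaled θ ε (c.1 (c.1.symm z)) := by
    rw [c.1.right_inv (hus hz)]; rfl
  have h1 := hC _ (mem_image_of_mem _ hz) ε hε hε1 v e hvW
  have h2 := hC' _ (mem_image_of_mem _ hz) ε hε hε1 v e hvW
  have e1 : ∀ T : 𝓓'(c.image, ℝ), evalOn T (χ * rescaled θ ε z) = T v := fun T => by
    rw [hχv _ hvW]
    exact evalOn_coe T v
  rw [e1, e1, add_mul]
  refine le_trans ?_ (add_le_add h1 h2)
  rw [abs_sub_comm (S.push c v)]
  exact abs_sub_le _ _ _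

/-- Two reconstructions agree in arbitrary charts: a test function is a finite sum of test functions
that can be transported to charts of the atlas. -/
lemma Patches.push_eq_push (P : Patches A γ F) (hγ : 0 < γ) {R S : ManifoldDistribution d M}
    (hR : IsReconstruction A γ F R) (hS : IsReconstruction A γ F S) (c : SmoothChart d M)
    (u : 𝓓(c.image, ℝ)) : R.push c u = S.push c u := by
  have hu := isTest_coe u
  have hus : tsupport u ⊆ c.1.target := u.tsupport_subset
  obtain ⟨s, hs⟩ := P.exists_glue_eq_sum hu.2.isCompact hus
  obtain ⟨χ, hχ, hχs, hχ1⟩ := exists_cutoff hu.2.isCompact c.1.open_target hus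
  have e : ∀ T : ManifoldDistribution d M, T.push c u = ∑ p ∈ s, evalOn (T.push (P.chart p))
      (transportTest (P.chart p) c (chartMul c u (P.weight p))) := by
    intro T
    have h := (finiteOrder_cutoff (T.push c) hχ hχs).sum_apply s
      (f := fun p => chartMul c u (P.weight p)) fun p _ => P.isTest_chartMul_weight hu hus p
    rw [(hs u subset_rfl).2, mul_eq_of_eq_one_on_tsupport hχ1, evalOn_coe] at h
    rw [h]
    refine Finset.sum_congr rfl fun p _ => ?_
    rw [mul_eq_of_eq_one_on_tsupport fun x hx => hχ1 x (tsupport_chartMul_subset hx)]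
    exact evalOn_push_transportTest T (P.isTest_chartMul_weight hu hus p)
      (P.tsupport_chartMul_weight_subset hus p)
  rw [e, e]
  refine Finset.sum_congr rfl fun p _ => ?_
  have ht := isTest_transportTest (P.isTest_chartMul_weight hu hus p)
    (P.tsupport_chartMul_weight_subset hus p)
  have hts : tsupport (transportTest (P.chart p) c (chartMul c u (P.weight p))) ⊆
      (P.chart p).image :=
    (tsupport_transportTest_subset (P.isTest_chartMul_weight hu hus p).2
      (P.tsupport_chartMul_weight_subset hus p)).trans
      ((P.mapsTo_interior_domain hus p).image_subset.trans
        (interior_subset.trans (P.domain_subset p)))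
  rw [evalOn_eq _ ht hts, evalOn_eq _ ht hts]
  exact push_eq_push_of_mem hγ hR hS (P.chart_mem p) _

end

end

end GermReconstruction

theorem theorem3p1 (d : ℕ) {M : Type*} [TopologicalSpace M] [T2Space M]
    [SecondCountableTopology M] [ChartedSpace (Eucl d) M] [IsManifold (𝓡 d) ∞ M]
    [MeasurableSpace M] [BorelSpace M]
    (A : Set (SmoothChart d M)) (hA : IsSmoothAtlas A)
    (γ : ℝ) (hγ : 0 < γ)
    (F : M → ManifoldDistribution d M) (hF : IsGerm F) (hcoh : IsCoherent A γ F) :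
    ∃! R : ManifoldDistribution d M, IsReconstruction A γ F R := by
  obtain ⟨P⟩ := GermReconstruction.nonempty_patches hA hγ hF hcoh
  obtain ⟨R, hR⟩ := P.exists_manifoldDistribution
  have hrec := P.isReconstruction hγ hF hcoh hR
  refine ⟨R, hrec, fun S hS => ?_⟩
  have hpush : S.push = R.push := by
    funext c
    exact DFunLike.ext _ _ fun u => P.push_eq_push hγ hS hrec c u
  cases S
  cases R
  congr
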